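/- Let $F$ be an arbitrary field and let $(S,n)$ be a nonsingular quadratic space of dimension $8$ over $F$ (nonsingular means that the polar form $b_n(x,y)=n(x+y)-n(x)-n(y)$ has radical $\{0\}$). Let $\star$ be a symmetric composition on $(S,n)$, i.e. an $F$-bilinear map $\star\colon S\times S\to S$ for which there is $\lambda_\star\in F^\times$ with $n(x\star y)=\lambda_\star n(x)n(y)$, and such that $b_n(x\star y,z)=b_n(x,y\star z)$, for all $x,y,z\in S$. Let $\mathbf{GO}(n)$ be the group scheme over $F$ of similarities of $(S,n)$. A similarity $f$ with multiplier $\mu(f)$ induces an automorphism $C_0(f)$ of the even Clifford algebra $C_0(S,n)$ with $C_0(f)(xy)=\mu(f)^{-1}f(x)f(y)$ for $x,y\in S$. Let $\mathbf{GO}^+(n)\subset\mathbf{GO}(n)$ be the subgroup of proper similarities, those for which $C_0(f)$ is the identity on the center of $C_0(S,n)$; let $\mathbf{PGO}^+(n)=\mathbf{GO}^+(n)/\mathbf{G}_m$, viewed as a group of automorphisms of $\operatorname{End}_F S$ through $[f]=\operatorname{Int}[f]\colon\varphi\mapsto f\varphi f^{-1}$; and let $\phi\colon\mathbf{GO}^+(n)\to\mathbf{PGO}^+(n)$,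 $f\mapsto[f]$, be the canonical map. For $x\in S$ let $\ell_x(y)=x\star y$ and $r_x(y)=y\star x$, and let $\alpha_0\colon C_0(S,n)\to(\operatorname{End}_FS)\times(\operatorname{End}_FS)$ be the algebra homomorphism with $\alpha_0(xy)=(\lambda_\star^{-1}r_x\ell_y,\lambda_\star^{-1}\ell_xr_y)$ for $x,y\in S$. There is exactly one automorphism $\rho_\star$ of the group scheme $\mathbf{PGO}^+(n)$ with the following property: for every commutative $F$-algebra $A$ and every $\theta\in\mathbf{PGO}^+(n)(A)$ there are a faithfully flat commutative $A$-algebra $B$ and $f,g,h\in\mathbf{GO}^+(n)(B)$ such that, over $B$, $\theta=[f]$, $\rho_\star(\theta)=[g]$ and $\alpha_0\circ C_0(f)=(\operatorname{Int}[g]\times\operatorname{Int}[h])\circ\alpha_0$. Let $\mathbf{Aut}(\star)$ be the group scheme over $F$ of similarities $f$ of $(S,n)$ such that $f(x\star y)=f(x)\star f(y)$ for all $x,y$. Then $\mathbf{Aut}(\star)\subset\mathbf{GO}^+(n)$, and $\phi$ induces an isomorphism of group schemes from $\mathbf{Aut}(\star)$ onto the subgroup $\mathbf{PGO}^+(n)^{\rho_\star}$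 of $\mathbf{PGO}^+(n)$ fixed under $\rho_\star$. -/

import Mathlib

open CategoryTheory TensorProduct

noncomputable section

namespace Triality

universe u v w w'

/-! ### Subgroups of group functors -/

section SubgroupFunctor

variable {C : Type w} [Category.{w'} C]

/-- A subgroup of a group-valued functor `G`: a family of subgroups of the groups `G(A)`,
stable under the maps `G(A) → G(B)`. -/
structure SubgroupFunctor (G : C ⥤ GrpCat.{v}) where
  sub : ∀ A : C, Subgroup (G.obj A)
  map_mem : ∀ {A B : C} (φ : A ⟶ B) (x : G.obj A), x ∈ sub A → G.map φ x ∈ sub B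

/-- The group functor underlying a subgroup of a group functor. -/
def SubgroupFunctor.toFunctor {G : C ⥤ GrpCat.{v}} (H : SubgroupFunctor G) : C ⥤ GrpCat.{v} where
  obj A := GrpCat.of (H.sub A)
  map {A B} φ := GrpCat.ofHom
    (((G.map φ).hom.comp (H.sub A).subtype).codRestrict (H.sub B)
      (fun x => H.map_mem φ x.1 x.2))
  map_id A := by
    ext x
    change G.map (𝟙 A) x.1 = x.1
    rw [G.map_id]
    rfl
  map_comp φ ψ := by
    ext x
    change G.map (φ ≫ ψ) x.1 = G.map ψ (G.map φ x.1)
    rw [G.map_comp]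
    rfl

/-- The inclusion of a subgroup of a group functor. -/
def SubgroupFunctor.incl {G : C ⥤ GrpCat.{v}} (H : SubgroupFunctor G) : H.toFunctor ⟶ G where
  app A := GrpCat.ofHom (H.sub A).subtype
  naturality _ _ _ := rfl

/-- The subgroup of the elements of `G` that are fixed under an automorphism `ρ` of `G`. -/
def fixedPoints {G : C ⥤ GrpCat.{v}} (ρ : G ≅ G) : SubgroupFunctor G where
  sub A :=
    { carrier := {x | ρ.hom.app A x = x}
      one_mem' := map_one _
      mul_mem' := by
        intro a b ha hb
        simp only [Set.mem_ofPred_eq, map_mul] at *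
        rw [ha, hb]
      inv_mem' := by
        intro a ha
        simp only [Set.mem_ofPred_eq, map_inv] at *
        rw [ha] }
  map_mem {A B} φ x hx := by
    change ρ.hom.app B (G.map φ x) = G.map φ x
    have hx' : ρ.hom.app A x = x := hx
    rw [NatTrans.naturality_apply, hx']

end SubgroupFunctor

/-! ### Scalar extension of quadratic forms, linear and bilinear maps

For a commutative `F`-algebra `A`, the extended space `S_A` is `A ⊗[F] S`. -/

section BaseChange

variable {F : Type u} [Field F] {S : Type v} [AddCommGroup S] [Module F S]
variable (A : Type w) [CommRing A] [Algebra F A]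
variable {B : Type w'} [CommRing B] [Algebra F B]

section

variable {A}

/-- The map `S_A → S_B` induced by `φ : A → B`. -/
def extVec (φ : A →ₐ[F] B) : A ⊗[F] S →ₗ[F] B ⊗[F] S := φ.toLinearMap.rTensor S

/-- The map `E_A → E_B` induced by `φ : A → B`, for an `F`-algebra `E`. -/
def extAlg (E : Type v) [Ring E] [Algebra F E] (φ : A →ₐ[F] B) : A ⊗[F] E →ₐ[F] B ⊗[F] E :=
  Algebra.TensorProduct.map φ (AlgHom.id F E)

theorem extVec_smul (φ : A →ₐ[F] B) (a : A) (X : A ⊗[F] S) :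
    extVec φ (a • X) = φ a • extVec φ X := by
  induction X with
  | zero => simp
  | add X Y hX hY => simp only [smul_add, map_add, hX, hY]
  | tmul b x => simp [extVec, smul_tmul']

end

/-- The extension of a quadratic form to `A ⊗[F] S`, in arbitrary characteristic. It is the unique
quadratic form over `A` with `a ⊗ x ↦ a ^ 2 * n x`. -/
def extForm [FiniteDimensional F S] (n : QuadraticForm F S) : QuadraticForm A (A ⊗[F] S) :=
  (LinearMap.BilinForm.baseChange A (n.toBilin (Module.finBasis F S))).toQuadraticMap

variable [FiniteDimensional F S] (n : QuadraticForm F S)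

theorem extForm_tmul (a : A) (x : S) : extForm A n (a ⊗ₜ x) = a * a * algebraMap F A (n x) := by
  have h : n.toBilin (Module.finBasis F S) x x = n x := by
    conv_rhs => rw [← n.toQuadraticMap_toBilin (Module.finBasis F S)]
    rfl
  rw [extForm, LinearMap.BilinMap.toQuadraticMap_apply, LinearMap.BilinForm.baseChange_tmul, h,
    Algebra.smul_def, mul_comm]

theorem polar_extForm_tmul (a b : A) (x y : S) :
    QuadraticMap.polar (extForm A n) (a ⊗ₜ x) (b ⊗ₜ y) =
      a * b * algebraMap F A (QuadraticMap.polar n x y) := by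
  have h (z t : S) : QuadraticMap.polar n z t = n.toBilin (Module.finBasis F S) z t +
      n.toBilin (Module.finBasis F S) t z := by
    conv_lhs => rw [← n.toQuadraticMap_toBilin (Module.finBasis F S)]
    exact LinearMap.BilinMap.polar_toQuadraticMap _ _
  rw [extForm, LinearMap.BilinMap.polar_toQuadraticMap, LinearMap.BilinForm.baseChange_tmul,
    LinearMap.BilinForm.baseChange_tmul, h, map_add, Algebra.smul_def, Algebra.smul_def]
  ring

variable {A}

theorem extForm_extVec (φ : A →ₐ[F] B) (X : A ⊗[F] S) :
    extForm B n (extVec φ X) = φ (extForm A n X) := by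
  have hpol (X Y : A ⊗[F] S) : QuadraticMap.polar (extForm B n) (extVec φ X) (extVec φ Y) =
      φ (QuadraticMap.polar (extForm A n) X Y) := by
    induction X with
    | zero => simp
    | add X X' hX hX' => simp only [map_add, QuadraticMap.polar_add_left, hX, hX']
    | tmul a x =>
      induction Y with
      | zero => simp
      | add Y Y' hY hY' => simp only [map_add, QuadraticMap.polar_add_right, hY, hY']
      | tmul b y => simp [extVec, polar_extForm_tmul]
  induction X with
  | zero => simp
  | add X Y hX hY =>
    rw [map_add, QuadraticMap.map_add (extForm B n), QuadraticMap.map_add (extForm A n), hX, hY,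
      hpol, map_add, map_add]
  | tmul a x => simp [extVec, extForm_tmul]

/-- If `p(x) q(x) = c n(x)` for all `x` in `S`, then the same holds on `S_A`. -/
theorem baseChange_mul_baseChange {E : Type v} [Ring E] [Algebra F E] (p q : S →ₗ[F] E) (c : F)
    (h : ∀ x, p x * q x = algebraMap F E (c * n x)) (X : A ⊗[F] S) :
    p.baseChange A X * q.baseChange A X =
      algebraMap A (A ⊗[F] E) (algebraMap F A c * extForm A n X) := by
  have hp (x y : S) : p x * q y + p y * q x = algebraMap F E (c * QuadraticMap.polar n x y) := by
    have h1 := h (x + y)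
    rw [QuadraticMap.map_add n] at h1
    simp only [map_add, mul_add, add_mul, h] at h1
    linear_combination (norm := noncomm_ring) h1
  have halg (b : A) (r : F) : b ⊗ₜ[F] algebraMap F E r =
      algebraMap A (A ⊗[F] E) (b * algebraMap F A r) := by
    rw [Algebra.TensorProduct.algebraMap_apply, Algebra.algebraMap_eq_smul_one r, ← smul_tmul,
      Algebra.smul_def, mul_comm]
    rfl
  have hpol (X Y : A ⊗[F] S) : p.baseChange A X * q.baseChange A Y +
      p.baseChange A Y * q.baseChange A X =
        algebraMap A (A ⊗[F] E) (algebraMap F A c * QuadraticMap.polar (extForm A n) X Y) := by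
    induction X with
    | zero => simp
    | add X X' hX hX' =>
      simp only [map_add, QuadraticMap.polar_add_left, mul_add, add_mul] at *
      rw [← hX, ← hX']
      abel
    | tmul a x =>
      induction Y with
      | zero => simp
      | add Y Y' hY hY' =>
        simp only [map_add, QuadraticMap.polar_add_right, mul_add, add_mul] at *
        rw [← hY, ← hY']
        abel
      | tmul b y =>
        rw [LinearMap.baseChange_tmul, LinearMap.baseChange_tmul, LinearMap.baseChange_tmul,
          LinearMap.baseChange_tmul, Algebra.TensorProduct.tmul_mul_tmul,
          Algebra.TensorProduct.tmul_mul_tmul, mul_comm b a, ← tmul_add, hp, halg,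
          polar_extForm_tmul, map_mul (algebraMap F A)]
        congr 1
        ring
  induction X with
  | zero => simp
  | add X Y hX hY =>
    have h2 := hpol X Y
    rw [QuadraticMap.map_add (extForm A n)]
    simp only [map_add, mul_add, add_mul] at *
    rw [← hX, ← hY, ← h2]
    abel
  | tmul a x =>
    rw [LinearMap.baseChange_tmul, LinearMap.baseChange_tmul, Algebra.TensorProduct.tmul_mul_tmul,
      h, halg, extForm_tmul, map_mul (algebraMap F A)]
    congr 1
    ring

end BaseChange

/-! ### The group schemes `GL(S)` and `Aut(E)` -/

section Ambient

variable (F : Type u) [Field F]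

/-- The group scheme `GL(S)`, with `GL(S)(A)` the group of units of `A ⊗ End_F S = End_A(S_A)`. -/
def GLFunctor (S : Type v) [AddCommGroup S] [Module F S] :
    CommAlgCat.{u} F ⥤ GrpCat.{max u v} where
  obj A := GrpCat.of (A ⊗[F] Module.End F S)ˣ
  map φ := GrpCat.ofHom (Units.map (MonoidHomClass.toMonoidHom (extAlg (Module.End F S) φ.hom)))
  map_id A := by
    ext f
    change extAlg (Module.End F S) (AlgHom.id F A) f.1 = f.1
    rw [extAlg, Algebra.TensorProduct.map_id]
    rfl
  map_comp {A B D} φ ψ := by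
    ext f
    change extAlg (Module.End F S) (ψ.hom.comp φ.hom) f.1 =
      extAlg (Module.End F S) ψ.hom (extAlg (Module.End F S) φ.hom f.1)
    have : extAlg (Module.End F S) (ψ.hom.comp φ.hom) =
        (extAlg (Module.End F S) ψ.hom).comp (extAlg (Module.End F S) φ.hom) := by
      ext <;> simp [extAlg]
    rw [this]
    rfl

variable {F} (E : Type v) [Ring E] [Algebra F E]
variable {A : Type w} [CommRing A] [Algebra F A] {B : Type w'} [CommRing B] [Algebra F B]

/-- The extension to `B` of an endomorphism `θ` of the `A`-algebra `A ⊗ E`, along `φ : A → B`. -/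
def extEnd (φ : A →ₐ[F] B) (θ : A ⊗[F] E →ₐ[A] A ⊗[F] E) : B ⊗[F] E →ₐ[B] B ⊗[F] E :=
  Algebra.TensorProduct.lift (Algebra.ofId B (B ⊗[F] E))
    (((extAlg E φ).comp (θ.restrictScalars F)).comp Algebra.TensorProduct.includeRight)
    (fun b _ => Algebra.commutes b _)

theorem extEnd_extAlg (φ : A →ₐ[F] B) (θ : A ⊗[F] E →ₐ[A] A ⊗[F] E) (x : A ⊗[F] E) :
    extEnd E φ θ (extAlg E φ x) = extAlg E φ (θ x) := by
  induction x with
  | zero => simp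
  | add x y hx hy => simp only [map_add, hx, hy]
  | tmul a e =>
    have h : a ⊗ₜ[F] e = algebraMap A (A ⊗[F] E) a * (1 ⊗ₜ e) := by
      simp [Algebra.TensorProduct.algebraMap_apply]
    have h1 : extAlg E φ (algebraMap A (A ⊗[F] E) a) = algebraMap B (B ⊗[F] E) (φ a) := by
      simp [extAlg, Algebra.TensorProduct.algebraMap_apply]
    have h2 : extEnd E φ θ (extAlg E φ (1 ⊗ₜ e)) = extAlg E φ (θ (1 ⊗ₜ e)) := by
      have h3 : extAlg E φ (1 ⊗ₜ e) = 1 ⊗ₜ e := by simp [extAlg]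
      rw [h3]
      refine (Algebra.TensorProduct.lift_tmul _ _ _ _ _).trans ?_
      rw [map_one, one_mul]
      rfl
    rw [h, map_mul θ, AlgHom.commutes, map_mul (extAlg E φ), map_mul (extAlg E φ), map_mul, h1, h2,
      AlgHom.commutes]

theorem extEnd_unique (φ : A →ₐ[F] B) (θ : A ⊗[F] E →ₐ[A] A ⊗[F] E)
    (η : B ⊗[F] E →ₐ[B] B ⊗[F] E) (h : ∀ x, η (extAlg E φ x) = extAlg E φ (θ x)) :
    η = extEnd E φ θ := by
  refine Algebra.TensorProduct.ext (Algebra.ext_id _ _ _) (AlgHom.ext fun e => ?_)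
  have h1 : extAlg E φ (1 ⊗ₜ e) = 1 ⊗ₜ e := by simp [extAlg]
  have h2 := h (1 ⊗ₜ e)
  rw [← extEnd_extAlg, h1] at h2
  exact h2

/-- The extension to `B` of automorphisms of the `A`-algebra `A ⊗ E`, along `φ : A → B`. -/
def extAut (φ : A →ₐ[F] B) : (A ⊗[F] E ≃ₐ[A] A ⊗[F] E) →* (B ⊗[F] E ≃ₐ[B] B ⊗[F] E) where
  toFun θ := AlgEquiv.ofAlgHom (extEnd E φ θ) (extEnd E φ θ.symm)
    (by
      rw [extEnd_unique E φ (AlgHom.id A _) (AlgHom.id B _) (fun _ => rfl)]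
      refine extEnd_unique E φ _ _ fun x => ?_
      simp [extEnd_extAlg])
    (by
      rw [extEnd_unique E φ (AlgHom.id A _) (AlgHom.id B _) (fun _ => rfl)]
      refine extEnd_unique E φ _ _ fun x => ?_
      simp [extEnd_extAlg])
  map_one' := by
    refine AlgEquiv.coe_toAlgHom_injective ?_
    exact (extEnd_unique E φ _ (AlgHom.id B _) (fun _ => rfl)).symm
  map_mul' θ η := by
    refine AlgEquiv.coe_toAlgHom_injective ?_
    refine (extEnd_unique E φ _ ((extEnd E φ θ).comp (extEnd E φ η)) fun x => ?_).symm
    simp [extEnd_extAlg]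

theorem extAut_extAlg (φ : A →ₐ[F] B) (θ : A ⊗[F] E ≃ₐ[A] A ⊗[F] E) (x : A ⊗[F] E) :
    extAut E φ θ (extAlg E φ x) = extAlg E φ (θ x) :=
  extEnd_extAlg E φ _ x

theorem extAut_unique (φ : A →ₐ[F] B) (θ : A ⊗[F] E ≃ₐ[A] A ⊗[F] E)
    (η : B ⊗[F] E ≃ₐ[B] B ⊗[F] E) (h : ∀ x, η (extAlg E φ x) = extAlg E φ (θ x)) :
    η = extAut E φ θ :=
  AlgEquiv.coe_toAlgHom_injective (extEnd_unique E φ θ η h)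

variable (F) in
/-- The automorphism group scheme of an `F`-algebra `E`: `Aut(E)(A) = Aut_A(A ⊗ E)`. -/
def AutAlgFunctor : CommAlgCat.{u} F ⥤ GrpCat.{max u v} where
  obj A := GrpCat.of (A ⊗[F] E ≃ₐ[A] A ⊗[F] E)
  map φ := GrpCat.ofHom (extAut E φ.hom)
  map_id A := by
    ext θ : 2
    refine (extAut_unique E (AlgHom.id F A) θ θ fun x => ?_).symm
    simp [extAlg]
  map_comp {A B D} φ ψ := by
    ext θ : 2
    refine (extAut_unique E (ψ.hom.comp φ.hom) θ (extAut E ψ.hom (extAut E φ.hom θ))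
      fun x => ?_).symm
    have h (x) : extAlg E (ψ.hom.comp φ.hom) x = extAlg E ψ.hom (extAlg E φ.hom x) := by
      have : extAlg E (ψ.hom.comp φ.hom) = (extAlg E ψ.hom).comp (extAlg E φ.hom) := by
        ext <;> simp [extAlg]
      rw [this]
      rfl
    rw [h, h, extAut_extAlg, extAut_extAlg]

/-- The inner automorphism `x ↦ u x u⁻¹` of an `A`-algebra. -/
def innerAut (A : Type w) [CommRing A] (R : Type w') [Ring R] [Algebra A R] :
    Rˣ →* (R ≃ₐ[A] R) where
  toFun u :=
    { toFun := fun x => u * x * (u⁻¹ : Rˣ)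
      invFun := fun x => (u⁻¹ : Rˣ) * x * u
      left_inv := fun x => by simp [mul_assoc]
      right_inv := fun x => by simp [mul_assoc]
      map_mul' := fun x y => by simp [mul_assoc]
      map_add' := fun x y => by simp [mul_add, add_mul]
      commutes' := fun a => by rw [← Algebra.commutes, mul_assoc, Units.mul_inv, mul_one] }
  map_one' := by ext x; simp
  map_mul' u v := by
    ext x
    simp only [AlgEquiv.coe_mk, Equiv.coe_fn_mk, AlgEquiv.mul_apply, mul_inv_rev, Units.val_mul,
      mul_assoc]

end Ambient

/-! ### Similarities and proper similarities -/

section EvenClifford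

variable {R : Type u} [CommRing R] {M : Type v} [AddCommGroup M] [Module R M]

/-- The endomorphism `C₀(f)` of the even Clifford algebra of `(M, Q)` induced by a similarity `f`
with multiplier `μ`: it satisfies `C₀(f)(xy) = μ⁻¹ f(x) f(y)` for `x, y` in `M`. -/
def evenSimilarity (Q : QuadraticForm R M) (f : M →ₗ[R] M) (μ : Rˣ)
    (hf : ∀ x, Q (f x) = μ * Q x) : CliffordAlgebra.even Q →ₐ[R] CliffordAlgebra.even Q :=
  CliffordAlgebra.even.lift Q
    { bilin := (μ⁻¹ : Rˣ).1 • (CliffordAlgebra.even.ι Q).bilin.compl₁₂ f f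
      contract := fun m => by
        simp [(CliffordAlgebra.even.ι Q).contract, hf, Algebra.smul_def, ← mul_assoc, ← map_mul]
      contract_mid := fun x y z => by
        simp only [LinearMap.smul_apply, LinearMap.compl₁₂_apply, smul_mul_smul_comm,
          (CliffordAlgebra.even.ι Q).contract_mid, hf, smul_smul]
        congr 1
        rw [mul_assoc, ← mul_assoc _ (μ : R), Units.inv_mul, one_mul, mul_comm] }

theorem evenSimilarity_ι (Q : QuadraticForm R M) (f : M →ₗ[R] M) (μ : Rˣ)
    (hf : ∀ x, Q (f x) = μ * Q x) (x y : M) :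
    evenSimilarity Q f μ hf ((CliffordAlgebra.even.ι Q).bilin x y) =
      (μ⁻¹ : Rˣ).1 • (CliffordAlgebra.even.ι Q).bilin (f x) (f y) :=
  CliffordAlgebra.even.lift_ι Q _ x y

end EvenClifford

section Similarities

variable {F : Type u} [Field F] {S : Type v} [AddCommGroup S] [Module F S]
variable {A : Type w} [CommRing A] [Algebra F A] {B : Type w'} [CommRing B] [Algebra F B]

/-- The endomorphism of `S_A` given by an element of `A ⊗ End_F S = End_A(S_A)`. -/
def act (f : A ⊗[F] Module.End F S) : A ⊗[F] S →ₗ[A] A ⊗[F] S :=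
  LinearMap.tensorProductEnd F A S f

theorem act_tmul (a b : A) (e : Module.End F S) (x : S) :
    act (a ⊗ₜ e) (b ⊗ₜ[F] x) = (a * b) ⊗ₜ e x := by
  simp [act, LinearMap.tensorProductEnd, LinearMap.tensorProduct, smul_tmul']

theorem act_one (X : A ⊗[F] S) : act (1 : A ⊗[F] Module.End F S) X = X := by
  rw [act, map_one]
  rfl

theorem act_mul (f g : A ⊗[F] Module.End F S) (X : A ⊗[F] S) :
    act (f * g) X = act f (act g X) := by
  rw [act, map_mul]
  rfl

theorem act_extAlg (φ : A →ₐ[F] B) (f : A ⊗[F] Module.End F S) (X : A ⊗[F] S) :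
    act (extAlg _ φ f) (extVec φ X) = extVec φ (act f X) := by
  induction f with
  | zero => simp [act]
  | add f g hf hg =>
    simp only [act, map_add, LinearMap.add_apply] at *
    rw [hf, hg]
  | tmul a e =>
    induction X with
    | zero => simp
    | add X Y hX hY => simp only [map_add, hX, hY]
    | tmul b x => rw [act_tmul]; simp [extAlg, extVec, act_tmul]

variable [FiniteDimensional F S] (n : QuadraticForm F S)

/-- The map `C₀(S, n) → C₀(S_A, n_A)` induced by `x ↦ 1 ⊗ x`. -/
def evenExt (A : Type w) [CommRing A] [Algebra F A] :
    CliffordAlgebra.even n →ₐ[F] CliffordAlgebra.even (extForm A n) :=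
  have h (c : F) (x : S) : (1 : A) ⊗ₜ[F] (c • x) = algebraMap F A c • ((1 : A) ⊗ₜ[F] x) := by
    rw [algebraMap_smul, tmul_smul]
  CliffordAlgebra.even.lift n
    { bilin := LinearMap.mk₂ F
        (fun x y => (CliffordAlgebra.even.ι (extForm A n)).bilin (1 ⊗ₜ x) (1 ⊗ₜ y))
        (fun x x' y => by simp [tmul_add])
        (fun c x y => by
          rw [h c x, LinearMap.map_smul₂, algebraMap_smul])
        (fun x y y' => by simp [tmul_add])
        (fun c x y => by
          rw [h c y, map_smul, algebraMap_smul])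
      contract := fun x => by
        rw [LinearMap.mk₂_apply, (CliffordAlgebra.even.ι (extForm A n)).contract, extForm_tmul,
          mul_one, one_mul, ← IsScalarTower.algebraMap_apply]
      contract_mid := fun x y z => by
        simp only [LinearMap.mk₂_apply]
        rw [(CliffordAlgebra.even.ι (extForm A n)).contract_mid, extForm_tmul, mul_one, one_mul,
          algebraMap_smul] }

theorem evenExt_ι (A : Type w) [CommRing A] [Algebra F A] (x y : S) :
    evenExt n A ((CliffordAlgebra.even.ι n).bilin x y) =
      (CliffordAlgebra.even.ι (extForm A n)).bilin (1 ⊗ₜ x) (1 ⊗ₜ y) :=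
  CliffordAlgebra.even.lift_ι _ _ x y

/-- The map `C₀(S_A, n_A) → C₀(S_B, n_B)` induced by `φ : A → B`. -/
theorem exists_evenMap (φ : A →ₐ[F] B) :
    ∃ T : CliffordAlgebra.even (extForm A n) →+* CliffordAlgebra.even (extForm B n),
      (∀ (a : A) z, T (a • z) = φ a • T z) ∧
      ∀ X Y, T ((CliffordAlgebra.even.ι (extForm A n)).bilin X Y) =
        (CliffordAlgebra.even.ι (extForm B n)).bilin (extVec φ X) (extVec φ Y) := by
  let _ : Algebra A (CliffordAlgebra.even (extForm B n)) :=
    Algebra.compHom _ (φ : A →+* B)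
  let T : CliffordAlgebra.even (extForm A n) →ₐ[A] CliffordAlgebra.even (extForm B n) :=
    CliffordAlgebra.even.lift (extForm A n)
      { bilin := LinearMap.mk₂ A
          (fun X Y => (CliffordAlgebra.even.ι (extForm B n)).bilin (extVec φ X) (extVec φ Y))
          (fun X X' Y => by simp)
          (fun c X Y => by
            rw [extVec_smul, map_smul]
            rfl)
          (fun X Y Y' => by simp)
          (fun c X Y => by
            rw [extVec_smul, map_smul]
            rfl)
        contract := fun X => by
          rw [LinearMap.mk₂_apply, (CliffordAlgebra.even.ι (extForm B n)).contract,
            extForm_extVec]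
          rfl
        contract_mid := fun X Y Z => by
          simp only [LinearMap.mk₂_apply]
          rw [(CliffordAlgebra.even.ι (extForm B n)).contract_mid, extForm_extVec]
          rfl }
  refine ⟨T.toRingHom, fun a z => map_smul T a z, fun X Y => ?_⟩
  exact CliffordAlgebra.even.lift_ι _ _ X Y

/-- `f` is a similarity of `(S_A, n_A)` with multiplier `μ`. -/
abbrev IsSimilarity (f : A ⊗[F] Module.End F S) (μ : Aˣ) : Prop :=
  ∀ X, extForm A n (act f X) = μ * extForm A n X

/-- `f` is a proper similarity of `(S_A, n_A)`: the automorphism `C₀(f)` of `C₀(S_A, n_A)` is the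
identity on the center. The center of `C₀(S_A, n_A) = A ⊗ C₀(S, n)` is `A ⊗ Z`, where `Z` is the
center of `C₀(S, n)`, so it is enough to consider the elements of `Z`. -/
def IsProperSimilarity (f : A ⊗[F] Module.End F S) : Prop :=
  ∃ (μ : Aˣ) (hf : IsSimilarity n f μ), ∀ z ∈ Subalgebra.center F (CliffordAlgebra.even n),
    evenSimilarity (extForm A n) (act f) μ hf (evenExt n A z) = evenExt n A z

variable {n}

theorem IsSimilarity.one : IsSimilarity n (1 : A ⊗[F] Module.End F S) 1 := fun X => by
  rw [act_one, Units.val_one, one_mul]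

theorem IsSimilarity.mul {f g : A ⊗[F] Module.End F S} {μ ν : Aˣ} (hf : IsSimilarity n f μ)
    (hg : IsSimilarity n g ν) : IsSimilarity n (f * g) (μ * ν) := fun X => by
  rw [act_mul, hf, hg, Units.val_mul, mul_assoc]

theorem IsSimilarity.inv {f : (A ⊗[F] Module.End F S)ˣ} {μ : Aˣ} (hf : IsSimilarity n f.1 μ) :
    IsSimilarity n (f⁻¹ : (A ⊗[F] Module.End F S)ˣ).1 μ⁻¹ := fun X => by
  have h := hf (act (f⁻¹ : (A ⊗[F] Module.End F S)ˣ).1 X)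
  rw [← act_mul, Units.mul_inv, act_one] at h
  rw [h, ← mul_assoc, Units.inv_mul, one_mul]

theorem IsSimilarity.ext {f : A ⊗[F] Module.End F S} {μ : Aˣ} (hf : IsSimilarity n f μ)
    (φ : A →ₐ[F] B) : IsSimilarity n (extAlg _ φ f) (Units.map (φ : A →* B) μ) := by
  intro X
  suffices h : (extForm B n).comp (act (extAlg _ φ f)) = (φ (μ : A)) • extForm B n by
    exact congrArg (fun Q => Q X) h
  refine _root_.baseChange_ext fun x => ?_
  have h1 : (1 : B) ⊗ₜ[F] x = extVec φ ((1 : A) ⊗ₜ x) := by simp [extVec]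
  rw [QuadraticMap.comp_apply, h1, act_extAlg, extForm_extVec, hf, map_mul,
    smul_apply, extForm_extVec, smul_eq_mul]

theorem evenSimilarity_comp {f g : A ⊗[F] Module.End F S} {μ ν : Aˣ} (hf : IsSimilarity n f μ)
    (hg : IsSimilarity n g ν) (z : CliffordAlgebra.even (extForm A n)) :
    evenSimilarity (extForm A n) (act (f * g)) (μ * ν) (hf.mul hg) z =
      evenSimilarity (extForm A n) (act f) μ hf (evenSimilarity (extForm A n) (act g) ν hg z) := by
  suffices h : evenSimilarity (extForm A n) (act (f * g)) (μ * ν) (hf.mul hg) =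
      (evenSimilarity (extForm A n) (act f) μ hf).comp
        (evenSimilarity (extForm A n) (act g) ν hg) by
    rw [h]
    rfl
  refine CliffordAlgebra.even.algHom_ext _
    (CliffordAlgebra.EvenHom.ext (LinearMap.ext₂ fun X Y => ?_))
  change evenSimilarity (extForm A n) (act (f * g)) (μ * ν) (hf.mul hg)
      ((CliffordAlgebra.even.ι _).bilin X Y) =
    evenSimilarity (extForm A n) (act f) μ hf (evenSimilarity (extForm A n) (act g) ν hg
      ((CliffordAlgebra.even.ι _).bilin X Y))
  rw [evenSimilarity_ι, evenSimilarity_ι, map_smul, evenSimilarity_ι, act_mul, act_mul, smul_smul,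
    mul_inv, Units.val_mul, mul_comm (μ⁻¹ : Aˣ).1]

theorem evenSimilarity_one {f : A ⊗[F] Module.End F S} {μ : Aˣ} (hf : IsSimilarity n f μ)
    (h1 : f = 1) (h2 : μ = 1) (z : CliffordAlgebra.even (extForm A n)) :
    evenSimilarity (extForm A n) (act f) μ hf z = z := by
  subst h1 h2
  suffices h : evenSimilarity (extForm A n) (act (1 : A ⊗[F] Module.End F S)) 1 hf =
      AlgHom.id A _ by
    rw [h]
    rfl
  refine CliffordAlgebra.even.algHom_ext _
    (CliffordAlgebra.EvenHom.ext (LinearMap.ext₂ fun X Y => ?_))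
  change evenSimilarity (extForm A n) (act (1 : A ⊗[F] Module.End F S)) 1 hf
      ((CliffordAlgebra.even.ι _).bilin X Y) = (CliffordAlgebra.even.ι _).bilin X Y
  rw [evenSimilarity_ι, act_one, act_one, inv_one, Units.val_one, one_smul]

theorem IsProperSimilarity.mul {f g : A ⊗[F] Module.End F S} (hf : IsProperSimilarity n f)
    (hg : IsProperSimilarity n g) : IsProperSimilarity n (f * g) := by
  obtain ⟨μ, hμ, hf⟩ := hf
  obtain ⟨ν, hν, hg⟩ := hg
  exact ⟨μ * ν, hμ.mul hν, fun z hz => by rw [evenSimilarity_comp hμ hν, hg z hz, hf z hz]⟩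

theorem IsProperSimilarity.one : IsProperSimilarity n (1 : A ⊗[F] Module.End F S) :=
  ⟨1, IsSimilarity.one, fun _ _ => evenSimilarity_one _ rfl rfl _⟩

theorem IsProperSimilarity.inv {f : (A ⊗[F] Module.End F S)ˣ} (hf : IsProperSimilarity n f.1) :
    IsProperSimilarity n (f⁻¹ : (A ⊗[F] Module.End F S)ˣ).1 := by
  obtain ⟨μ, hμ, hf⟩ := hf
  refine ⟨μ⁻¹, hμ.inv, fun z hz => ?_⟩
  conv_lhs => rw [← hf z hz]
  rw [← evenSimilarity_comp hμ.inv hμ]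
  exact evenSimilarity_one _ (Units.inv_mul f) (inv_mul_cancel μ) _

theorem IsProperSimilarity.ext {f : A ⊗[F] Module.End F S} (hf : IsProperSimilarity n f)
    (φ : A →ₐ[F] B) : IsProperSimilarity n (extAlg _ φ f) := by
  obtain ⟨μ, hμ, hf⟩ := hf
  refine ⟨Units.map (φ : A →* B) μ, hμ.ext φ, fun z hz => ?_⟩
  obtain ⟨T, hsmul, hT⟩ := exists_evenMap n φ
  have hTF (c : F) (y) : T (c • y) = c • T y := by
    rw [← algebraMap_smul A c y, hsmul, AlgHom.commutes, algebraMap_smul]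
  let TF : CliffordAlgebra.even (extForm A n) →ₐ[F] CliffordAlgebra.even (extForm B n) :=
    { T with
      commutes' := fun c => by
        change T (algebraMap F _ c) = _
        rw [Algebra.algebraMap_eq_smul_one, hTF, map_one, ← Algebra.algebraMap_eq_smul_one] }
  have e1 : TF.comp (evenExt n A) = evenExt n B := by
    refine CliffordAlgebra.even.algHom_ext _
      (CliffordAlgebra.EvenHom.ext (LinearMap.ext₂ fun x y => ?_))
    change T (evenExt n A ((CliffordAlgebra.even.ι _).bilin x y)) =
      evenExt n B ((CliffordAlgebra.even.ι _).bilin x y)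
    rw [evenExt_ι, evenExt_ι, hT]
    simp [extVec]
  have e2 (w : CliffordAlgebra.even n) :
      T (evenSimilarity (extForm A n) (act f) μ hμ (evenExt n A w)) =
        evenSimilarity (extForm B n) (act (extAlg _ φ f)) (Units.map (φ : A →* B) μ) (hμ.ext φ)
          (evenExt n B w) := by
    suffices h : (TF.comp ((evenSimilarity (extForm A n) (act f) μ hμ).restrictScalars F)).comp
        (evenExt n A) = ((evenSimilarity (extForm B n) (act (extAlg _ φ f))
          (Units.map (φ : A →* B) μ) (hμ.ext φ)).restrictScalars F).comp (evenExt n B) from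
      DFunLike.congr_fun h w
    refine CliffordAlgebra.even.algHom_ext _
      (CliffordAlgebra.EvenHom.ext (LinearMap.ext₂ fun x y => ?_))
    change T (evenSimilarity (extForm A n) (act f) μ hμ
        (evenExt n A ((CliffordAlgebra.even.ι _).bilin x y))) =
      evenSimilarity (extForm B n) (act (extAlg _ φ f)) (Units.map (φ : A →* B) μ) (hμ.ext φ)
        (evenExt n B ((CliffordAlgebra.even.ι _).bilin x y))
    have h1 (x : S) : (1 : B) ⊗ₜ[F] x = extVec φ ((1 : A) ⊗ₜ x) := by simp [extVec]
    rw [evenExt_ι, evenExt_ι, evenSimilarity_ι, evenSimilarity_ι, hsmul, hT, h1, h1, act_extAlg,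
      act_extAlg]
    rfl
  rw [← e2, hf z hz]
  exact DFunLike.congr_fun e1 z

end Similarities

/-! ### The group schemes `GO⁺(n)` and `PGO⁺(n)` -/

section PGO

variable {F : Type u} [Field F] {S : Type v} [AddCommGroup S] [Module F S]
  [FiniteDimensional F S] (n : QuadraticForm F S)

/-- The group scheme `GO(n)` of similarities of `(S, n)`. -/
def GO : SubgroupFunctor (GLFunctor F S) where
  sub A :=
    { carrier := {f : (A ⊗[F] Module.End F S)ˣ | ∃ μ : Aˣ, IsSimilarity n f.1 μ}
      one_mem' := ⟨1, IsSimilarity.one⟩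
      mul_mem' := fun ⟨_, hf⟩ ⟨_, hg⟩ => ⟨_, hf.mul hg⟩
      inv_mem' := fun ⟨_, hf⟩ => ⟨_, hf.inv⟩ }
  map_mem φ _ hf := by
    obtain ⟨_, hf⟩ := hf
    exact ⟨_, hf.ext φ.hom⟩

/-- The group scheme `GO⁺(n)` of proper similarities of `(S, n)`. -/
def GOPlus : SubgroupFunctor (GLFunctor F S) where
  sub A :=
    { carrier := {f : (A ⊗[F] Module.End F S)ˣ | IsProperSimilarity n f.1}
      one_mem' := IsProperSimilarity.one
      mul_mem' := IsProperSimilarity.mul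
      inv_mem' := IsProperSimilarity.inv }
  map_mem φ _ hf := IsProperSimilarity.ext hf φ.hom

/-- The homomorphism `f ↦ Int[f]` from `GL(S)` to `Aut(End S)`. -/
def intHom : GLFunctor F S ⟶ AutAlgFunctor F (Module.End F S) where
  app A := GrpCat.ofHom (innerAut A (A ⊗[F] Module.End F S))
  naturality A B φ := by
    ext f : 2
    refine extAut_unique _ φ.hom (innerAut A _ f) (innerAut B _ _) fun x => ?_
    change (Units.map (MonoidHomClass.toMonoidHom (extAlg (Module.End F S) φ.hom)) f).1 *
      extAlg _ φ.hom x * ((Units.map (MonoidHomClass.toMonoidHom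
        (extAlg (Module.End F S) φ.hom)) f)⁻¹).1 = extAlg _ φ.hom (f.1 * x * f⁻¹.1)
    rw [map_mul, map_mul]
    rfl

theorem exists_pushout {A B A' : CommAlgCat.{u} F} (φ : A ⟶ B)
    (hφ : φ.hom.toRingHom.FaithfullyFlat) (χ : A ⟶ A') :
    ∃ (B' : CommAlgCat.{u} F) (φ' : A' ⟶ B') (χ' : B ⟶ B'), φ'.hom.toRingHom.FaithfullyFlat ∧
      χ ≫ φ' = φ ≫ χ' := by
  algebraize [φ.hom.toRingHom, χ.hom.toRingHom]
  have : IsScalarTower F A A' := .of_algebraMap_eq' χ.hom.comp_algebraMap.symm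
  have : IsScalarTower F A B := .of_algebraMap_eq' φ.hom.comp_algebraMap.symm
  refine ⟨CommAlgCat.of F (A' ⊗[A] B),
    CommAlgCat.ofHom (Algebra.TensorProduct.includeLeft (R := A) (S := F)),
    CommAlgCat.ofHom ((Algebra.TensorProduct.includeRight (R := A)).restrictScalars F), ?_, ?_⟩
  · have h : (algebraMap A' (A' ⊗[A] B)).FaithfullyFlat :=
      RingHom.faithfullyFlat_algebraMap_iff.mpr inferInstance
    exact h
  · ext a
    exact (Algebra.TensorProduct.tmul_one_eq_one_tmul a)

/-- The group scheme `PGO⁺(n) = GO⁺(n) / Gₘ`, that is, the image of `GO⁺(n)` in `Aut(End S)` under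
`f ↦ Int[f]`: an automorphism of `A ⊗ End S` belongs to `PGO⁺(n)(A)` if and only if it is of the
form `Int[f]` with `f` in `GO⁺(n)(B)` over some faithfully flat extension `B` of `A`. -/
def PGOPlus : SubgroupFunctor (AutAlgFunctor F (Module.End F S)) where
  sub A :=
    { carrier := {θ | ∃ (B : CommAlgCat.{u} F) (φ : A ⟶ B), φ.hom.toRingHom.FaithfullyFlat ∧
        ∃ f ∈ (GOPlus n).sub B, (AutAlgFunctor F (Module.End F S)).map φ θ = intHom.app B f}
      one_mem' := ⟨A, 𝟙 A, .of_bijective Function.bijective_id, 1, one_mem _, by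
        rw [map_one, map_one]⟩
      mul_mem' := by
        rintro θ η ⟨B, φ, hφ, f, hf, hθ⟩ ⟨C, χ, hχ, g, hg, hη⟩
        obtain ⟨D, φ', χ', hφ', h⟩ := exists_pushout φ hφ χ
        refine ⟨D, χ ≫ φ', RingHom.FaithfullyFlat.stableUnderComposition _ _ hχ hφ',
          (GLFunctor F S).map χ' f * (GLFunctor F S).map φ' g,
          mul_mem ((GOPlus n).map_mem χ' f hf) ((GOPlus n).map_mem φ' g hg), ?_⟩
        rw [map_mul, map_mul, NatTrans.naturality_apply, NatTrans.naturality_apply, ← hθ, ← hη,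
          ← ConcreteCategory.comp_apply, ← ConcreteCategory.comp_apply, ← Functor.map_comp,
          ← Functor.map_comp, h]
      inv_mem' := by
        rintro θ ⟨B, φ, hφ, f, hf, hθ⟩
        exact ⟨B, φ, hφ, f⁻¹, inv_mem hf, by rw [map_inv, map_inv, hθ]⟩ }
  map_mem {A A'} χ θ hθ := by
    obtain ⟨B, φ, hφ, f, hf, hθ⟩ := hθ
    obtain ⟨D, φ', χ', hφ', h⟩ := exists_pushout φ hφ χ
    refine ⟨D, φ', hφ', (GLFunctor F S).map χ' f, (GOPlus n).map_mem χ' f hf, ?_⟩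
    rw [NatTrans.naturality_apply, ← hθ, ← ConcreteCategory.comp_apply,
      ← ConcreteCategory.comp_apply, ← Functor.map_comp, ← Functor.map_comp, h]

/-- The canonical map `GO⁺(n) → PGO⁺(n)`, `f ↦ [f] = Int[f]`. -/
def canonicalMap : (GOPlus n).toFunctor ⟶ (PGOPlus n).toFunctor where
  app A := GrpCat.ofHom (((intHom.app A).hom.comp ((GOPlus n).sub A).subtype).codRestrict
    ((PGOPlus n).sub A) fun f => ⟨A, 𝟙 A, .of_bijective Function.bijective_id, f.1, f.2, by
      rw [CategoryTheory.Functor.map_id]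
      rfl⟩)
  naturality A B φ := by
    ext f : 2
    exact Subtype.ext (NatTrans.naturality_apply intHom φ f.1)

end PGO

/-! ### Symmetric compositions -/

section SymmetricComposition

variable {F : Type u} [Field F] {S : Type v} [AddCommGroup S] [Module F S]

/-- A symmetric composition `⋆` on the quadratic space `(S, n)`, with its multiplier. -/
structure SymmetricComposition (n : QuadraticForm F S) where
  /-- The bilinear map `x ⋆ y`. -/
  mul : S →ₗ[F] S →ₗ[F] S
  /-- The multiplier of `⋆`. -/
  multiplier : Fˣ
  norm_mul : ∀ x y, n (mul x y) = multiplier * n x * n y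
  polar_mul : ∀ x y z, QuadraticMap.polar n (mul x y) z = QuadraticMap.polar n x (mul y z)

namespace SymmetricComposition

variable {n : QuadraticForm F S} (c : SymmetricComposition n)

/-- The linear map `x ↦ ℓ_x`, where `ℓ_x(y) = x ⋆ y`. -/
def left : S →ₗ[F] Module.End F S := c.mul

/-- The linear map `x ↦ r_x`, where `r_x(y) = y ⋆ x`. -/
def right : S →ₗ[F] Module.End F S := c.mul.flip

theorem polar_mul_mul_left (x y z : S) : QuadraticMap.polar n (c.mul x y) (c.mul x z) =
    c.multiplier * n x * QuadraticMap.polar n y z := by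
  simp only [QuadraticMap.polar, ← map_add, c.norm_mul]
  ring

theorem polar_mul_mul_right (x y z : S) : QuadraticMap.polar n (c.mul y x) (c.mul z x) =
    c.multiplier * n x * QuadraticMap.polar n y z := by
  have h : c.mul y x + c.mul z x = c.mul (y + z) x := by simp
  simp only [QuadraticMap.polar, h, c.norm_mul]
  ring

theorem right_mul_left (hn : n.polarBilin.SeparatingLeft) (x : S) :
    c.right x * c.left x = algebraMap F (Module.End F S) (c.multiplier * n x) := by
  refine LinearMap.ext fun y => sub_eq_zero.mp (hn _ fun z => ?_)
  have h1 : QuadraticMap.polar n (c.mul (c.mul x y) x) z =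
      c.multiplier * n x * QuadraticMap.polar n y z := by
    rw [c.polar_mul, polar_mul_mul_left]
  rw [map_sub, LinearMap.sub_apply, sub_eq_zero, Module.algebraMap_end_apply, map_smul,
    LinearMap.smul_apply]
  exact h1

theorem left_mul_right (hn : n.polarBilin.SeparatingLeft) (x : S) :
    c.left x * c.right x = algebraMap F (Module.End F S) (c.multiplier * n x) := by
  refine LinearMap.ext fun y => sub_eq_zero.mp (hn _ fun z => ?_)
  have h1 : QuadraticMap.polar n (c.mul x (c.mul y x)) z =
      c.multiplier * n x * QuadraticMap.polar n y z := by
    rw [QuadraticMap.polar_comm, ← c.polar_mul, polar_mul_mul_right, QuadraticMap.polar_comm]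
  rw [map_sub, LinearMap.sub_apply, sub_eq_zero, Module.algebraMap_end_apply, map_smul,
    LinearMap.smul_apply]
  exact h1

variable (A : Type w) [CommRing A] [Algebra F A]

/-- The extension of the composition `⋆` to `S_A`. -/
def extMul : A ⊗[F] S →ₗ[A] A ⊗[F] S →ₗ[A] A ⊗[F] S :=
  LinearMap.BilinMap.baseChange A c.mul

variable {A} in
/-- `f(x ⋆ y) = f(x) ⋆ f(y)` for all `x, y` in `S_A`. -/
def Preserves (f : A ⊗[F] Module.End F S) : Prop :=
  ∀ X Y, act f (c.extMul A X Y) = c.extMul A (act f X) (act f Y)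

variable {A} {c} in
theorem Preserves.one : c.Preserves (1 : A ⊗[F] Module.End F S) := fun X Y => by
  rw [act_one, act_one, act_one]

variable {A} {c} in
theorem Preserves.mul {f g : A ⊗[F] Module.End F S} (hf : c.Preserves f) (hg : c.Preserves g) :
    c.Preserves (f * g) := fun X Y => by
  rw [act_mul, hg, hf, act_mul, act_mul]

variable {A} {c} in
theorem Preserves.inv {f : (A ⊗[F] Module.End F S)ˣ} (hf : c.Preserves f.1) :
    c.Preserves (f⁻¹ : (A ⊗[F] Module.End F S)ˣ).1 := fun X Y => by
  have h (Z : A ⊗[F] S) : act f.1 (act (f⁻¹ : (A ⊗[F] Module.End F S)ˣ).1 Z) = Z := by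
    rw [← act_mul, Units.mul_inv, act_one]
  have h' (Z : A ⊗[F] S) : act (f⁻¹ : (A ⊗[F] Module.End F S)ˣ).1 (act f.1 Z) = Z := by
    rw [← act_mul, Units.inv_mul, act_one]
  rw [← h' (c.extMul A (act _ X) (act _ Y)), hf, h, h]

variable {A} {c} in
theorem Preserves.ext {B : Type w'} [CommRing B] [Algebra F B] {f : A ⊗[F] Module.End F S}
    (hf : c.Preserves f) (φ : A →ₐ[F] B) : c.Preserves (extAlg _ φ f) := by
  have hφ (X Y : A ⊗[F] S) :
      c.extMul B (extVec φ X) (extVec φ Y) = extVec φ (c.extMul A X Y) := by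
    induction X with
    | zero => simp
    | add X X' hX hX' => simp only [map_add, LinearMap.add_apply, hX, hX']
    | tmul a x =>
      induction Y with
      | zero => simp
      | add Y Y' hY hY' => simp only [map_add, hY, hY']
      | tmul b y => simp [extMul, extVec]
  suffices h : (c.extMul B).compr₂ (act (extAlg _ φ f)) =
      (c.extMul B).compl₁₂ (act (extAlg _ φ f)) (act (extAlg _ φ f)) from
    fun X Y => congrArg (fun β => β X Y) h
  refine TensorProduct.AlgebraTensorModule.curry_injective
    (LinearMap.ext_ring (LinearMap.ext fun x => ?_))
  refine TensorProduct.AlgebraTensorModule.curry_injective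
    (LinearMap.ext_ring (LinearMap.ext fun y => ?_))
  have h1 (x : S) : (1 : B) ⊗ₜ[F] x = extVec φ ((1 : A) ⊗ₜ x) := by simp [extVec]
  change act (extAlg _ φ f) (c.extMul B (1 ⊗ₜ x) (1 ⊗ₜ y)) =
    c.extMul B (act (extAlg _ φ f) (1 ⊗ₜ x)) (act (extAlg _ φ f) (1 ⊗ₜ y))
  rw [h1, h1, hφ, act_extAlg, act_extAlg, act_extAlg, hφ, hf]

variable [FiniteDimensional F S]

/-- The homomorphism `α₀` from `C₀(S_A, n_A)` to `End(S_A) × End(S_A)` with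
`α₀(xy) = (λ⁻¹ r_x ℓ_y, λ⁻¹ ℓ_x r_y)` for `x, y` in `S_A`, where `λ` is the multiplier of `⋆`. -/
def alphaEven (hn : n.polarBilin.SeparatingLeft) :
    CliffordAlgebra.even (extForm A n) →ₐ[A]
      (A ⊗[F] Module.End F S) × (A ⊗[F] Module.End F S) :=
  have hmul : algebraMap F A (c.multiplier⁻¹ : Fˣ) * algebraMap F A c.multiplier = 1 := by
    rw [← map_mul, Units.inv_mul, map_one]
  CliffordAlgebra.even.lift (extForm A n)
    { bilin := LinearMap.mk₂ A
        (fun X Y => algebraMap F A (c.multiplier⁻¹ : Fˣ) •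
          (c.right.baseChange A X * c.left.baseChange A Y,
            c.left.baseChange A X * c.right.baseChange A Y))
        (fun X X' Y => by simp only [map_add, add_mul, ← smul_add, Prod.mk_add_mk])
        (fun a X Y => by
          rw [smul_comm a, Prod.smul_mk a]
          simp only [map_smul, smul_mul_assoc])
        (fun X Y Y' => by simp only [map_add, mul_add, ← smul_add, Prod.mk_add_mk])
        (fun a X Y => by
          rw [smul_comm a, Prod.smul_mk a]
          simp only [map_smul, mul_smul_comm])
      contract := fun X => by
        rw [LinearMap.mk₂_apply,
          baseChange_mul_baseChange n c.right c.left _ (c.right_mul_left hn),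
          baseChange_mul_baseChange n c.left c.right _ (c.left_mul_right hn),
          ← Prod.algebraMap_apply, map_mul (algebraMap A ((A ⊗[F] Module.End F S) × (A ⊗[F] Module.End F S))),
          ← Algebra.smul_def, smul_smul, hmul, one_smul]
      contract_mid := fun X Y Z => by
        have h (p q r s : A ⊗[F] Module.End F S) : p * q * (r * s) = p * (q * r) * s := by
          simp only [mul_assoc]
        simp only [LinearMap.mk₂_apply]
        rw [smul_mul_smul_comm, Prod.mk_mul_mk, h, h,
          baseChange_mul_baseChange n c.left c.right _ (c.left_mul_right hn),
          baseChange_mul_baseChange n c.right c.left _ (c.right_mul_left hn)]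
        simp only [Algebra.algebraMap_eq_smul_one (A := A ⊗[F] Module.End F S), mul_smul_comm, mul_one, smul_mul_assoc,
          ← Prod.smul_mk, smul_smul]
        congr 1
        linear_combination (extForm A n Y) * (algebraMap F A (c.multiplier⁻¹ : Fˣ)) * hmul }

theorem alphaEven_ι (hn : n.polarBilin.SeparatingLeft) (X Y : A ⊗[F] S) :
    c.alphaEven A hn ((CliffordAlgebra.even.ι (extForm A n)).bilin X Y) =
      algebraMap F A (c.multiplier⁻¹ : Fˣ) •
          (c.right.baseChange A X * c.left.baseChange A Y,
            c.left.baseChange A X * c.right.baseChange A Y) :=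
  CliffordAlgebra.even.lift_ι _ _ X Y

/-- Commutation of the diagram `D⁺(f, g, h)`, for similarities `f`, `g`, `h` over `A`:
`α₀ ∘ C₀[f] = (Int[g] × Int[h]) ∘ α₀`. -/
def DPlus (hn : n.polarBilin.SeparatingLeft) (f g h : (A ⊗[F] Module.End F S)ˣ) : Prop :=
  ∃ (μ : Aˣ) (hf : IsSimilarity n f.1 μ), ∀ z : CliffordAlgebra.even (extForm A n),
    c.alphaEven A hn (evenSimilarity (extForm A n) (act f.1) μ hf z) =
      (innerAut A _ g (c.alphaEven A hn z).1, innerAut A _ h (c.alphaEven A hn z).2)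

/-- `ρ` is the automorphism `ρ_⋆` of `PGO⁺(n)`: it carries `[f]` to the class `[g]` such that
`D⁺(f, g, h)` commutes for some `h`. Since an element of `PGO⁺(n)(A)` is of the form `[f]` only
over a faithfully flat extension of `A`, this is required over such an extension. -/
def IsTriality (hn : n.polarBilin.SeparatingLeft)
    (ρ : (PGOPlus n).toFunctor ≅ (PGOPlus n).toFunctor) : Prop :=
  ∀ (A : CommAlgCat.{u} F) (θ : (PGOPlus n).toFunctor.obj A),
    ∃ (B : CommAlgCat.{u} F) (φ : A ⟶ B) (f g h : (GOPlus n).toFunctor.obj B),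
      φ.hom.toRingHom.FaithfullyFlat ∧
      c.DPlus B hn f.1 g.1 h.1 ∧
      (PGOPlus n).toFunctor.map φ θ = (canonicalMap n).app B f ∧
      (PGOPlus n).toFunctor.map φ (ρ.hom.app A θ) = (canonicalMap n).app B g

/-- The group scheme `Aut(⋆)` of the similarities of `(S, n)` that preserve `⋆`. -/
def autScheme : SubgroupFunctor (GLFunctor F S) where
  sub A :=
    { carrier := {f : (A ⊗[F] Module.End F S)ˣ | f ∈ (GO n).sub A ∧ c.Preserves f.1}
      one_mem' := ⟨one_mem _, Preserves.one⟩
      mul_mem' := fun ⟨hf, hf'⟩ ⟨hg, hg'⟩ => ⟨mul_mem hf hg, hf'.mul hg'⟩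
      inv_mem' := fun ⟨hf, hf'⟩ => ⟨inv_mem hf, hf'.inv⟩ }
  map_mem φ _ hf := ⟨(GO n).map_mem φ _ hf.1, hf.2.ext φ.hom⟩

end SymmetricComposition
end SymmetricComposition

end Triality
end

/-! The element α(x) = (0, r_x; λ⁻¹ℓ_x, 0) of M₂(End S) squares to n(x), because r_x ℓ_x = ℓ_x r_x =
λ n(x). This gives a graded homomorphism from C(S, n) to M₂(End S). Both sides have dimension 2⁸
when dim S = 8, so it is an isomorphism (`cliffordLift_bijective`, `alpha_bijective`), and its even
part α₀ is an isomorphism onto End S × End S, over F and then over every A. In particular the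
operators r_x ℓ_y generate End(S_A).

Let f be a proper similarity with multiplier μ. Then C₀(f) fixes the central idempotent that α₀
sends to (1, 0), so it induces an endomorphism of the first factor End(S_A). That endomorphism is of
the form Int[g] after a faithfully flat extension (`exists_extEnd_eq_conj`), which means r_{f(x)}
ℓ_{f(y)} g = μ g r_x ℓ_y. The adjoint of r_x ℓ_y is r_y ℓ_x and these operators generate, so Int[g]
respects adjoints and g is a similarity, of some multiplier ν. A third similarity h then satisfies
f(x) ⋆ g(y) = h(x ⋆ y), h(x) ⋆ f(y) = μ g(x ⋆ y), g(x) ⋆ h(y) = ν f(x ⋆ y) (`exists_isRelated`).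
Conversely these identities give the diagram D⁺(f, g, h) (`IsRelated.dPlus`).

Two facts make [f] ↦ [g] an automorphism. The class [g] depends only on [f], since Int[g] is
prescribed on generators; and the identities are cyclic, (g, h, νf) being again such a triple, so
the third iterate is the identity. Uniqueness of [g] lets the locally defined map descend to
PGO⁺(n), because Aut(End S) is a sheaf for the faithfully flat topology (`IsLocalRotation`,
`existsUnique_isTriality`).

If f preserves ⋆, its multiplier is 1 and (f, f, f) is a related triple, so f is proper and [f] is
fixed. If [f] is fixed, then locally [f] = [g] = [h], so f(x) ⋆ f(y) = s f(x ⋆ y) with a scalar s,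
and s⁻¹f preserves ⋆. An automorphism of ⋆ is determined by its class, so this local representative
descends as well (`exists_preserves_of_locallyRelated`). -/

noncomputable section

namespace Triality

universe u v w w'

/-! ### Matrix coordinates on `A ⊗ End_F S` -/

section Matrices

variable {F : Type u} [Field F] {S : Type v} [AddCommGroup S] [Module F S]
variable {ι : Type*} [Fintype ι] [DecidableEq ι] (b : Module.Basis ι F S)
variable (A : Type w) [CommRing A] [Algebra F A] {B : Type w'} [CommRing B] [Algebra F B]

/-- The homomorphism `A ⊗ End_F S → M_ι(A)` given by a basis of `S`. -/
def matHom : A ⊗[F] Module.End F S →ₐ[A] Matrix ι ι A :=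
  Algebra.TensorProduct.lift (Algebra.ofId A (Matrix ι ι A))
    ((Algebra.ofId F A).mapMatrix.comp (LinearMap.toMatrixAlgEquiv b).toAlgHom)
    (fun a _ => Algebra.commutes a _)

variable {A} in
theorem matHom_tmul (a : A) (e : Module.End F S) (i j : ι) :
    matHom b A (a ⊗ₜ e) i j = a * algebraMap F A (LinearMap.toMatrixAlgEquiv b e i j) := by
  have h : matHom b A (a ⊗ₜ e) = algebraMap A (Matrix ι ι A) a *
      (LinearMap.toMatrixAlgEquiv b e).map (algebraMap F A) :=
    Algebra.TensorProduct.lift_tmul _ _ _ _ _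
  rw [h, ← Algebra.smul_def]
  rfl

/-- The basis of elementary endomorphisms goes to the basis of elementary matrices, over any A. -/
theorem matHom_bijective : Function.Bijective (matHom b A) := by
  have h : (matHom b A).toLinearMap =
      ((b.end.baseChange A).equiv (Matrix.stdBasis A ι ι) (Equiv.refl _)).toLinearMap := by
    refine (b.end.baseChange A).ext fun ij => ?_
    rw [LinearEquiv.coe_coe, Module.Basis.equiv_apply, Module.Basis.baseChange_apply]
    ext i j
    change matHom b A (1 ⊗ₜ b.end ij) i j = _
    rw [matHom_tmul, one_mul, LinearMap.toMatrixAlgEquiv_apply, Module.Basis.end_apply_apply,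
      Matrix.stdBasis_eq_single, Matrix.single_apply]
    by_cases h2 : ij.2 = j <;> by_cases h1 : ij.1 = i <;> simp [h1, h2]
  have h' : ⇑(matHom b A) =
      (b.end.baseChange A).equiv (Matrix.stdBasis A ι ι) (Equiv.refl _) :=
    funext fun x => LinearMap.congr_fun h x
  rw [h']
  exact LinearEquiv.bijective _

/-- The isomorphism `A ⊗ End_F S ≃ M_ι(A)` given by a basis of `S`. -/
def matEquiv : A ⊗[F] Module.End F S ≃ₐ[A] Matrix ι ι A :=
  AlgEquiv.ofBijective (matHom b A) (matHom_bijective b A)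

variable {A}

theorem matEquiv_extAlg (φ : A →ₐ[F] B) (x : A ⊗[F] Module.End F S) (i j : ι) :
    matEquiv b B (extAlg _ φ x) i j = φ (matEquiv b A x i j) := by
  change matHom b B (extAlg _ φ x) i j = φ (matHom b A x i j)
  induction x with
  | zero => simp only [map_zero, Matrix.zero_apply]
  | add x y hx hy => simp only [map_add, Matrix.add_apply, hx, hy]
  | tmul a e =>
    rw [matHom_tmul, map_mul, AlgHom.commutes, ← matHom_tmul]
    rfl

theorem matEquiv_symm_extAlg (φ : A →ₐ[F] B) (M : Matrix ι ι A) :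
    extAlg _ φ ((matEquiv b A).symm M) = (matEquiv b B).symm (M.map φ) := by
  rw [AlgEquiv.eq_symm_apply]
  ext i j
  rw [matEquiv_extAlg, AlgEquiv.apply_symm_apply, Matrix.map_apply]

theorem act_algebraMap (a : A) (X : A ⊗[F] S) :
    act (algebraMap A (A ⊗[F] Module.End F S) a) X = a • X := by
  rw [act, AlgHom.commutes, Module.algebraMap_end_apply]

theorem act_unit_inv (f : (A ⊗[F] Module.End F S)ˣ) (X : A ⊗[F] S) :
    act f.1 (act (f⁻¹ : (A ⊗[F] Module.End F S)ˣ).1 X) = X := by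
  rw [← act_mul, Units.mul_inv, act_one]

variable [FiniteDimensional F S]

theorem extAlg_injective {φ : A →ₐ[F] B} (hφ : Function.Injective φ) :
    Function.Injective (extAlg (Module.End F S) φ) := by
  intro x y h
  refine (matEquiv (Module.finBasis F S) A).injective (Matrix.ext fun i j => hφ ?_)
  rw [← matEquiv_extAlg, ← matEquiv_extAlg, h]

/-- Exactness of A → B ⇉ C passes to A ⊗ End S by applying it to each matrix entry. -/
theorem exists_extAlg_eq {C : Type*} [CommRing C] [Algebra F C] {φ : A →ₐ[F] B}
    {p q : B →ₐ[F] C} (hpq : ∀ x, p x = q x → ∃ a, φ a = x) (x : B ⊗[F] Module.End F S)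
    (hx : extAlg _ p x = extAlg _ q x) : ∃ y, extAlg _ φ y = x := by
  have h (i j) : ∃ a, φ a = matEquiv (Module.finBasis F S) B x i j :=
    hpq _ (by rw [← matEquiv_extAlg, ← matEquiv_extAlg, hx])
  choose M hM using h
  refine ⟨(matEquiv (Module.finBasis F S) A).symm (Matrix.of M), ?_⟩
  rw [matEquiv_symm_extAlg, AlgEquiv.symm_apply_eq]
  ext i j
  exact hM i j

theorem exists_algebraMap_eq_of_commute (x : A ⊗[F] Module.End F S) (hx : ∀ y, x * y = y * x) :
    ∃ a, x = algebraMap A _ a := by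
  let Φ := matEquiv (Module.finBasis F S) A
  obtain ⟨a, ha⟩ : Φ x ∈ Set.range (Matrix.scalar _) :=
    Matrix.mem_range_scalar_iff_commute_single'.mpr fun i j => by
    have := congrArg Φ (hx (Φ.symm (Matrix.single i j 1)))
    rw [map_mul, map_mul, Φ.apply_symm_apply] at this
    exact this.symm
  refine ⟨a, Φ.injective ?_⟩
  rw [AlgEquiv.commutes, ← ha]
  rfl

/-- The matrix entries of x are the coordinates of its values on basis vectors. Operator identities
can therefore be checked on vectors of S_A. -/
theorem act_injective : Function.Injective (act : A ⊗[F] Module.End F S → _) := by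
  let b := Module.finBasis F S
  have key (x : A ⊗[F] Module.End F S) (i j) :
      (b.baseChange A).repr (act x (1 ⊗ₜ b j)) i = matEquiv b A x i j := by
    change _ = matHom b A x i j
    induction x with
    | zero => simp [act]
    | add x y hx hy =>
      rw [map_add, Matrix.add_apply, ← hx, ← hy, act, map_add]
      simp only [act, LinearMap.add_apply, map_add, Finsupp.add_apply]
    | tmul a e =>
      rw [act_tmul, matHom_tmul, Module.Basis.baseChange_repr_tmul, mul_one,
        LinearMap.toMatrixAlgEquiv_apply, Algebra.smul_def, mul_comm]
  intro x y h
  refine (matEquiv b A).injective (Matrix.ext fun i j => ?_)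
  rw [← key, ← key, h]

end Matrices

/-! ### Faithfully flat descent -/

section Descent

variable {F : Type u} [Field F]

/-- The two maps from `B` to `B ⊗[A] B`, for a faithfully flat `A`-algebra `B`. -/
theorem exists_kernelPair {A B : CommAlgCat.{u} F} (φ : A ⟶ B)
    (hφ : φ.hom.toRingHom.FaithfullyFlat) :
    ∃ (C : CommAlgCat.{u} F) (p q : B ⟶ C), φ ≫ p = φ ≫ q ∧
      ∀ x, p.hom x = q.hom x → ∃ a, φ.hom a = x := by
  algebraize [φ.hom.toRingHom]
  have : IsScalarTower F A B := .of_algebraMap_eq' φ.hom.comp_algebraMap.symm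
  refine ⟨CommAlgCat.of F (B ⊗[A] B),
    CommAlgCat.ofHom (Algebra.TensorProduct.includeLeft (R := A) (S := F)),
    CommAlgCat.ofHom ((Algebra.TensorProduct.includeRight (R := A)).restrictScalars F), ?_, ?_⟩
  · ext a
    exact (Algebra.TensorProduct.tmul_one_eq_one_tmul a)
  · intro x hx
    obtain ⟨a, ha⟩ := (Algebra.codRestrictEqLocusPushoutCocone.bijective_of_faithfullyFlat A B).2
      ⟨x, hx⟩
    exact ⟨a, congrArg Subtype.val ha⟩

end Descent

/-! ### Endomorphisms of matrix algebras are inner, locally -/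

section SkolemNoether

/-- Column j of g is θ(E_{jo})y. Since a E_{jo} = ∑ₖ a_{kj} E_{ko}, the relation θ(a)g = ga holds
for every y. Row i of h is xθ(E_{oi}), and E_{oi}E_{jo} = δ_{ij}E_{oo} gives hg = s·1 with s =
x·θ(E_{oo})y. The unit hypothesis on s serves only to invert g. -/
theorem exists_conj_of_isUnit {ι : Type*} [Fintype ι] [DecidableEq ι] {B : Type*} [CommRing B]
    (θ : Matrix ι ι B →ₐ[B] Matrix ι ι B) (o : ι) (x y : ι → B)
    (hs : IsUnit (x ⬝ᵥ (θ (Matrix.single o o 1)).mulVec y)) :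
    ∃ g : (Matrix ι ι B)ˣ, ∀ a, θ a * g = g * a := by
  let g : Matrix ι ι B := Matrix.of fun i j => (θ (Matrix.single j o 1)).mulVec y i
  let h : Matrix ι ι B := Matrix.of fun i j => Matrix.vecMul x (θ (Matrix.single o i 1)) j
  obtain ⟨s, hs⟩ := hs
  have hg (a) : θ a * g = g * a := by
    ext i j
    have h1 : a * Matrix.single j o 1 = ∑ k, a k j • Matrix.single k o (1 : B) := by
      ext p q
      rw [Matrix.sum_apply]
      by_cases hq : o = q <;> simp [Matrix.mul_apply, Matrix.single_apply, hq]
    have h2 : (θ a * g) i j = (θ a).mulVec ((θ (Matrix.single j o 1)).mulVec y) i := rfl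
    rw [h2, Matrix.mulVec_mulVec, ← map_mul, h1, map_sum, Matrix.sum_mulVec, Finset.sum_apply,
      Matrix.mul_apply]
    refine Finset.sum_congr rfl fun k _ => ?_
    rw [map_smul, Matrix.smul_mulVec, Pi.smul_apply, smul_eq_mul, mul_comm]
    rfl
  have hh : h * g = s.1 • (1 : Matrix ι ι B) := by
    ext i j
    have h2 : (h * g) i j =
        Matrix.vecMul x (θ (Matrix.single o i 1)) ⬝ᵥ (θ (Matrix.single j o 1)).mulVec y := rfl
    rw [h2, ← Matrix.dotProduct_mulVec, Matrix.mulVec_mulVec, ← map_mul]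
    by_cases hij : i = j
    · subst hij
      rw [Matrix.single_mul_single_same, mul_one, ← hs]
      simp
    · rw [Matrix.single_mul_single_of_ne _ _ _ _ hij, map_zero]
      simp [hij]
  have hu : IsUnit g := by
    refine IsUnit.of_mul_eq_one_right ((s⁻¹ : Bˣ).1 • h) ?_
    rw [smul_mul_assoc, hh, smul_smul, Units.inv_mul, one_smul]
  exact ⟨hu.unit, hg⟩

/-- Apply θ to 1 = ∑ᵢ E_{io}E_{oo}E_{oi} and read one diagonal entry. -/
theorem span_entries_eq_top {ι : Type*} [Fintype ι] [DecidableEq ι] {B : Type*} [CommRing B]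
    (θ : Matrix ι ι B →ₐ[B] Matrix ι ι B) (o : ι) :
    Ideal.span (Set.range fun k : ι × ι => θ (Matrix.single o o 1) k.1 k.2) = ⊤ := by
  rw [Ideal.eq_top_iff_one]
  set I := Ideal.span (Set.range fun k : ι × ι => θ (Matrix.single o o 1) k.1 k.2)
  have h1 : (1 : Matrix ι ι B) = ∑ i, θ (Matrix.single i o 1) * θ (Matrix.single o o 1) *
      θ (Matrix.single o i 1) := by
    simp only [← map_mul, Matrix.single_mul_single_same, mul_one, ← map_sum]
    rw [← map_one θ]
    congr 1
    ext p q
    rw [Matrix.sum_apply]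
    by_cases hpq : p = q <;> simp [Matrix.single_apply, Matrix.one_apply, hpq, ite_and]
  have h2 := congrFun (congrFun h1 o) o
  rw [Matrix.one_apply_eq, Matrix.sum_apply] at h2
  rw [h2]
  refine Ideal.sum_mem _ fun i _ => ?_
  simp only [Matrix.mul_apply]
  exact Ideal.sum_mem _ fun p _ => I.mul_mem_right _ (Ideal.sum_mem _ fun q _ =>
    I.mul_mem_left _ (Ideal.subset_span ⟨(q, p), rfl⟩))

/-- Every prime misses some `s k`, hence comes from a prime of the corresponding localization. -/
theorem faithfullyFlat_pi_away {κ : Type*} [Finite κ] {B : Type*} [CommRing B] (s : κ → B)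
    (hs : Ideal.span (Set.range s) = ⊤) :
    Module.FaithfullyFlat B (∀ k, Localization.Away (s k)) := by
  classical
  have := Fintype.ofFinite κ
  have : Module.Flat B (∀ k, Localization.Away (s k)) :=
    Module.Flat.of_linearEquiv (DFinsupp.linearEquivFunOnFintype (R := B)
      (M := fun k => Localization.Away (s k))).symm
  refine .of_comap_surjective fun p => ?_
  obtain ⟨k, hk⟩ : ∃ k, s k ∉ p.asIdeal := by
    by_contra! h
    exact p.isPrime.ne_top (top_le_iff.mp (hs ▸ Ideal.span_le.mpr (Set.range_subset_iff.mpr h)))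
  obtain ⟨p', hp'⟩ : p ∈ Set.range
      (PrimeSpectrum.comap (algebraMap B (Localization.Away (s k)))) := by
    rw [PrimeSpectrum.localization_away_comap_range _ (s k)]
    exact hk
  refine ⟨PrimeSpectrum.comap (Pi.evalRingHom _ k) p', ?_⟩
  rw [← hp', ← PrimeSpectrum.comap_comp_apply]
  rfl

theorem dotProduct_mulVec_indicator {ι : Type*} [Fintype ι] [DecidableEq ι] {R : ι × ι → Type*}
    [∀ k, CommRing (R k)] (M : Matrix ι ι (∀ k, R k)) (k : ι × ι) :
    ((fun p k => if p = k.1 then 1 else 0) ⬝ᵥ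
      M.mulVec (fun q k => if q = k.2 then 1 else 0)) k = M k.1 k.2 k := by
  simp [dotProduct, Matrix.mulVec]

variable {F : Type u} [Field F] {S : Type v} [AddCommGroup S] [Module F S] [FiniteDimensional F S]

/-- An endomorphism of the `A`-algebra `A ⊗ End_F S` becomes inner over a faithfully flat extension
of `A`. -/
theorem exists_extEnd_eq_conj [Nontrivial S] (A : CommAlgCat.{u} F)
    (θ : A ⊗[F] Module.End F S →ₐ[A] A ⊗[F] Module.End F S) :
    ∃ (B : CommAlgCat.{u} F) (φ : A ⟶ B) (g : (B ⊗[F] Module.End F S)ˣ),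
      φ.hom.toRingHom.FaithfullyFlat ∧ ∀ x, extEnd _ φ.hom θ x * g = g * x := by
  let b := Module.finBasis F S
  let o : Fin (Module.finrank F S) := ⟨0, Module.finrank_pos⟩
  let ΨA := matEquiv b A
  let θA : Matrix _ _ A →ₐ[A] Matrix _ _ A := (ΨA.toAlgHom.comp θ).comp ΨA.symm.toAlgHom
  let s (k : _ × _) : A := θA (Matrix.single o o 1) k.1 k.2
  let B := ∀ k, Localization.Away (s k)
  let φ : A →ₐ[F] B := IsScalarTower.toAlgHom F A B
  let ΨB := matEquiv b B
  let θB : Matrix _ _ B →ₐ[B] Matrix _ _ B :=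
    (ΨB.toAlgHom.comp (extEnd _ φ θ)).comp ΨB.symm.toAlgHom
  have hθ (i j) : θB (Matrix.single o o 1) i j = φ (θA (Matrix.single o o 1) i j) := by
    have h1 : (Matrix.single o o (1 : B)) = (Matrix.single o o (1 : A)).map φ := by
      ext p q
      simp only [Matrix.map_apply, Matrix.single_apply, apply_ite φ, map_one, map_zero]
    have h2 : ΨB.symm (Matrix.single o o 1) = extAlg _ φ (ΨA.symm (Matrix.single o o 1)) := by
      rw [h1, matEquiv_symm_extAlg]
    change ΨB (extEnd _ φ θ (ΨB.symm (Matrix.single o o 1))) i j = _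
    rw [h2, extEnd_extAlg]
    exact matEquiv_extAlg b φ _ i j
  have hff : φ.toRingHom.FaithfullyFlat := by
    have h := faithfullyFlat_pi_away s (span_entries_eq_top θA o)
    exact RingHom.faithfullyFlat_algebraMap_iff.mpr h
  -- The factor of B indexed by k = (i, j) inverts the entry (i, j) of θ(E_{oo}). Taking the two
  -- vectors equal to e_i and e_j on that factor makes the scalar x·θ(E_{oo})y equal to this entry,
  -- so it is a unit on all factors at once.
  obtain ⟨g, hg⟩ := exists_conj_of_isUnit θB o
    (fun p k => if p = k.1 then 1 else 0) (fun q k => if q = k.2 then 1 else 0) (by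
      rw [Pi.isUnit_iff]
      intro k
      have : (((fun p k => if p = k.1 then 1 else 0) : Fin _ → B) ⬝ᵥ
          (θB (Matrix.single o o 1)).mulVec (fun q k => if q = k.2 then 1 else 0)) k =
          algebraMap A (Localization.Away (s k)) (s k) := by
        rw [dotProduct_mulVec_indicator, hθ]
        rfl
      rw [this]
      exact IsLocalization.Away.algebraMap_isUnit (s k))
  refine ⟨CommAlgCat.of F B, CommAlgCat.ofHom φ, Units.map ΨB.symm.toMonoidHom g, hff,
    fun x => ΨB.injective ?_⟩
  have h := hg (ΨB x)
  have h1 : θB (ΨB x) = ΨB (extEnd _ φ θ x) := by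
    change ΨB (extEnd _ φ θ (ΨB.symm (ΨB x))) = _
    rw [AlgEquiv.symm_apply_apply]
  rw [h1] at h
  have h2 : ΨB (Units.map ΨB.symm.toMonoidHom g).1 = g := ΨB.apply_symm_apply g.1
  refine (map_mul ΨB _ _).trans (Eq.trans ?_ (map_mul ΨB _ _).symm)
  rw [h2]
  exact h

end SkolemNoether

/-! ### Representations of the Clifford algebra of a nonsingular form -/

section ProdSpan

variable {F : Type*} [Field F] {R : Type*} [Ring R] [Algebra F R]

/-- The span of the products of the sublists of a list. -/
def prodSpan (F : Type*) [Field F] {R : Type*} [Ring R] [Algebra F R] : List R → Submodule F R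
  | [] => F ∙ 1
  | a :: l => prodSpan F l ⊔ (prodSpan F l).map (LinearMap.mulLeft F a)

instance finiteDimensional_prodSpan (l : List R) : FiniteDimensional F (prodSpan F l) := by
  induction l with
  | nil => exact inferInstanceAs (FiniteDimensional F (F ∙ (1 : R)))
  | cons a l ih => exact inferInstanceAs (FiniteDimensional F
      (prodSpan F l ⊔ (prodSpan F l).map (LinearMap.mulLeft F a) : Submodule F R))

theorem finrank_prodSpan_le (l : List R) : Module.finrank F (prodSpan F l) ≤ 2 ^ l.length := by
  induction l with
  | nil => exact (finrank_span_le_card ({1} : Set R)).trans (by simp)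
  | cons a l ih =>
    refine (Submodule.finrank_add_le_finrank_add_finrank _ _).trans ?_
    have := Submodule.finrank_map_le (LinearMap.mulLeft F a) (prodSpan F l)
    rw [List.length_cons, pow_succ]
    omega

theorem one_mem_prodSpan (l : List R) : (1 : R) ∈ prodSpan F l := by
  induction l with
  | nil => exact Submodule.mem_span_singleton_self _
  | cons a l ih => exact Submodule.mem_sup_left ih

/-- The Clifford relations move a new factor into its place in the order of the list, at the cost of
shorter products. -/
theorem mul_mem_prodSpan (l : List R) (h1 : ∀ a ∈ l, ∃ c : F, a * a = algebraMap F R c)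
    (h2 : ∀ a ∈ l, ∀ b ∈ l, ∃ c : F, a * b + b * a = algebraMap F R c) (a : R) (ha : a ∈ l)
    (x : R) (hx : x ∈ prodSpan F l) : a * x ∈ prodSpan F l := by
  induction l generalizing a x with
  | nil => simp at ha
  | cons e l ih =>
    have ih' := ih (fun a ha => h1 a (List.mem_cons_of_mem _ ha))
      (fun a ha b hb => h2 a (List.mem_cons_of_mem _ ha) b (List.mem_cons_of_mem _ hb))
    obtain ⟨y, hy, _, ⟨z, hz, rfl⟩, rfl⟩ := Submodule.mem_sup.mp hx
    rw [LinearMap.mulLeft_apply, mul_add]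
    rcases List.mem_cons.mp ha with rfl | ha'
    · obtain ⟨c, hc⟩ := h1 a (by simp)
      rw [← mul_assoc, hc, ← Algebra.smul_def]
      exact add_mem (Submodule.mem_sup_right ⟨y, hy, rfl⟩)
        (Submodule.mem_sup_left (Submodule.smul_mem _ _ hz))
    · obtain ⟨c, hc⟩ := h2 a ha e (by simp)
      have h3 : a * (e * z) = c • z + e * -(a * z) := by
        rw [Algebra.smul_def, ← hc]
        noncomm_ring
      rw [h3]
      exact add_mem (Submodule.mem_sup_left (ih' a ha' y hy))
        (add_mem (Submodule.mem_sup_left (Submodule.smul_mem _ _ hz))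
          (Submodule.mem_sup_right ⟨_, neg_mem (ih' a ha' z hz), rfl⟩))

/-- If every element of the list has a skew derivation that takes it to `1` and kills the elements
that follow, then the products of the sublists are linearly independent. -/
theorem finrank_prodSpan_eq [Nontrivial R] (ε : R →ₐ[F] R) (l : List (R × R))
    (h1 : ∀ p ∈ l, p.2 * p.1 - ε p.1 * p.2 = 1)
    (h2 : l.Pairwise fun p q => p.2 * q.1 = ε q.1 * p.2) :
    Module.finrank F (prodSpan F (l.map Prod.fst)) = 2 ^ l.length := by
  induction l with
  | nil => exact finrank_span_singleton one_ne_zero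
  | cons p l ih =>
    rw [List.pairwise_cons] at h2
    have ih' := ih (fun p hp => h1 p (List.mem_cons_of_mem _ hp)) h2.2
    have hker (l' : List R) (hl' : ∀ a ∈ l', p.2 * a = ε a * p.2) :
        ∀ x ∈ prodSpan F l', p.2 * x = ε x * p.2 := by
      induction l' with
      | nil =>
        intro x hx
        obtain ⟨c, rfl⟩ := Submodule.mem_span_singleton.mp hx
        rw [map_smul, map_one, mul_smul_comm, smul_mul_assoc, one_mul, mul_one]
      | cons a l' ih'' =>
        have h3 := ih'' fun a ha => hl' a (List.mem_cons_of_mem _ ha)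
        intro x hx
        obtain ⟨y, hy, _, ⟨z, hz, rfl⟩, rfl⟩ := Submodule.mem_sup.mp hx
        rw [LinearMap.mulLeft_apply, map_add, map_mul, mul_add, add_mul, h3 y hy, ← mul_assoc,
          hl' a (by simp), mul_assoc, h3 z hz, mul_assoc]
    have hker' := hker (l.map Prod.fst) (by
      intro a ha
      obtain ⟨q, hq, rfl⟩ := List.mem_map.mp ha
      exact h2.1 q hq)
    -- The skew derivation D(x) = `p.2 * x - ε x * p.2` vanishes on the span W of the later
    -- products, and D(`p.1 * x`) = x for x in W. Hence multiplication by `p.1` is injective on W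
    -- and its image meets W only in 0, so each new factor doubles the dimension.
    have hD (x) (hx : x ∈ prodSpan F (l.map Prod.fst)) :
        p.2 * (p.1 * x) - ε (p.1 * x) * p.2 = x := by
      rw [map_mul, mul_assoc (ε p.1), ← hker' x hx, ← mul_assoc, ← mul_assoc, ← sub_mul,
        h1 p (by simp), one_mul]
    have hinf : prodSpan F (l.map Prod.fst) ⊓
        (prodSpan F (l.map Prod.fst)).map (LinearMap.mulLeft F p.1) = ⊥ := by
      rw [eq_bot_iff]
      rintro _ ⟨hx, z, hz, rfl⟩
      have h4 : z = 0 := by rw [← hD z hz, sub_eq_zero]; exact hker' _ hx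
      rw [h4, map_zero]
      exact zero_mem _
    have hmap : Module.finrank F ((prodSpan F (l.map Prod.fst)).map (LinearMap.mulLeft F p.1)) =
        Module.finrank F (prodSpan F (l.map Prod.fst)) := by
      have hinj : Function.Injective
          ((LinearMap.mulLeft F p.1).domRestrict (prodSpan F (l.map Prod.fst))) := by
        rw [← LinearMap.ker_eq_bot, eq_bot_iff]
        rintro ⟨z, hz⟩ h5
        have h5' : p.1 * z = 0 := h5
        have h6 := hD z hz
        rw [h5', map_zero, mul_zero, zero_mul, sub_zero] at h6
        exact Subtype.ext h6.symm
      have h7 := LinearMap.finrank_range_of_inj hinj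
      rwa [LinearMap.range_domRestrict] at h7
    have h8 := Submodule.finrank_sup_add_finrank_inf_eq (prodSpan F (l.map Prod.fst))
      ((prodSpan F (l.map Prod.fst)).map (LinearMap.mulLeft F p.1))
    rw [hinf, finrank_bot, hmap, ih'] at h8
    rw [List.length_cons, pow_succ, mul_two, ← h8]
    rfl

theorem map_prodSpan {R' : Type*} [Ring R'] [Algebra F R'] (f : R →ₐ[F] R') (l : List R) :
    (prodSpan F l).map f.toLinearMap = prodSpan F (l.map f) := by
  induction l with
  | nil =>
    change (F ∙ (1 : R)).map f.toLinearMap = F ∙ (1 : R')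
    rw [Submodule.map_span, Set.image_singleton]
    simp
  | cons a l ih =>
    change (prodSpan F l ⊔ (prodSpan F l).map (LinearMap.mulLeft F a)).map f.toLinearMap =
      prodSpan F (l.map f) ⊔ (prodSpan F (l.map f)).map (LinearMap.mulLeft F (f a))
    rw [Submodule.map_sup, ih, ← ih, ← Submodule.map_comp, ← Submodule.map_comp]
    congr 2
    ext x
    simp

variable {S : Type*} [AddCommGroup S] [Module F S] (n : QuadraticForm F S)

/-- This bounds the dimension of the Clifford algebra by 2 ^ m; the matching lower bound comes from
the representation. -/
theorem prodSpan_ι_eq_top {m : ℕ} (b : Module.Basis (Fin m) F S) :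
    prodSpan F (List.ofFn fun i => CliffordAlgebra.ι n (b i)) = ⊤ := by
  set l := List.ofFn fun i => CliffordAlgebra.ι n (b i) with hl
  have hmem (a) (ha : a ∈ l) : ∃ i, CliffordAlgebra.ι n (b i) = a := by
    simpa [hl, List.mem_ofFn] using ha
  have hmul := mul_mem_prodSpan (F := F) l
    (fun a ha => by
      obtain ⟨i, rfl⟩ := hmem a ha
      exact ⟨_, CliffordAlgebra.ι_sq_scalar n _⟩)
    (fun a ha c hc => by
      obtain ⟨i, rfl⟩ := hmem a ha
      obtain ⟨j, rfl⟩ := hmem c hc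
      exact ⟨_, CliffordAlgebra.ι_mul_ι_add_swap _ _⟩)
  rw [eq_top_iff]
  rintro x -
  induction x using CliffordAlgebra.left_induction with
  | algebraMap r =>
    rw [Algebra.algebraMap_eq_smul_one]
    exact Submodule.smul_mem _ _ (one_mem_prodSpan l)
  | add x y hx hy => exact add_mem hx hy
  | ι_mul x v hx =>
    rw [← b.sum_repr v, map_sum, Finset.sum_mul]
    refine Submodule.sum_mem _ fun i _ => ?_
    rw [map_smul, smul_mul_assoc]
    exact Submodule.smul_mem _ _ (hmul _ (by simp [hl, List.mem_ofFn]) x hx)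

/-- A representation of the Clifford algebra of a nonsingular form on a space of dimension `m`, in a
graded algebra of dimension `2 ^ m`, is an isomorphism. -/
theorem cliffordLift_bijective [FiniteDimensional F S] (hn : n.polarBilin.SeparatingLeft)
    [Nontrivial R] (hR : Module.finrank F R = 2 ^ Module.finrank F S) (p : S →ₗ[F] R)
    (hp : ∀ x, p x * p x = algebraMap F R (n x)) (ε : R →ₐ[F] R) (hε : ∀ x, ε (p x) = -p x) :
    Function.Bijective (CliffordAlgebra.lift n ⟨p, hp⟩) := by
  let b := Module.finBasis F S
  have hnd : n.polarBilin.Nondegenerate := by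
    refine ⟨hn, fun y hy => hn y fun x => ?_⟩
    rw [QuadraticMap.polarBilin_apply_apply, QuadraticMap.polar_comm]
    exact hy x
  let d := LinearMap.BilinForm.dualBasis n.polarBilin hnd b
  have hd (i j) : QuadraticMap.polar n (d i) (b j) = if j = i then 1 else 0 :=
    LinearMap.BilinForm.apply_dualBasis_left hnd b i j
  have hpp (x y) : p x * p y + p y * p x = algebraMap F R (QuadraticMap.polar n x y) := by
    rw [QuadraticMap.polar, map_sub, map_sub, ← hp, ← hp, ← hp, map_add]
    noncomm_ring
  let f := CliffordAlgebra.lift n ⟨p, hp⟩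
  -- The dual basis supplies the skew derivations. Since ε is -1 on the vectors, the derivation
  -- attached to p(d i) takes p(b j) to the anticommutator, which is δ_{ij}.
  let l := List.ofFn fun i => (p (b i), p (d i))
  have hW : Module.finrank F (prodSpan F (l.map Prod.fst)) = 2 ^ l.length := by
    refine finrank_prodSpan_eq ε l (fun q hq => ?_) (List.pairwise_ofFn.mpr fun i j hij => ?_)
    · obtain ⟨i, rfl⟩ := (List.mem_ofFn' _ _).mp hq
      simp only [hε]
      rw [neg_mul, sub_neg_eq_add, hpp, hd, if_pos rfl, map_one]
    · simp only [hε]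
      rw [neg_mul, eq_neg_iff_add_eq_zero, hpp, hd, if_neg hij.ne', map_zero]
  have hlen : l.length = Module.finrank F S := by simp [l]
  have : FiniteDimensional F R := FiniteDimensional.of_finrank_pos (by rw [hR]; positivity)
  have hlf : (List.ofFn fun i => CliffordAlgebra.ι n (b i)).map f = l.map Prod.fst := by
    rw [List.map_ofFn, List.map_ofFn]
    congr 1
    ext i
    exact CliffordAlgebra.lift_ι_apply _ _ _
  have hrange : LinearMap.range f.toLinearMap = ⊤ := by
    rw [← Submodule.map_top, ← prodSpan_ι_eq_top n b, map_prodSpan, hlf]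
    exact Submodule.eq_top_of_finrank_eq (by rw [hW, hlen, hR])
  have hC : Module.finrank F (CliffordAlgebra n) ≤ 2 ^ Module.finrank F S := by
    rw [← finrank_top, ← prodSpan_ι_eq_top n b]
    exact (finrank_prodSpan_le _).trans (by simp)
  have hfd : FiniteDimensional F (CliffordAlgebra n) := by
    refine Module.finite_def.mpr ?_
    rw [← prodSpan_ι_eq_top n b]
    exact Module.Finite.iff_fg.mp inferInstance
  have hsurj : Function.Surjective f.toLinearMap := LinearMap.range_eq_top.mp hrange
  have heq : Module.finrank F (CliffordAlgebra n) = Module.finrank F R :=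
    le_antisymm (hC.trans hR.ge) (LinearMap.finrank_le_finrank_of_surjective hsurj)
  exact ⟨(LinearMap.injective_iff_surjective_of_finrank_eq_finrank heq).mpr hsurj, hsurj⟩

end ProdSpan

/-! ### The homomorphism `α₀` is an isomorphism -/

section BlockMatrices

variable {A : Type*} [CommRing A] (R : Type*) [Ring R] [Algebra A R]

/-- The block diagonal `2 × 2` matrices. -/
def blockDiag : R × R →ₐ[A] Matrix (Fin 2) (Fin 2) R where
  toFun p := !![p.1, 0; 0, p.2]
  map_one' := by ext i j; fin_cases i <;> fin_cases j <;> rfl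
  map_mul' p q := by simp
  map_zero' := by ext i j; fin_cases i <;> fin_cases j <;> rfl
  map_add' p q := by simp
  commutes' a := by ext i j; fin_cases i <;> fin_cases j <;> simp [Matrix.algebraMap_matrix_apply]

variable {R}

theorem blockDiag_apply (p : R × R) :
    blockDiag (A := A) R p = !![p.1, 0; 0, p.2] := rfl

theorem blockDiag_injective : Function.Injective (blockDiag (A := A) R) := by
  intro p q h
  exact Prod.ext (congrFun (congrFun h 0) 0) (congrFun (congrFun h 1) 1)

/-- The linear map `x ↦ (0, p x; q x, 0)`. -/
def offDiag {M : Type*} [AddCommGroup M] [Module A M] (p q : M →ₗ[A] R) :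
    M →ₗ[A] Matrix (Fin 2) (Fin 2) R where
  toFun x := !![0, p x; q x, 0]
  map_add' x y := by simp
  map_smul' a x := by simp

theorem offDiag_mul_offDiag {M : Type*} [AddCommGroup M] [Module A M] (p q : M →ₗ[A] R) (x y : M) :
    offDiag p q x * offDiag p q y = blockDiag (A := A) R (p x * q y, q x * p y) := by
  simp [offDiag, blockDiag_apply]

variable (A R) in
/-- The automorphism of the algebra of `2 × 2` matrices that is the identity on the block diagonal
matrices and `-1` on the others. -/
def gradeAut : Matrix (Fin 2) (Fin 2) R →ₐ[A] Matrix (Fin 2) (Fin 2) R where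
  toFun M := !![M 0 0, -M 0 1; -M 1 0, M 1 1]
  map_one' := by simp [Matrix.one_fin_two]
  map_mul' M N := by simp [Matrix.mul_apply, Fin.sum_univ_two, ← neg_add_rev, add_comm]
  map_zero' := by ext i j; fin_cases i <;> fin_cases j <;> simp
  map_add' M N := by simp [add_comm]
  commutes' a := by ext i j; fin_cases i <;> fin_cases j <;> simp [Matrix.algebraMap_matrix_apply]

theorem gradeAut_offDiag {M : Type*} [AddCommGroup M] [Module A M] (p q : M →ₗ[A] R) (x : M) :
    gradeAut A R (offDiag p q x) = -offDiag p q x := by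
  ext i j
  fin_cases i <;> fin_cases j <;> simp [gradeAut, offDiag]

end BlockMatrices

namespace SymmetricComposition

variable {F : Type u} [Field F] {S : Type v} [AddCommGroup S] [Module F S]
  {n : QuadraticForm F S} (c : SymmetricComposition n) (hn : n.polarBilin.SeparatingLeft)

theorem inv_multiplier_smul (a : F) (R : Type*) [Ring R] [Algebra F R] :
    (c.multiplier⁻¹ : Fˣ).1 • algebraMap F R (c.multiplier * a) = algebraMap F R a := by
  rw [Algebra.smul_def, ← map_mul, ← mul_assoc, Units.inv_mul, one_mul]

/-- The homomorphism `C(S, n) → M₂(End S)` with `x ↦ (0, r_x; λ⁻¹ ℓ_x, 0)`. -/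
def alpha : CliffordAlgebra n →ₐ[F] Matrix (Fin 2) (Fin 2) (Module.End F S) :=
  CliffordAlgebra.lift n ⟨offDiag c.right ((c.multiplier⁻¹ : Fˣ).1 • c.left), fun x => by
    rw [offDiag_mul_offDiag (A := F), LinearMap.smul_apply, mul_smul_comm, smul_mul_assoc,
      c.right_mul_left hn, c.left_mul_right hn, inv_multiplier_smul, ← Prod.algebraMap_apply,
      AlgHom.commutes]⟩

theorem alpha_ι (x : S) : c.alpha hn (CliffordAlgebra.ι n x) =
    offDiag c.right ((c.multiplier⁻¹ : Fˣ).1 • c.left) x :=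
  CliffordAlgebra.lift_ι_apply _ _ _

theorem alpha_ι_mul_ι (x y : S) :
    c.alpha hn (CliffordAlgebra.ι n x * CliffordAlgebra.ι n y) =
      blockDiag (A := F) _ ((c.multiplier⁻¹ : Fˣ).1 • (c.right x * c.left y, c.left x * c.right y)) := by
  rw [map_mul, alpha_ι, alpha_ι, offDiag_mul_offDiag (A := F), LinearMap.smul_apply,
    LinearMap.smul_apply, mul_smul_comm, smul_mul_assoc]
  rfl

/-- Dimension 8 enters here: 4 · 8² = 2⁸. -/
theorem alpha_bijective [FiniteDimensional F S] (hdim : Module.finrank F S = 8) :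
    Function.Bijective (c.alpha hn) := by
  have : Nontrivial S := Module.nontrivial_of_finrank_pos (R := F) (by omega)
  refine cliffordLift_bijective n hn ?_ _ _ (gradeAut F _) fun x => gradeAut_offDiag _ _ x
  rw [Module.finrank_matrix, Module.finrank_linearMap, hdim]
  rfl

theorem exists_blockDiag_eq_alpha (z : CliffordAlgebra n) (hz : z ∈ CliffordAlgebra.evenOdd n 0) :
    ∃ p, blockDiag (A := F) _ p = c.alpha hn z := by
  induction z, hz using CliffordAlgebra.even_induction with
  | algebraMap r => exact ⟨algebraMap F _ r, by rw [AlgHom.commutes, AlgHom.commutes]⟩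
  | add x y hx hy ihx ihy =>
    obtain ⟨p, hp⟩ := ihx
    obtain ⟨q, hq⟩ := ihy
    exact ⟨p + q, by rw [map_add, map_add, hp, hq]⟩
  | ι_mul_ι_mul x y z hz ih =>
    obtain ⟨p, hp⟩ := ih
    exact ⟨_ * p, by rw [map_mul (c.alpha hn), ← hp, alpha_ι_mul_ι, map_mul]⟩

theorem alpha_odd_apply (z : CliffordAlgebra n) (hz : z ∈ CliffordAlgebra.evenOdd n 1) :
    c.alpha hn z 0 0 = 0 ∧ c.alpha hn z 1 1 = 0 := by
  induction z, hz using CliffordAlgebra.odd_induction with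
  | ι v => rw [alpha_ι]; exact ⟨rfl, rfl⟩
  | add x y hx hy ihx ihy =>
    rw [map_add, Matrix.add_apply, Matrix.add_apply, ihx.1, ihx.2, ihy.1, ihy.2]
    simp
  | ι_mul_ι_mul x y z hz ih =>
    rw [map_mul, alpha_ι_mul_ι, blockDiag_apply, Matrix.mul_apply, Matrix.mul_apply,
      Fin.sum_univ_two, Fin.sum_univ_two, ih.1, ih.2]
    simp

/-- The homomorphism `α₀` from `C₀(S, n)` to `End S × End S`. -/
def alphaZero : CliffordAlgebra.even n →ₐ[F] Module.End F S × Module.End F S :=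
  { toFun := fun z => (c.alpha hn z.1 0 0, c.alpha hn z.1 1 1)
    map_one' := by
      change (c.alpha hn 1 0 0, c.alpha hn 1 1 1) = 1
      rw [map_one]
      rfl
    map_mul' := fun z w => by
      obtain ⟨p, hp⟩ := c.exists_blockDiag_eq_alpha hn z.1 z.2
      obtain ⟨q, hq⟩ := c.exists_blockDiag_eq_alpha hn w.1 w.2
      change (c.alpha hn (z.1 * w.1) 0 0, c.alpha hn (z.1 * w.1) 1 1) = _
      rw [map_mul (c.alpha hn), ← hp, ← hq, ← map_mul]
      rfl
    map_zero' := by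
      change (c.alpha hn 0 0 0, c.alpha hn 0 1 1) = 0
      rw [map_zero]
      rfl
    map_add' := fun z w => by
      change (c.alpha hn (z.1 + w.1) 0 0, c.alpha hn (z.1 + w.1) 1 1) = _
      rw [map_add]
      rfl
    commutes' := fun a => by
      change (c.alpha hn (algebraMap F _ a) 0 0, c.alpha hn (algebraMap F _ a) 1 1) = _
      rw [AlgHom.commutes]
      simp only [Matrix.algebraMap_matrix_apply, if_true]
      rfl }

theorem blockDiag_alphaZero (z : CliffordAlgebra.even n) :
    blockDiag (A := F) _ (c.alphaZero hn z) = c.alpha hn z.1 := by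
  obtain ⟨p, hp⟩ := c.exists_blockDiag_eq_alpha hn z.1 z.2
  have h : c.alphaZero hn z = (c.alpha hn z.1 0 0, c.alpha hn z.1 1 1) := rfl
  rw [h, ← hp]
  rfl

theorem alphaZero_ι (x y : S) : c.alphaZero hn ((CliffordAlgebra.even.ι n).bilin x y) =
    (c.multiplier⁻¹ : Fˣ).1 • (c.right x * c.left y, c.left x * c.right y) := by
  apply blockDiag_injective (A := F)
  rw [blockDiag_alphaZero, ← alpha_ι_mul_ι]
  rfl

variable [FiniteDimensional F S]

/-- Odd elements have zero diagonal blocks. So if z maps to a block diagonal matrix, the even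
component of z already has the required diagonal blocks. -/
theorem alphaZero_bijective (hdim : Module.finrank F S = 8) :
    Function.Bijective (c.alphaZero hn) := by
  obtain ⟨hinj, hsurj⟩ := c.alpha_bijective hn hdim
  refine ⟨fun z w h => Subtype.ext (hinj ?_), fun p => ?_⟩
  · rw [← blockDiag_alphaZero, h, blockDiag_alphaZero]
  · obtain ⟨z, hz⟩ := hsurj (blockDiag (A := F) _ p)
    have htop : z ∈ CliffordAlgebra.evenOdd n 0 ⊔ CliffordAlgebra.evenOdd n 1 := by
      rw [(CliffordAlgebra.evenOdd_isCompl n).sup_eq_top]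
      trivial
    obtain ⟨x, hx, y, hy, rfl⟩ := Submodule.mem_sup.mp htop
    obtain ⟨h0, h1⟩ := c.alpha_odd_apply hn y hy
    refine ⟨⟨x, hx⟩, Prod.ext ?_ ?_⟩
    · have := congrFun (congrFun hz 0) 0
      rw [map_add, Matrix.add_apply, h0, add_zero] at this
      exact this
    · have := congrFun (congrFun hz 1) 1
      rw [map_add, Matrix.add_apply, h1, add_zero] at this
      exact this

variable (A : Type w) [CommRing A] [Algebra F A]

theorem alphaEven_evenExt (z : CliffordAlgebra.even n) :
    c.alphaEven A hn (evenExt n A z) = (1 ⊗ₜ (c.alphaZero hn z).1, 1 ⊗ₜ (c.alphaZero hn z).2) := by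
  let i : Module.End F S →ₐ[F] A ⊗[F] Module.End F S := Algebra.TensorProduct.includeRight
  suffices h : ((c.alphaEven A hn).restrictScalars F).comp (evenExt n A) =
      (AlgHom.prodMap i i).comp (c.alphaZero hn) from DFunLike.congr_fun h z
  refine CliffordAlgebra.even.algHom_ext _
    (CliffordAlgebra.EvenHom.ext (LinearMap.ext₂ fun x y => ?_))
  change c.alphaEven A hn (evenExt n A ((CliffordAlgebra.even.ι n).bilin x y)) =
    (AlgHom.prodMap i i) (c.alphaZero hn ((CliffordAlgebra.even.ι n).bilin x y))
  rw [evenExt_ι, alphaEven_ι, alphaZero_ι, map_smul, algebraMap_smul,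
    LinearMap.baseChange_tmul, LinearMap.baseChange_tmul, LinearMap.baseChange_tmul,
    LinearMap.baseChange_tmul, Algebra.TensorProduct.tmul_mul_tmul,
    Algebra.TensorProduct.tmul_mul_tmul, one_mul]
  rfl

end SymmetricComposition

section EvenExt

variable {F : Type u} [Field F] {S : Type v} [AddCommGroup S] [Module F S] [FiniteDimensional F S]
  (n : QuadraticForm F S) (A : Type w) [CommRing A] [Algebra F A]

theorem subalgebra_even_eq_top {R : Type*} [CommRing R] {M : Type*} [AddCommGroup M] [Module R M]
    (Q : QuadraticForm R M) (T : Subalgebra R (CliffordAlgebra.even Q))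
    (hT : ∀ x y, (CliffordAlgebra.even.ι Q).bilin x y ∈ T) : T = ⊤ := by
  rw [eq_top_iff]
  rintro ⟨z, hz⟩ -
  induction z, hz using CliffordAlgebra.even_induction with
  | algebraMap r => exact T.algebraMap_mem r
  | add x y hx hy ihx ihy => exact T.add_mem ihx ihy
  | ι_mul_ι_mul x y z hz ih => exact T.mul_mem (hT x y) ih

/-- The homomorphism `A ⊗ C₀(S, n) → C₀(S_A, n_A)`. -/
def evenBaseChange : A ⊗[F] CliffordAlgebra.even n →ₐ[A] CliffordAlgebra.even (extForm A n) :=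
  Algebra.TensorProduct.lift (Algebra.ofId A _) (evenExt n A) (fun a _ => Algebra.commutes a _)

variable {A} in
theorem evenBaseChange_tmul (a : A) (z : CliffordAlgebra.even n) :
    evenBaseChange n A (a ⊗ₜ z) = a • evenExt n A z :=
  (Algebra.TensorProduct.lift_tmul _ _ _ _ _).trans (Algebra.smul_def _ _).symm

theorem evenBaseChange_surjective : Function.Surjective (evenBaseChange n A) := by
  rw [← AlgHom.range_eq_top]
  refine subalgebra_even_eq_top _ _ fun X Y => ?_
  induction X with
  | zero => rw [map_zero]; exact zero_mem _
  | add X X' hX hX' => rw [map_add]; exact add_mem hX hX'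
  | tmul a x =>
    induction Y with
    | zero => rw [map_zero]; exact zero_mem _
    | add Y Y' hY hY' => rw [map_add]; exact add_mem hY hY'
    | tmul b y =>
      refine ⟨(a * b) ⊗ₜ (CliffordAlgebra.even.ι n).bilin x y, ?_⟩
      have h (a : A) (x : S) : a ⊗ₜ[F] x = a • ((1 : A) ⊗ₜ[F] x) := by
        rw [smul_tmul', smul_eq_mul, mul_one]
      rw [h a x, h b y, LinearMap.map_smul₂, map_smul, smul_smul, ← evenExt_ι]
      exact evenBaseChange_tmul n _ _

end EvenExt

namespace SymmetricComposition

variable {F : Type u} [Field F] {S : Type v} [AddCommGroup S] [Module F S] [FiniteDimensional F S]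
  {n : QuadraticForm F S} (c : SymmetricComposition n) (hn : n.polarBilin.SeparatingLeft)
  (A : Type w) [CommRing A] [Algebra F A]

/-- The composite A ⊗ C₀(S, n) → C₀(S_A, n_A) → End(S_A) × End(S_A) is the base change of the
isomorphism α₀ over F. As the first map is onto, the second is bijective, and no separate base
change theorem for C₀ is needed. -/
theorem alphaEven_comp_evenBaseChange_bijective (hdim : Module.finrank F S = 8) :
    Function.Bijective fun z => c.alphaEven A hn (evenBaseChange n A z) := by
  let e := (LinearEquiv.ofBijective (c.alphaZero hn).toLinearMap
    (c.alphaZero_bijective hn hdim)).baseChange F A _ _ ≪≫ₗ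
      TensorProduct.prodRight F A A (Module.End F S) (Module.End F S)
  have h : (fun z => c.alphaEven A hn (evenBaseChange n A z)) = e := by
    ext1 z
    induction z with
    | zero => simp only [map_zero]
    | add x y hx hy => simp only [map_add, hx, hy]
    | tmul a z =>
      rw [evenBaseChange_tmul, map_smul, alphaEven_evenExt, Prod.smul_mk, smul_tmul', smul_tmul',
        smul_eq_mul, mul_one]
      rfl
  rw [h]
  exact e.bijective

theorem alphaEven_surjective (hdim : Module.finrank F S = 8) :
    Function.Surjective (c.alphaEven A hn) := by
  intro p
  obtain ⟨z, hz⟩ := (c.alphaEven_comp_evenBaseChange_bijective hn A hdim).2 p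
  exact ⟨_, hz⟩

theorem alphaEven_injective (hdim : Module.finrank F S = 8) :
    Function.Injective (c.alphaEven A hn) := by
  intro x y h
  obtain ⟨z, rfl⟩ := evenBaseChange_surjective n A x
  obtain ⟨w, rfl⟩ := evenBaseChange_surjective n A y
  rw [(c.alphaEven_comp_evenBaseChange_bijective hn A hdim).1 h]

end SymmetricComposition

/-! ### Related triples of similarities -/

section Nonsingular

variable {F : Type u} [Field F] {S : Type v} [AddCommGroup S] [Module F S]
  {n : QuadraticForm F S} {A : Type w} [CommRing A] [Algebra F A]

theorem exists_polar_eq_one [Nontrivial S] (hn : n.polarBilin.SeparatingLeft) :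
    ∃ x y : S, QuadraticMap.polar n x y = 1 := by
  obtain ⟨x, hx⟩ := exists_ne (0 : S)
  have : ∃ y, QuadraticMap.polar n x y ≠ 0 := by
    by_contra! h
    exact hx (hn x h)
  obtain ⟨y, hy⟩ := this
  refine ⟨x, (QuadraticMap.polar n x y)⁻¹ • y, ?_⟩
  rw [QuadraticMap.polar_smul_right, smul_eq_mul, inv_mul_cancel₀ hy]

theorem exists_apply_ne_zero [Nontrivial S] (hn : n.polarBilin.SeparatingLeft) :
    ∃ x : S, n x ≠ 0 := by
  by_contra! h
  obtain ⟨x, y, hxy⟩ := exists_polar_eq_one hn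
  simp [QuadraticMap.polar, h] at hxy

theorem act_add (a b : A ⊗[F] Module.End F S) (X : A ⊗[F] S) :
    act (a + b) X = act a X + act b X := by
  rw [act, map_add]
  rfl

theorem act_smul (t : A) (a : A ⊗[F] Module.End F S) (X : A ⊗[F] S) :
    act (t • a) X = t • act a X := by
  rw [act, map_smul]
  rfl

variable [FiniteDimensional F S]

/-- The coordinates of X in a basis coming from S are its polar products with the dual basis, and
duality survives scalar extension. -/
theorem eq_zero_of_polar_extForm (hn : n.polarBilin.SeparatingLeft) {X : A ⊗[F] S}
    (hX : ∀ y : S, QuadraticMap.polar (extForm A n) X (1 ⊗ₜ y) = 0) : X = 0 := by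
  let b := Module.finBasis F S
  have hnd : n.polarBilin.Nondegenerate := by
    refine ⟨hn, fun y hy => hn y fun x => ?_⟩
    rw [QuadraticMap.polarBilin_apply_apply, QuadraticMap.polar_comm]
    exact hy x
  let d := LinearMap.BilinForm.dualBasis n.polarBilin hnd b
  have hd (i j) : QuadraticMap.polar n (d i) (b j) = if j = i then 1 else 0 :=
    LinearMap.BilinForm.apply_dualBasis_left hnd b i j
  have h (i) : (b.baseChange A).repr X i = QuadraticMap.polar (extForm A n) X (1 ⊗ₜ d i) := by
    conv_rhs => rw [← (b.baseChange A).sum_repr X]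
    rw [← QuadraticMap.polarBilin_apply_apply, map_sum, LinearMap.sum_apply]
    simp only [map_smul, LinearMap.smul_apply, QuadraticMap.polarBilin_apply_apply,
      Module.Basis.baseChange_apply, polar_extForm_tmul]
    simp only [QuadraticMap.polar_comm n (b _), hd]
    simp
  refine (b.baseChange A).ext_elem fun i => ?_
  rw [h, hX, map_zero]
  rfl

theorem eq_of_polar_extForm (hn : n.polarBilin.SeparatingLeft) {X X' : A ⊗[F] S}
    (h : ∀ Y, QuadraticMap.polar (extForm A n) X Y = QuadraticMap.polar (extForm A n) X' Y) :
    X = X' := by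
  refine sub_eq_zero.mp (eq_zero_of_polar_extForm hn fun y => ?_)
  rw [QuadraticMap.polar_sub_left, h, sub_self]

theorem IsSimilarity.polar {f : A ⊗[F] Module.End F S} {μ : Aˣ} (hf : IsSimilarity n f μ)
    (X Y : A ⊗[F] S) : QuadraticMap.polar (extForm A n) (act f X) (act f Y) =
      μ * QuadraticMap.polar (extForm A n) X Y := by
  simp only [QuadraticMap.polar, ← map_add, hf X, hf Y, hf (X + Y)]
  ring

variable (n A) in
/-- `a'` is adjoint to `a` for the polar form of `n`. -/
def IsAdjoint (a a' : A ⊗[F] Module.End F S) : Prop :=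
  ∀ X Y, QuadraticMap.polar (extForm A n) (act a X) Y =
    QuadraticMap.polar (extForm A n) X (act a' Y)

theorem IsAdjoint.mul {a a' b b' : A ⊗[F] Module.End F S} (ha : IsAdjoint n A a a')
    (hb : IsAdjoint n A b b') : IsAdjoint n A (a * b) (b' * a') := fun X Y => by
  rw [act_mul, act_mul, ha, hb]

theorem IsAdjoint.add {a a' b b' : A ⊗[F] Module.End F S} (ha : IsAdjoint n A a a')
    (hb : IsAdjoint n A b b') : IsAdjoint n A (a + b) (a' + b') := fun X Y => by
  rw [act_add, act_add, QuadraticMap.polar_add_left, QuadraticMap.polar_add_right, ha, hb]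

theorem IsAdjoint.smul {a a' : A ⊗[F] Module.End F S} (ha : IsAdjoint n A a a') (t : A) :
    IsAdjoint n A (t • a) (t • a') := fun X Y => by
  rw [act_smul, act_smul, QuadraticMap.polar_smul_left, QuadraticMap.polar_smul_right, ha]

variable (n A) in
theorem IsAdjoint.one : IsAdjoint n A 1 1 := fun X Y => by rw [act_one, act_one]

theorem IsAdjoint.unique (hn : n.polarBilin.SeparatingLeft) {a b b' : A ⊗[F] Module.End F S}
    (h : IsAdjoint n A a b) (h' : IsAdjoint n A a b') : b = b' := by
  refine act_injective (LinearMap.ext fun X => eq_of_polar_extForm hn fun Y => ?_)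
  rw [QuadraticMap.polar_comm, ← h, h', QuadraticMap.polar_comm]

variable (n) in
/-- The operator `z ↦ b_n(w, z) u`. -/
def rankOne (u w : S) : Module.End F S := (n.polarBilin w).smulRight u

variable (A) in
theorem act_rankOne (u w : S) (X : A ⊗[F] S) : act (1 ⊗ₜ rankOne n u w) X =
    QuadraticMap.polar (extForm A n) (1 ⊗ₜ w) X • (1 ⊗ₜ u) := by
  induction X with
  | zero => rw [map_zero, QuadraticMap.polar_zero_right, zero_smul]
  | add X Y hX hY => rw [map_add, QuadraticMap.polar_add_right, add_smul, hX, hY]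
  | tmul a x =>
    rw [act_tmul, polar_extForm_tmul, one_mul, smul_tmul', smul_eq_mul, mul_one, mul_comm,
      ← Algebra.smul_def, smul_tmul]
    rfl

variable (A) in
theorem isAdjoint_rankOne (u w : S) :
    IsAdjoint n A (1 ⊗ₜ rankOne n u w) (1 ⊗ₜ rankOne n w u) := fun X Y => by
  rw [act_rankOne, act_rankOne, QuadraticMap.polar_smul_left, QuadraticMap.polar_smul_right,
    QuadraticMap.polar_comm _ X, smul_eq_mul, smul_eq_mul, mul_comm]

/-- If conjugation by `g` preserves adjoints, then `g` is a similarity for the polar form. -/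
theorem exists_polar_act_eq [Nontrivial S] (hn : n.polarBilin.SeparatingLeft)
    (g : (A ⊗[F] Module.End F S)ˣ)
    (hg : ∀ a a', IsAdjoint n A a a' → IsAdjoint n A (g * a * (g⁻¹ : (A ⊗[F] Module.End F S)ˣ).1)
      (g * a' * (g⁻¹ : (A ⊗[F] Module.End F S)ˣ).1)) :
    ∃ ν : Aˣ, ∀ X Y, QuadraticMap.polar (extForm A n) (act g.1 X) (act g.1 Y) =
      ν * QuadraticMap.polar (extForm A n) X Y := by
  obtain ⟨u, v, huv⟩ := exists_polar_eq_one hn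
  have huv' : QuadraticMap.polar (extForm A n) (1 ⊗ₜ u) (1 ⊗ₜ v) = 1 := by
    rw [polar_extForm_tmul, huv, map_one, mul_one, mul_one]
  set ν := QuadraticMap.polar (extForm A n) (act g.1 (1 ⊗ₜ u)) (act g.1 (1 ⊗ₜ v)) with hν
  have hadj (a a') (h : IsAdjoint n A a a') (X Y) :
      QuadraticMap.polar (extForm A n) (act g.1 (act a X)) (act g.1 Y) =
        QuadraticMap.polar (extForm A n) (act g.1 X) (act g.1 (act a' Y)) := by
    have h1 := hg a a' h (act g.1 X) (act g.1 Y)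
    simp only [act_mul] at h1
    simp only [← act_mul _ g.1, Units.inv_mul, act_one] at h1
    exact h1
  have h1 (X) (w : S) : QuadraticMap.polar (extForm A n) (act g.1 X) (act g.1 (1 ⊗ₜ w)) =
      ν * QuadraticMap.polar (extForm A n) X (1 ⊗ₜ w) := by
    -- For the adjoint pair z ↦ b(w, z)u and z ↦ b(u, z)w, with b(u, v) = 1, this reads b(w, X)
    -- b(g(u), g(v)) = b(g(X), g(w)).
    have h2 := hadj _ _ (isAdjoint_rankOne A u w) X (1 ⊗ₜ v)
    rw [act_rankOne, act_rankOne, map_smul, map_smul, QuadraticMap.polar_smul_left,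
      QuadraticMap.polar_smul_right, huv', ← hν, one_smul, QuadraticMap.polar_comm _ _ X] at h2
    rw [← h2, smul_eq_mul, mul_comm]
  have h2 (X Y) : QuadraticMap.polar (extForm A n) (act g.1 X) (act g.1 Y) =
      ν * QuadraticMap.polar (extForm A n) X Y := by
    induction Y with
    | zero => rw [map_zero, QuadraticMap.polar_zero_right, QuadraticMap.polar_zero_right, mul_zero]
    | add Y Y' hY hY' =>
      rw [map_add, QuadraticMap.polar_add_right, QuadraticMap.polar_add_right, hY, hY', mul_add]
    | tmul a w =>
      have h3 : a ⊗ₜ[F] w = a • ((1 : A) ⊗ₜ[F] w) := by rw [smul_tmul', smul_eq_mul, mul_one]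
      rw [h3, map_smul, QuadraticMap.polar_smul_right, QuadraticMap.polar_smul_right, h1]
      simp only [smul_eq_mul]
      ring
  -- Evaluating at g⁻¹(u) and g⁻¹(v) exhibits an inverse of ν.
  have h3 := h2 (act (g⁻¹ : (A ⊗[F] Module.End F S)ˣ).1 (1 ⊗ₜ u))
    (act (g⁻¹ : (A ⊗[F] Module.End F S)ˣ).1 (1 ⊗ₜ v))
  rw [act_unit_inv, act_unit_inv, huv'] at h3
  exact ⟨Units.mkOfMulEqOne _ _ h3.symm, h2⟩

end Nonsingular

namespace SymmetricComposition

variable {F : Type u} [Field F] {S : Type v} [AddCommGroup S] [Module F S]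
  {n : QuadraticForm F S} (c : SymmetricComposition n) {A : Type w} [CommRing A] [Algebra F A]

theorem act_left (X Y : A ⊗[F] S) : act (c.left.baseChange A X) Y = c.extMul A X Y := by
  induction X with
  | zero => simp [act]
  | add X X' hX hX' => simp only [map_add, LinearMap.add_apply, ← hX, ← hX', act]
  | tmul a x =>
    induction Y with
    | zero => simp
    | add Y Y' hY hY' => simp only [map_add, hY, hY']
    | tmul b y => rw [LinearMap.baseChange_tmul, act_tmul]; simp [extMul, left]

theorem act_right (X Y : A ⊗[F] S) : act (c.right.baseChange A X) Y = c.extMul A Y X := by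
  induction X with
  | zero => simp [act]
  | add X X' hX hX' => simp only [map_add, LinearMap.add_apply, ← hX, ← hX', act]
  | tmul a x =>
    induction Y with
    | zero => simp
    | add Y Y' hY hY' => simp only [map_add, LinearMap.add_apply, hY, hY']
    | tmul b y => rw [LinearMap.baseChange_tmul, act_tmul]; simp [extMul, right, mul_comm a b]

variable [FiniteDimensional F S]

theorem extForm_extMul (X Y : A ⊗[F] S) : extForm A n (c.extMul A X Y) =
    algebraMap F A c.multiplier * extForm A n X * extForm A n Y := by
  have h1 (x : S) (Y : A ⊗[F] S) : extForm A n (c.extMul A (1 ⊗ₜ x) Y) =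
      algebraMap F A (c.multiplier * n x) * extForm A n Y := by
    suffices h : (extForm A n).comp (c.extMul A (1 ⊗ₜ x)) =
        algebraMap F A (c.multiplier * n x) • extForm A n from congrArg (fun Q => Q Y) h
    refine _root_.baseChange_ext fun y => ?_
    rw [QuadraticMap.comp_apply, smul_apply, smul_eq_mul]
    simp only [extMul, LinearMap.BilinMap.baseChange_tmul, extForm_tmul, c.norm_mul, map_mul]
    ring
  suffices h : (extForm A n).comp ((c.extMul A).flip Y) =
      (algebraMap F A c.multiplier * extForm A n Y) • extForm A n by
    refine (congrArg (fun Q => Q X) h).trans ?_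
    rw [smul_apply, smul_eq_mul]
    ring
  refine _root_.baseChange_ext fun x => ?_
  rw [QuadraticMap.comp_apply, smul_apply, smul_eq_mul, LinearMap.flip_apply, h1,
    extForm_tmul, map_mul]
  ring

theorem polar_extMul (X Y Z : A ⊗[F] S) :
    QuadraticMap.polar (extForm A n) (c.extMul A X Y) Z =
      QuadraticMap.polar (extForm A n) X (c.extMul A Y Z) := by
  induction X with
  | zero => simp
  | add X X' hX hX' =>
    rw [map_add, LinearMap.add_apply, QuadraticMap.polar_add_left, QuadraticMap.polar_add_left, hX,
      hX']
  | tmul a x =>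
    induction Y with
    | zero => simp
    | add Y Y' hY hY' =>
      rw [map_add, map_add, LinearMap.add_apply, QuadraticMap.polar_add_left,
        QuadraticMap.polar_add_right, hY, hY']
    | tmul b y =>
      induction Z with
      | zero => simp
      | add Z Z' hZ hZ' =>
        rw [map_add, QuadraticMap.polar_add_right, QuadraticMap.polar_add_right, hZ, hZ']
      | tmul d z =>
        simp only [extMul, LinearMap.BilinMap.baseChange_tmul, polar_extForm_tmul, c.polar_mul]
        ring

theorem isAdjoint_right (X : A ⊗[F] S) :
    IsAdjoint n A (c.right.baseChange A X) (c.left.baseChange A X) := fun Y Z => by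
  rw [act_left, act_right, polar_extMul]

theorem isAdjoint_left (X : A ⊗[F] S) :
    IsAdjoint n A (c.left.baseChange A X) (c.right.baseChange A X) := fun Y Z => by
  rw [act_left, act_right, QuadraticMap.polar_comm, ← polar_extMul, QuadraticMap.polar_comm]

end SymmetricComposition

/-! ### Homotheties and the kernel of f ↦ Int[f] -/

section Homothety

variable {F : Type u} [Field F] {S : Type v} [AddCommGroup S] [Module F S]
  {A : Type u} [CommRing A] [Algebra F A]

/-- The homothety of ratio `a`. -/
def homothety (S : Type v) [AddCommGroup S] [Module F S] (a : Aˣ) : (A ⊗[F] Module.End F S)ˣ :=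
  Units.map (algebraMap A (A ⊗[F] Module.End F S)).toMonoidHom a

theorem act_homothety_mul (a : Aˣ) (f : (A ⊗[F] Module.End F S)ˣ) (X : A ⊗[F] S) :
    act (homothety S a * f).1 X = a.1 • act f.1 X := by
  rw [Units.val_mul, act_mul]
  exact act_algebraMap _ _

theorem innerAut_homothety_mul (a : Aˣ) (f : (A ⊗[F] Module.End F S)ˣ) :
    innerAut A _ (homothety S a * f) = innerAut A _ f := by
  rw [map_mul]
  have : innerAut A (A ⊗[F] Module.End F S) (homothety S a) = 1 := by
    refine AlgEquiv.ext fun x => ?_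
    change (homothety S a).1 * x * (homothety S a)⁻¹.1 = x
    rw [Units.mul_inv_eq_iff_eq_mul]
    exact Algebra.commutes a.1 x
  rw [this, one_mul]

theorem algebraMap_end_injective [FiniteDimensional F S] [Nontrivial S] :
    Function.Injective (algebraMap A (A ⊗[F] Module.End F S)) := by
  intro a b h
  let o : Fin (Module.finrank F S) := ⟨0, Module.finrank_pos⟩
  have h1 := congrArg (fun x => matEquiv (Module.finBasis F S) A x o o) h
  simpa only [AlgEquiv.commutes, Matrix.algebraMap_matrix_apply, if_true, Algebra.algebraMap_self,
    RingHom.id_apply] using h1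

theorem innerAut_eq_iff [FiniteDimensional F S] [Nontrivial S] (g g' : (A ⊗[F] Module.End F S)ˣ) :
    innerAut A _ g = innerAut A _ g' ↔ ∃ a : Aˣ, g = homothety S a * g' := by
  constructor
  · intro h
    have hcomm (k : (A ⊗[F] Module.End F S)ˣ) (hk : innerAut A (A ⊗[F] Module.End F S) k = 1) :
        ∃ a, k.1 = algebraMap A _ a := by
      refine exists_algebraMap_eq_of_commute _ fun y => ?_
      have h1 : k.1 * y * (k⁻¹ : (A ⊗[F] Module.End F S)ˣ).1 = y := DFunLike.congr_fun hk y
      rwa [Units.mul_inv_eq_iff_eq_mul] at h1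
    have h1 : innerAut A (A ⊗[F] Module.End F S) (g * g'⁻¹) = 1 := by
      rw [map_mul, map_inv, h, mul_inv_cancel]
    obtain ⟨a, ha⟩ := hcomm _ h1
    -- The inverse is central too, and its scalar is the inverse of a.
    obtain ⟨b, hb⟩ := hcomm (g * g'⁻¹)⁻¹ (by rw [map_inv, h1, inv_one])
    have hab : a * b = 1 := by
      refine algebraMap_end_injective (F := F) (S := S) ?_
      rw [map_mul, ← ha, ← hb, Units.mul_inv, map_one]
    refine ⟨Units.mkOfMulEqOne a b hab, ?_⟩
    have h2 : g * g'⁻¹ = homothety S (Units.mkOfMulEqOne a b hab) := Units.ext ha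
    rw [← h2, inv_mul_cancel_right]
  · rintro ⟨a, rfl⟩
    exact innerAut_homothety_mul a g'

end Homothety

theorem even_intertwine {R M B B' : Type*} [CommRing R] [AddCommGroup M] [Module R M] [Ring B]
    [Algebra R B] [Ring B'] [Algebra R B'] {Q : QuadraticForm R M}
    (φ : CliffordAlgebra.even Q →ₐ[R] B × B')
    (ψ : CliffordAlgebra.even Q →ₐ[R] CliffordAlgebra.even Q) (θ : B ≃ₐ[R] B) (θ' : B' ≃ₐ[R] B')
    (h : ∀ x y, φ (ψ ((CliffordAlgebra.even.ι Q).bilin x y)) =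
      (θ (φ ((CliffordAlgebra.even.ι Q).bilin x y)).1,
        θ' (φ ((CliffordAlgebra.even.ι Q).bilin x y)).2)) (z : CliffordAlgebra.even Q) :
    φ (ψ z) = (θ (φ z).1, θ' (φ z).2) := by
  have := CliffordAlgebra.even.algHom_ext Q (f := φ.comp ψ)
    (g := (AlgHom.prodMap θ.toAlgHom θ'.toAlgHom).comp φ)
    (CliffordAlgebra.EvenHom.ext (LinearMap.ext₂ h))
  exact DFunLike.congr_fun this z

theorem isSimilarity_homothety_mul {F : Type u} [Field F] {S : Type v} [AddCommGroup S]
    [Module F S] [FiniteDimensional F S] {n : QuadraticForm F S} {A : Type u}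
    [CommRing A] [Algebra F A] {f : (A ⊗[F] Module.End F S)ˣ} {μ : Aˣ}
    (hf : IsSimilarity n f.1 μ) (a : Aˣ) :
    IsSimilarity n (homothety S a * f).1 (a * a * μ) := fun X => by
  rw [act_homothety_mul, QuadraticMap.map_smul, hf, smul_eq_mul, Units.val_mul, Units.val_mul,
    mul_assoc (a.1 * a.1)]

/-- Compare values at a vector of S on which n does not vanish. The multiplier hidden in `DPlus` can
thus be identified with a given one. -/
theorem IsSimilarity.multiplier_unique {F : Type u} [Field F] {S : Type v} [AddCommGroup S]
    [Module F S] [FiniteDimensional F S] [Nontrivial S] {n : QuadraticForm F S} {A : Type u}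
    [CommRing A] [Algebra F A] (hn : n.polarBilin.SeparatingLeft)
    {f : A ⊗[F] Module.End F S} {μ μ' : Aˣ}
    (hf : IsSimilarity n f μ) (hf' : IsSimilarity n f μ') : μ = μ' := by
  obtain ⟨x, hx⟩ := exists_apply_ne_zero hn
  have h := (hf (1 ⊗ₜ x)).symm.trans (hf' (1 ⊗ₜ x))
  rw [extForm_tmul, mul_one, one_mul] at h
  exact Units.ext (((IsUnit.mk0 _ hx).map (algebraMap F A)).mul_right_cancel h)

/-! ### Related triples and the diagram D⁺ -/

namespace SymmetricComposition

variable {F : Type u} [Field F] {S : Type v} [AddCommGroup S] [Module F S] [FiniteDimensional F S]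
  {n : QuadraticForm F S} (c : SymmetricComposition n) {A : Type u} [CommRing A] [Algebra F A]

/-- The similarities `f`, `g`, `h` form a related triple. -/
structure IsRelated (f g h : (A ⊗[F] Module.End F S)ˣ) (μ ν : Aˣ) : Prop where
  left : IsSimilarity n f.1 μ
  mid : IsSimilarity n g.1 ν
  right : IsSimilarity n h.1 (μ * ν)
  left_mul_mid : ∀ X Y, c.extMul A (act f.1 X) (act g.1 Y) = act h.1 (c.extMul A X Y)
  right_mul_left : ∀ X Y, c.extMul A (act h.1 X) (act f.1 Y) = μ.1 • act g.1 (c.extMul A X Y)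
  mid_mul_right : ∀ X Y, c.extMul A (act g.1 X) (act h.1 Y) = ν.1 • act f.1 (c.extMul A X Y)

variable {c} in
-- In the first component, (f(y) ⋆ g(z)) ⋆ f(x) = h(y ⋆ z) ⋆ f(x) = μ g((y ⋆ z) ⋆ x); the second is
-- similar. It is enough to test the diagram on the generators xy of the even Clifford algebra.
theorem IsRelated.dPlus {f g h : (A ⊗[F] Module.End F S)ˣ} {μ ν : Aˣ}
    (H : c.IsRelated f g h μ ν) (hn : n.polarBilin.SeparatingLeft) : c.DPlus A hn f g h := by
  have h1 (X Y) : c.right.baseChange A (act f.1 X) * c.left.baseChange A (act f.1 Y) * g.1 =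
      μ.1 • (g.1 * (c.right.baseChange A X * c.left.baseChange A Y)) := by
    refine act_injective (LinearMap.ext fun Z => ?_)
    simp only [act_mul, act_smul, act_left, act_right, H.left_mul_mid, H.right_mul_left]
  have h2 (X Y) : c.left.baseChange A (act f.1 X) * c.right.baseChange A (act f.1 Y) * h.1 =
      μ.1 • (h.1 * (c.left.baseChange A X * c.right.baseChange A Y)) := by
    refine act_injective (LinearMap.ext fun Z => ?_)
    simp only [act_mul, act_smul, act_left, act_right, H.right_mul_left, map_smul, H.left_mul_mid]
  have h3 {p q : A ⊗[F] Module.End F S} {k : (A ⊗[F] Module.End F S)ˣ}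
      (e : p * k.1 = μ.1 • (k.1 * q)) : (μ⁻¹ : Aˣ).1 • p = innerAut A _ k q := by
    change _ = k.1 * q * (k⁻¹ : (A ⊗[F] Module.End F S)ˣ).1
    rw [Units.eq_mul_inv_iff_mul_eq, smul_mul_assoc, e, smul_smul, Units.inv_mul, one_smul]
  refine ⟨μ, H.left, even_intertwine _ _ (innerAut A _ g) (innerAut A _ h) fun X Y => ?_⟩
  rw [evenSimilarity_ι, map_smul, alphaEven_ι, alphaEven_ι, smul_comm, Prod.smul_mk, Prod.smul_mk,
    Prod.smul_mk, h3 (h1 X Y), h3 (h2 X Y), map_smul, map_smul]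

variable {c} in
-- This cyclic symmetry is the source of the order 3 of triality. Scaling f by ν absorbs the scalar
-- in the third identity, so that it takes the place of the first; the multiplier becomes ν²μ =
-- ν(μν).
theorem IsRelated.rotate {f g h : (A ⊗[F] Module.End F S)ˣ} {μ ν : Aˣ}
    (H : c.IsRelated f g h μ ν) : c.IsRelated g h (homothety S ν * f) ν (μ * ν) where
  left := H.mid
  mid := H.right
  right := by
    have := isSimilarity_homothety_mul H.left ν
    rwa [mul_assoc, mul_comm ν μ] at this
  left_mul_mid X Y := by rw [H.mid_mul_right, act_homothety_mul]
  right_mul_left X Y := by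
    rw [act_homothety_mul, map_smul, LinearMap.smul_apply, H.left_mul_mid]
  mid_mul_right X Y := by
    rw [act_homothety_mul, map_smul, H.right_mul_left, smul_smul, Units.val_mul, mul_comm μ.1]

variable {c} in
-- The first component of the diagram, written with operators. It is all that is needed to rebuild a
-- related triple from f and g.
theorem DPlus.right_mul_left_mul {hn : n.polarBilin.SeparatingLeft} [Nontrivial S]
    {f g h : (A ⊗[F] Module.End F S)ˣ} (H : c.DPlus A hn f g h) {μ : Aˣ}
    (hf : IsSimilarity n f.1 μ) (X Y : A ⊗[F] S) :
    c.right.baseChange A (act f.1 X) * c.left.baseChange A (act f.1 Y) * g.1 =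
      μ.1 • (g.1 * (c.right.baseChange A X * c.left.baseChange A Y)) := by
  obtain ⟨μ', hf', H⟩ := H
  obtain rfl := hf.multiplier_unique hn hf'
  have h1 := congrArg Prod.fst (H ((CliffordAlgebra.even.ι _).bilin X Y))
  have h2 {P Q : A ⊗[F] Module.End F S} {s : A}
      (hs : algebraMap F A c.multiplier.1 * s = 1)
      (h : μ⁻¹.1 • s • P = innerAut A _ g (s • Q)) : P * g.1 = μ.1 • (g.1 * Q) := by
    rw [map_smul, smul_comm] at h
    have h' : algebraMap F A c.multiplier.1 • s • μ⁻¹.1 • P =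
        algebraMap F A c.multiplier.1 • s • innerAut A _ g Q := congrArg _ h
    rw [smul_smul, smul_smul _ s (innerAut A _ g Q), hs, one_smul, one_smul] at h'
    have h'' : μ⁻¹.1 • P = g.1 * Q * (g⁻¹ : (A ⊗[F] Module.End F S)ˣ).1 := h'
    rw [Units.eq_mul_inv_iff_mul_eq, smul_mul_assoc] at h''
    rw [← h'', smul_smul, Units.mul_inv, one_smul]
  rw [evenSimilarity_ι, map_smul, alphaEven_ι, alphaEven_ι] at h1
  exact h2 (by rw [← map_mul, Units.mul_inv, map_one]) h1

end SymmetricComposition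

theorem isUnit_of_mul_eq_algebraMap {A R : Type*} [CommRing A] [Ring R] [Algebra A R] {X Y : R}
    {s : A} (hs : IsUnit s) (hXY : X * Y = algebraMap A R s) (hYX : Y * X = algebraMap A R s) :
    IsUnit X := by
  obtain ⟨t, rfl⟩ := hs
  have h : algebraMap A R t⁻¹.1 * algebraMap A R t.1 = 1 := by
    rw [← map_mul, Units.inv_mul, map_one]
  exact ⟨⟨X, algebraMap A R t⁻¹.1 * Y, by rw [← mul_assoc, ← Algebra.commutes, mul_assoc, hXY, h],
    by rw [mul_assoc, hYX, h]⟩, rfl⟩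

theorem mul_left_cancel_of_isUnit {A R : Type*} [CommRing A] [Ring R] [Algebra A R] {P Q X Y : R}
    {s : A} (hs : IsUnit s) (hXY : Y * X = algebraMap A R s) (h : X * P = X * Q) : P = Q := by
  have h1 : algebraMap A R s * P = algebraMap A R s * Q := by
    rw [← hXY, mul_assoc, h, mul_assoc]
  exact (hs.map (algebraMap A R)).mul_left_cancel h1

namespace SymmetricComposition

variable {F : Type u} [Field F] {S : Type v} [AddCommGroup S] [Module F S] [FiniteDimensional F S]
  {n : QuadraticForm F S} (c : SymmetricComposition n)
  {A : Type u} [CommRing A] [Algebra F A]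

/-- If `g` intertwines the operators `r_x ℓ_y` and `r_{f(x)} ℓ_{f(y)}` up to a scalar, then
conjugation by `g` preserves adjoints. -/
theorem isAdjoint_conj (hn : n.polarBilin.SeparatingLeft) (hdim : Module.finrank F S = 8)
    {f g : (A ⊗[F] Module.End F S)ˣ} {μ : Aˣ}
    (H : ∀ X Y, c.right.baseChange A (act f.1 X) * c.left.baseChange A (act f.1 Y) * g.1 =
      μ.1 • (g.1 * (c.right.baseChange A X * c.left.baseChange A Y)))
    (a a' : A ⊗[F] Module.End F S) (ha : IsAdjoint n A a a') :
    IsAdjoint n A (g * a * (g⁻¹ : (A ⊗[F] Module.End F S)ˣ).1)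
      (g * a' * (g⁻¹ : (A ⊗[F] Module.End F S)ˣ).1) := by
  let γ := innerAut A (A ⊗[F] Module.End F S) g
  -- The operators having an adjoint that γ respects form a subalgebra. It contains every r_x ℓ_y,
  -- whose adjoint is r_y ℓ_x, and these generate because α₀ is onto.
  let T : Subalgebra A (A ⊗[F] Module.End F S) :=
    { carrier := {a | ∃ a', IsAdjoint n A a a' ∧ IsAdjoint n A (γ a) (γ a')}
      mul_mem' := by
        rintro a b ⟨a', h1, h2⟩ ⟨b', h3, h4⟩
        refine ⟨b' * a', h1.mul h3, ?_⟩
        rw [map_mul, map_mul]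
        exact h2.mul h4
      add_mem' := by
        rintro a b ⟨a', h1, h2⟩ ⟨b', h3, h4⟩
        refine ⟨a' + b', h1.add h3, ?_⟩
        rw [map_add, map_add]
        exact h2.add h4
      algebraMap_mem' := fun t => by
        refine ⟨algebraMap A _ t, ?_, ?_⟩
        · rw [Algebra.algebraMap_eq_smul_one]
          exact (IsAdjoint.one n A).smul t
        · rw [AlgEquiv.commutes, Algebra.algebraMap_eq_smul_one]
          exact (IsAdjoint.one n A).smul t }
  have hγ (X Y) : γ (c.right.baseChange A X * c.left.baseChange A Y) =
      (μ⁻¹ : Aˣ).1 • (c.right.baseChange A (act f.1 X) * c.left.baseChange A (act f.1 Y)) := by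
    change g.1 * _ * (g⁻¹ : (A ⊗[F] Module.End F S)ˣ).1 = _
    rw [Units.mul_inv_eq_iff_eq_mul, smul_mul_assoc, H, smul_smul, Units.inv_mul, one_smul]
  have hT (X Y) : c.right.baseChange A X * c.left.baseChange A Y ∈ T := by
    refine ⟨c.right.baseChange A Y * c.left.baseChange A X,
      (c.isAdjoint_right X).mul (c.isAdjoint_left Y), ?_⟩
    rw [hγ, hγ]
    exact ((c.isAdjoint_right _).mul (c.isAdjoint_left _)).smul _
  have htop : T.comap ((AlgHom.fst A _ _).comp (c.alphaEven A hn)) = ⊤ := by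
    refine subalgebra_even_eq_top _ _ fun X Y => ?_
    rw [Subalgebra.mem_comap, AlgHom.comp_apply, alphaEven_ι]
    exact T.smul_mem (hT X Y) _
  obtain ⟨z, hz⟩ := c.alphaEven_surjective hn A hdim (a, 0)
  have hz' : z ∈ T.comap ((AlgHom.fst A _ _).comp (c.alphaEven A hn)) := by
    rw [htop]
    trivial
  rw [Subalgebra.mem_comap, AlgHom.comp_apply, hz] at hz'
  obtain ⟨b', h1, h2⟩ := hz'
  obtain rfl := h1.unique hn ha
  exact h2

theorem exists_isRelated (hn : n.polarBilin.SeparatingLeft) (hdim : Module.finrank F S = 8)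
    {f g : (A ⊗[F] Module.End F S)ˣ} {μ : Aˣ}
    (hf : IsSimilarity n f.1 μ)
    (H : ∀ X Y, c.right.baseChange A (act f.1 X) * c.left.baseChange A (act f.1 Y) * g.1 =
      μ.1 • (g.1 * (c.right.baseChange A X * c.left.baseChange A Y))) :
    ∃ h ν, c.IsRelated f g h μ ν := by
  have : Nontrivial S := Module.nontrivial_of_finrank_pos (R := F) (by omega)
  obtain ⟨ν, hν⟩ := exists_polar_act_eq hn g (c.isAdjoint_conj hn hdim H)
  obtain ⟨x, hx⟩ := exists_apply_ne_zero hn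
  obtain ⟨p, q, hpq⟩ := exists_polar_eq_one hn
  let l := c.left.baseChange A
  let r := c.right.baseChange A
  let X₀ : A ⊗[F] S := 1 ⊗ₜ x
  have hlr (X) : l X * r X = algebraMap A _ (algebraMap F A c.multiplier * extForm A n X) :=
    baseChange_mul_baseChange n c.left c.right _ (c.left_mul_right hn) X
  have hrl (X) : r X * l X = algebraMap A _ (algebraMap F A c.multiplier * extForm A n X) :=
    baseChange_mul_baseChange n c.right c.left _ (c.right_mul_left hn) X
  have hm : IsUnit (algebraMap F A c.multiplier.1) := c.multiplier.isUnit.map (algebraMap F A)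
  have hX₀ : IsUnit (extForm A n X₀) := by
    rw [extForm_tmul, mul_one, one_mul]
    exact (IsUnit.mk0 _ hx).map (algebraMap F A)
  have hfX₀ : IsUnit (extForm A n (act f.1 X₀)) := by
    rw [hf]
    exact μ.isUnit.mul hX₀
  obtain ⟨L₀, hL₀⟩ := isUnit_of_mul_eq_algebraMap (hm.mul hX₀) (hlr X₀) (hrl X₀)
  obtain ⟨L₁, hL₁⟩ := isUnit_of_mul_eq_algebraMap (hm.mul hfX₀) (hlr _) (hrl (act f.1 X₀))
  -- The identity f(x) ⋆ g(y) = h(x ⋆ y) at a single x₀ with n(x₀) ≠ 0 forces this choice, ℓ_{x₀}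
  -- being invertible.
  let h := L₁ * g * L₀⁻¹
  have hL : h.1 * l X₀ = l (act f.1 X₀) * g.1 := by
    rw [← hL₀, ← hL₁]
    change (L₁.1 * g.1 * (L₀⁻¹ : (A ⊗[F] Module.End F S)ˣ).1) * L₀.1 = _
    rw [mul_assoc, Units.inv_mul, mul_one]
  -- The hypothesis `H` at Y = x₀, with ℓ_{x₀} cancelled on the right. The first identity for
  -- general X then follows from `H` with x₀ in the first place, by cancelling r_{f(x₀)} on the
  -- left.
  have hb (X) : r (act f.1 X) * h.1 = μ.1 • (g.1 * r X) := by
    have h1 : r (act f.1 X) * h.1 * L₀.1 = μ.1 • (g.1 * r X) * L₀.1 := by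
      rw [hL₀, mul_assoc, hL, ← mul_assoc, H, smul_mul_assoc, mul_assoc]
    exact L₀.isUnit.mul_right_cancel h1
  have ha (X) : h.1 * l X = l (act f.1 X) * g.1 := by
    refine mul_left_cancel_of_isUnit (hm.mul hfX₀) (hlr (act f.1 X₀)) ?_
    rw [← mul_assoc, hb, ← mul_assoc, H, smul_mul_assoc, mul_assoc]
  have hfg (X Y) : c.extMul A (act f.1 X) (act g.1 Y) = act h.1 (c.extMul A X Y) := by
    rw [← act_left, ← act_left, ← act_mul, ← act_mul]
    exact congrArg (act · Y) (ha X).symm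
  have hhf (X Y) : c.extMul A (act h.1 X) (act f.1 Y) = μ.1 • act g.1 (c.extMul A X Y) := by
    rw [← act_right, ← act_right, ← act_mul, ← act_mul, ← act_smul]
    exact congrArg (act · X) (hb Y)
  have hsurj (Z) : ∃ Y, c.extMul A X₀ Y = Z := by
    refine ⟨act (L₀⁻¹ : (A ⊗[F] Module.End F S)ˣ).1 Z, ?_⟩
    rw [← act_left]
    change act (l X₀) _ = Z
    rw [← hL₀]
    exact act_unit_inv L₀ Z
  have hpol (X Y Z) : QuadraticMap.polar (extForm A n) (c.extMul A X Y) (c.extMul A X Z) =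
      algebraMap F A c.multiplier * extForm A n X * QuadraticMap.polar (extForm A n) Y Z := by
    simp only [QuadraticMap.polar, ← map_add, c.extForm_extMul]
    ring
  have hpol' (X Y Z) : QuadraticMap.polar (extForm A n) (c.extMul A Y X) (c.extMul A Z X) =
      algebraMap F A c.multiplier * extForm A n X * QuadraticMap.polar (extForm A n) Y Z := by
    simp only [QuadraticMap.polar, ← LinearMap.add_apply, ← map_add, c.extForm_extMul]
    ring
  have hhpol (Z W) : QuadraticMap.polar (extForm A n) (act h.1 Z) (act h.1 W) =
      (μ * ν : Aˣ).1 * QuadraticMap.polar (extForm A n) Z W := by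
    obtain ⟨Y, rfl⟩ := hsurj Z
    obtain ⟨Y', rfl⟩ := hsurj W
    rw [← hfg, ← hfg, hpol, hpol, hν, hf, Units.val_mul]
    ring
  -- In characteristic 2 the polar form does not determine n. The value n(g(Y)) is recovered from
  -- b(p ⋆ Y, q ⋆ Y) = λ n(Y) b(p, q) with b(p, q) = 1, using that h is a similarity for the polar
  -- form.
  have hg : IsSimilarity n g.1 ν := fun Y => by
    have h1 : QuadraticMap.polar (extForm A n) (1 ⊗ₜ p) (1 ⊗ₜ q) = 1 := by
      rw [polar_extForm_tmul, hpq, map_one, mul_one, mul_one]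
    have h2 := hhpol (c.extMul A (1 ⊗ₜ p) Y) (c.extMul A (1 ⊗ₜ q) Y)
    rw [← hfg, ← hfg, hpol', hpol', hf.polar, h1, Units.val_mul] at h2
    refine (hm.mul μ.isUnit).mul_left_cancel ?_
    linear_combination h2
  refine ⟨h, ν, hf, hg, fun Z => ?_, hfg, hhf, fun X Y => ?_⟩
  · obtain ⟨Y, rfl⟩ := hsurj Z
    rw [← hfg, c.extForm_extMul, c.extForm_extMul, hf, hg, Units.val_mul]
    ring
  -- The third identity is obtained by pairing with Z = f(W): b(f(W), g(X) ⋆ h(Y)) = b(h(W ⋆ X),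
  -- h(Y)) = μν b(W, X ⋆ Y) = ν b(f(W), f(X ⋆ Y)).
  · refine eq_of_polar_extForm hn fun Z => ?_
    rw [QuadraticMap.polar_comm, QuadraticMap.polar_smul_left, smul_eq_mul]
    have h1 := act_unit_inv f Z
    set W := act (f⁻¹ : (A ⊗[F] Module.End F S)ˣ).1 Z
    rw [← h1, ← polar_extMul, hfg, hhpol, polar_extMul, hf.polar, Units.val_mul,
      QuadraticMap.polar_comm _ W]
    ring

end SymmetricComposition

/-! ### From proper similarities to related triples, locally -/

theorem exists_map_fst {A R R₁ R₂ : Type*} [CommRing A] [Ring R] [Algebra A R] [Ring R₁]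
    [Algebra A R₁] [Ring R₂] [Algebra A R₂] (α : R →ₐ[A] R₁ × R₂) (hα : Function.Bijective α)
    (C : R →ₐ[A] R) (e : R) (he : α e = (1, 0)) (hCe : C e = e) :
    ∃ θ : R₁ →ₐ[A] R₁, ∀ z, (α (C z)).1 = θ (α z).1 := by
  let α' := AlgEquiv.ofBijective α hα
  have hα' (p) : α (α'.symm p) = p := α'.apply_symm_apply p
  have he' : α'.symm (1, 0) = e := α'.injective ((α'.apply_symm_apply _).trans he.symm)
  -- Since C fixes e, replacing z by ze does not change the first component of α(C z), while ze
  -- depends only on the first component of α(z).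
  have key (z) : (α (C z)).1 = (α (C (α'.symm ((α z).1, 0)))).1 := by
    have h1 : α'.symm ((α z).1, 0) = z * e := by
      apply hα.1
      rw [hα', map_mul, he]
      exact Prod.ext (mul_one _).symm (mul_zero _).symm
    rw [h1, map_mul, hCe, map_mul, he]
    exact (mul_one _).symm
  let θ : R₁ →ₐ[A] R₁ := AlgHom.ofLinearMap
    ((LinearMap.fst A R₁ R₂).comp (α.toLinearMap.comp (C.toLinearMap.comp
      (α'.symm.toLinearMap.comp (LinearMap.inl A R₁ R₂)))))
    (by
      change (α (C (α'.symm (1, 0)))).1 = 1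
      rw [he', hCe, he])
    (fun a b => by
      change (α (C (α'.symm (a * b, 0)))).1 = (α (C (α'.symm (a, 0)))).1 * (α (C (α'.symm (b, 0)))).1
      have : ((a * b, 0) : R₁ × R₂) = (a, 0) * (b, 0) := Prod.ext rfl (mul_zero _).symm
      rw [this, map_mul, map_mul, map_mul, Prod.fst_mul])
  exact ⟨θ, key⟩

section Ext

variable {F : Type u} [Field F] {S : Type v} [AddCommGroup S] [Module F S]
  {A B : Type u} [CommRing A] [Algebra F A] [CommRing B] [Algebra F B]

theorem extVec_one_tmul (φ : A →ₐ[F] B) (x : S) :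
    extVec φ ((1 : A) ⊗ₜ[F] x) = 1 ⊗ₜ x := by simp [extVec]

theorem extAlg_smul {E : Type v} [Ring E] [Algebra F E] (φ : A →ₐ[F] B) (a : A) (x : A ⊗[F] E) :
    extAlg E φ (a • x) = φ a • extAlg E φ x := by
  induction x with
  | zero => simp
  | add x y hx hy => rw [smul_add, map_add, map_add, smul_add, hx, hy]
  | tmul b x => simp [extAlg, smul_tmul']

theorem extAlg_baseChange {E : Type v} [Ring E] [Algebra F E] (p : S →ₗ[F] E) (φ : A →ₐ[F] B)
    (X : A ⊗[F] S) : extAlg E φ (p.baseChange A X) = p.baseChange B (extVec φ X) := by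
  induction X with
  | zero => simp
  | add X Y hX hY => simp only [map_add, hX, hY]
  | tmul a x => simp [extAlg, extVec]

end Ext

section Center

variable {F : Type u} [Field F] {S : Type v} [AddCommGroup S] [Module F S] [FiniteDimensional F S]
  {n : QuadraticForm F S} {A : Type u} [CommRing A] [Algebra F A]

theorem evenExt_commute {z : CliffordAlgebra.even n}
    (hz : z ∈ Subalgebra.center F (CliffordAlgebra.even n))
    (w : CliffordAlgebra.even (extForm A n)) : evenExt n A z * w = w * evenExt n A z := by
  obtain ⟨y, rfl⟩ := evenBaseChange_surjective n A w
  induction y with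
  | zero => rw [map_zero, mul_zero, zero_mul]
  | add x y hx hy => rw [map_add, mul_add, add_mul, hx, hy]
  | tmul a y =>
    rw [evenBaseChange_tmul, mul_smul_comm, smul_mul_assoc, ← map_mul, ← map_mul,
      Subalgebra.mem_center_iff.mp hz y]

end Center

namespace SymmetricComposition

variable {F : Type u} [Field F] {S : Type v} [AddCommGroup S] [Module F S] [FiniteDimensional F S]
  {n : QuadraticForm F S} (c : SymmetricComposition n)

section

variable (hn : n.polarBilin.SeparatingLeft) {A : Type u} [CommRing A] [Algebra F A]

variable (A) in
-- The idempotent (1, 0) already comes from the center of C₀(S, n) over F, which is where properness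
-- is tested.
theorem exists_alphaEven_eq_one_zero (hdim : Module.finrank F S = 8) :
    ∃ z ∈ Subalgebra.center F (CliffordAlgebra.even n), c.alphaEven A hn (evenExt n A z) = (1, 0) := by
  obtain ⟨z, hz⟩ := (c.alphaZero_bijective hn hdim).2 (1, 0)
  refine ⟨z, Subalgebra.mem_center_iff.mpr fun y => (c.alphaZero_bijective hn hdim).1 ?_, ?_⟩
  · rw [map_mul, map_mul, hz]
    ext1 <;> simp
  · rw [alphaEven_evenExt, hz, tmul_zero]
    rfl

variable {c hn}

/-- Central elements of C₀(S, n) go to central elements of End × End, and these are fixed by Int[g]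
× Int[h]. -/
theorem DPlus.isProperSimilarity (hdim : Module.finrank F S = 8)
    {f g h : (A ⊗[F] Module.End F S)ˣ} (H : c.DPlus A hn f g h) : IsProperSimilarity n f.1 := by
  obtain ⟨μ, hf, H⟩ := H
  refine ⟨μ, hf, fun z hz => c.alphaEven_injective hn A hdim ?_⟩
  rw [H]
  have hcomm (p) : c.alphaEven A hn (evenExt n A z) * p = p * c.alphaEven A hn (evenExt n A z) := by
    obtain ⟨w, rfl⟩ := c.alphaEven_surjective hn A hdim p
    rw [← map_mul, ← map_mul, evenExt_commute hz]
  set p := c.alphaEven A hn (evenExt n A z)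
  refine Prod.ext ?_ ?_
  · change g.1 * p.1 * (g⁻¹ : (A ⊗[F] Module.End F S)ˣ).1 = p.1
    rw [Units.mul_inv_eq_iff_eq_mul]
    exact (congrArg Prod.fst (hcomm (g.1, 0))).symm
  · change h.1 * p.2 * (h⁻¹ : (A ⊗[F] Module.End F S)ˣ).1 = p.2
    rw [Units.mul_inv_eq_iff_eq_mul]
    exact (congrArg Prod.snd (hcomm (0, h.1))).symm

variable (c) in
-- The products r_x ℓ_y generate the algebra, because α₀ is onto.
theorem ext_of_right_mul_left (hn : n.polarBilin.SeparatingLeft) (hdim : Module.finrank F S = 8)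
    {θ θ' : A ⊗[F] Module.End F S ≃ₐ[A] A ⊗[F] Module.End F S}
    (h : ∀ X Y, θ (c.right.baseChange A X * c.left.baseChange A Y) =
      θ' (c.right.baseChange A X * c.left.baseChange A Y)) : θ = θ' := by
  let T := AlgHom.equalizer θ.toAlgHom θ'.toAlgHom
  have htop : T.comap ((AlgHom.fst A _ _).comp (c.alphaEven A hn)) = ⊤ := by
    refine subalgebra_even_eq_top _ _ fun X Y => ?_
    rw [Subalgebra.mem_comap, AlgHom.comp_apply, alphaEven_ι]
    exact T.smul_mem (h X Y) _
  refine AlgEquiv.ext fun y => ?_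
  obtain ⟨z, hz⟩ := c.alphaEven_surjective hn A hdim (y, 0)
  have hz' : z ∈ T.comap ((AlgHom.fst A _ _).comp (c.alphaEven A hn)) := by
    rw [htop]
    trivial
  rw [Subalgebra.mem_comap, AlgHom.comp_apply, hz] at hz'
  exact hz'

/-- Replacing f by af multiplies both r_{f(x)} ℓ_{f(y)} and the multiplier by a², so the prescribed
values of Int[g] on the generators do not change. -/
theorem DPlus.innerAut_eq (hdim : Module.finrank F S = 8) {f g h f' g' h' : (A ⊗[F] Module.End F S)ˣ}
    (H : c.DPlus A hn f g h) (H' : c.DPlus A hn f' g' h')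
    (hff' : innerAut A _ f = innerAut A _ f') : innerAut A _ g = innerAut A _ g' := by
  have : Nontrivial S := Module.nontrivial_of_finrank_pos (R := F) (by omega)
  obtain ⟨a, rfl⟩ := (innerAut_eq_iff _ _).mp hff'
  obtain ⟨μ, hf', -⟩ := id H'
  have h1 := H.right_mul_left_mul (isSimilarity_homothety_mul hf' a)
  have h2 := H'.right_mul_left_mul hf'
  have key {k : (A ⊗[F] Module.End F S)ˣ} {P Q : A ⊗[F] Module.End F S}
      (e : P * k.1 = μ.1 • (k.1 * Q)) : innerAut A _ k Q = μ⁻¹.1 • P := by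
    change k.1 * Q * (k⁻¹ : (A ⊗[F] Module.End F S)ˣ).1 = _
    rw [Units.mul_inv_eq_iff_eq_mul, smul_mul_assoc, e, smul_smul, Units.inv_mul, one_smul]
  refine c.ext_of_right_mul_left hn hdim fun X Y => ?_
  rw [key (h2 X Y)]
  refine key ?_
  have h3 := h1 X Y
  rw [act_homothety_mul, act_homothety_mul, map_smul, map_smul, smul_mul_smul_comm,
    Units.val_mul (a * a), mul_smul a.1, smul_mul_assoc, smul_mul_assoc] at h3
  have h4 : (a * a).1 • (c.right.baseChange A (act f'.1 X) *
      c.left.baseChange A (act f'.1 Y) * g.1) =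
        (a * a).1 • μ.1 • (g.1 * (c.right.baseChange A X * c.left.baseChange A Y)) := by
    rw [Units.val_mul, mul_smul a.1, h3, mul_smul, Units.val_mul, mul_smul]
  exact (a * a).isUnit.smul_left_cancel.mp h4

end

theorem exists_algHom_right_mul_left (hn : n.polarBilin.SeparatingLeft)
    (hdim : Module.finrank F S = 8) {A : Type u} [CommRing A] [Algebra F A]
    {f : A ⊗[F] Module.End F S} {μ : Aˣ} (hf : IsSimilarity n f μ)
    (hfz : ∀ z ∈ Subalgebra.center F (CliffordAlgebra.even n),
      evenSimilarity (extForm A n) (act f) μ hf (evenExt n A z) = evenExt n A z) :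
    ∃ θ : A ⊗[F] Module.End F S →ₐ[A] A ⊗[F] Module.End F S, ∀ X Y : A ⊗[F] S,
      c.right.baseChange A (act f X) * c.left.baseChange A (act f Y) =
        μ.1 • θ (c.right.baseChange A X * c.left.baseChange A Y) := by
  obtain ⟨z, hz, hz'⟩ := c.exists_alphaEven_eq_one_zero hn A hdim
  obtain ⟨θ, hθ⟩ := exists_map_fst (c.alphaEven A hn)
    ⟨c.alphaEven_injective hn A hdim, c.alphaEven_surjective hn A hdim⟩
    (evenSimilarity (extForm A n) (act f) μ hf) _ hz' (hfz z hz)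
  refine ⟨θ, fun X Y => ?_⟩
  have h1 := hθ ((CliffordAlgebra.even.ι _).bilin X Y)
  rw [evenSimilarity_ι, map_smul, alphaEven_ι, alphaEven_ι, Prod.smul_fst, Prod.smul_fst,
    Prod.smul_fst, map_smul] at h1
  have h2 := congrArg (fun p => μ.1 • algebraMap F A c.multiplier.1 • p) h1
  have hmul : algebraMap F A c.multiplier * algebraMap F A (c.multiplier⁻¹ : Fˣ) = 1 := by
    rw [← map_mul, Units.mul_inv, map_one]
  simp only [smul_smul] at h2
  have e1 : μ.1 * (algebraMap F A c.multiplier * (μ⁻¹.1 * algebraMap F A (c.multiplier⁻¹ : Fˣ))) =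
      1 := by
    linear_combination (algebraMap F A c.multiplier * algebraMap F A (c.multiplier⁻¹ : Fˣ)) *
      μ.mul_inv + hmul
  have e2 : μ.1 * (algebraMap F A c.multiplier * algebraMap F A (c.multiplier⁻¹ : Fˣ)) = μ.1 := by
    rw [hmul, mul_one]
  rw [e1, e2, one_smul] at h2
  exact h2

/-- The extension of A serves only to make the endomorphism induced by C₀(f) on the first factor
inner; the conjugating unit is g. -/
theorem exists_isRelated_ext (hn : n.polarBilin.SeparatingLeft)
    (hdim : Module.finrank F S = 8) {A : CommAlgCat.{u} F}
    (f : (A ⊗[F] Module.End F S)ˣ) (hf : IsProperSimilarity n f.1) :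
    ∃ (B : CommAlgCat.{u} F) (φ : A ⟶ B), φ.hom.toRingHom.FaithfullyFlat ∧
      ∃ (g h : (B ⊗[F] Module.End F S)ˣ) (μ ν : Bˣ),
        c.IsRelated ((GLFunctor F S).map φ f) g h μ ν := by
  have : Nontrivial S := Module.nontrivial_of_finrank_pos (R := F) (by omega)
  obtain ⟨μ, hf, hfz⟩ := hf
  obtain ⟨θ, hθ'⟩ := c.exists_algHom_right_mul_left hn hdim hf hfz
  obtain ⟨B, φ, g, hφ, hg⟩ := exists_extEnd_eq_conj A θ
  let f' : (B ⊗[F] Module.End F S)ˣ := (GLFunctor F S).map φ f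
  have hf' : f'.1 = extAlg _ φ.hom f.1 := rfl
  have hfB : IsSimilarity n f'.1 (Units.map (φ.hom : A →* B) μ) := hf.ext φ.hom
  have H1 (x y : S) : c.right.baseChange B (act f'.1 (1 ⊗ₜ x)) *
      c.left.baseChange B (act f'.1 (1 ⊗ₜ y)) * g.1 =
        φ.hom μ.1 • (g.1 * (c.right.baseChange B (1 ⊗ₜ x) * c.left.baseChange B (1 ⊗ₜ y))) := by
    have h1 := congrArg (extAlg _ φ.hom) (hθ' (1 ⊗ₜ x) (1 ⊗ₜ y))
    rw [map_mul, extAlg_baseChange, extAlg_baseChange, extAlg_smul, ← extEnd_extAlg, map_mul (extAlg _ φ.hom),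
      extAlg_baseChange, extAlg_baseChange, ← act_extAlg, ← act_extAlg, extVec_one_tmul,
      extVec_one_tmul] at h1
    rw [hf', h1, smul_mul_assoc, hg]
  have H2 (X Y : B ⊗[F] S) : c.right.baseChange B (act f'.1 X) *
      c.left.baseChange B (act f'.1 Y) * g.1 =
        φ.hom μ.1 • (g.1 * (c.right.baseChange B X * c.left.baseChange B Y)) := by
    have h3 (b : B) (x : S) : b ⊗ₜ[F] x = b • ((1 : B) ⊗ₜ[F] x) := by
      rw [smul_tmul', smul_eq_mul, mul_one]
    induction X with
    | zero => simp only [map_zero, zero_mul, mul_zero, smul_zero]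
    | add X X' hX hX' => simp only [map_add, add_mul, mul_add, smul_add, hX, hX']
    | tmul a x =>
      induction Y with
      | zero => simp only [map_zero, zero_mul, mul_zero, smul_zero]
      | add Y Y' hY hY' => simp only [map_add, add_mul, mul_add, smul_add, hY, hY']
      | tmul b y =>
        rw [h3 a x, h3 b y]
        simp only [map_smul, smul_mul_assoc, mul_smul_comm, H1, smul_smul]
        congr 1
        ring
  obtain ⟨h, ν, hh⟩ := c.exists_isRelated hn hdim hfB H2
  exact ⟨B, φ, hφ, g, h, _, ν, hh⟩

end SymmetricComposition

/-! ### Gluing a local relation into an automorphism -/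

section LocalRotation

variable {F : Type u} [Field F] {G : CommAlgCat.{u} F ⥤ GrpCat.{w}}

theorem map_map_apply (G : CommAlgCat.{u} F ⥤ GrpCat.{w}) {A B C : CommAlgCat.{u} F} (φ : A ⟶ B)
    (χ : B ⟶ C) (x : G.obj A) : G.map χ (G.map φ x) = G.map (φ ≫ χ) x := by
  rw [G.map_comp]
  rfl

/-- The sheaf property of a group functor for faithfully flat extensions. -/
structure IsFaithfullyFlatSheaf (G : CommAlgCat.{u} F ⥤ GrpCat.{w}) : Prop where
  injective : ∀ {A B : CommAlgCat.{u} F} (φ : A ⟶ B), φ.hom.toRingHom.FaithfullyFlat →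
    Function.Injective (G.map φ)
  exists_map_eq : ∀ {A B : CommAlgCat.{u} F} (φ : A ⟶ B), φ.hom.toRingHom.FaithfullyFlat →
    ∀ x : G.obj B, (∀ (C : CommAlgCat.{u} F) (p q : B ⟶ C), φ ≫ p = φ ≫ q →
      G.map p x = G.map q x) → ∃ y, G.map φ y = x

/-- A natural multiplicative relation on the group functor `G` that is, locally for the faithfully
flat topology, the graph of an automorphism of order `3` of the subgroup `P`. -/
structure IsLocalRotation (P : SubgroupFunctor G)
    (R : ∀ A : CommAlgCat.{u} F, G.obj A → G.obj A → Prop) : Prop where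
  map : ∀ {A B : CommAlgCat.{u} F} (φ : A ⟶ B) {θ η : G.obj A}, R A θ η →
    R B (G.map φ θ) (G.map φ η)
  mul : ∀ {A : CommAlgCat.{u} F} {θ η θ' η' : G.obj A}, R A θ η → R A θ' η' →
    R A (θ * θ') (η * η')
  unique : ∀ {A : CommAlgCat.{u} F} {θ η η' : G.obj A}, R A θ η → R A θ η' → η = η'
  rotate : ∀ {A : CommAlgCat.{u} F} {θ η : G.obj A}, R A θ η → ∃ ζ, R A η ζ ∧ R A ζ θ
  mem : ∀ {A : CommAlgCat.{u} F} {θ η : G.obj A}, R A θ η → θ ∈ P.sub A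
  mem_of_map_mem : ∀ {A B : CommAlgCat.{u} F} (φ : A ⟶ B), φ.hom.toRingHom.FaithfullyFlat →
    ∀ θ, G.map φ θ ∈ P.sub B → θ ∈ P.sub A
  exists_map : ∀ {A : CommAlgCat.{u} F}, ∀ θ ∈ P.sub A, ∃ (B : CommAlgCat.{u} F) (φ : A ⟶ B),
    φ.hom.toRingHom.FaithfullyFlat ∧ ∃ η, R B (G.map φ θ) η

/-- The relation `R` holds after a faithfully flat extension. -/
def LocallyRelated (R : ∀ A : CommAlgCat.{u} F, G.obj A → G.obj A → Prop) {A : CommAlgCat.{u} F}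
    (θ η : G.obj A) : Prop :=
  ∃ (B : CommAlgCat.{u} F) (φ : A ⟶ B), φ.hom.toRingHom.FaithfullyFlat ∧
    R B (G.map φ θ) (G.map φ η)

variable {P : SubgroupFunctor G} {R : ∀ A : CommAlgCat.{u} F, G.obj A → G.obj A → Prop}

namespace IsLocalRotation

theorem common_extension (hR : IsLocalRotation P R) {A : CommAlgCat.{u} F} {θ η θ' η' : G.obj A}
    (h : LocallyRelated R θ η) (h' : LocallyRelated R θ' η') :
    ∃ (B : CommAlgCat.{u} F) (φ : A ⟶ B), φ.hom.toRingHom.FaithfullyFlat ∧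
      R B (G.map φ θ) (G.map φ η) ∧ R B (G.map φ θ') (G.map φ η') := by
  obtain ⟨B, φ, hφ, h⟩ := h
  obtain ⟨C, χ, hχ, h'⟩ := h'
  obtain ⟨D, φ', χ', hφ', e⟩ := exists_pushout φ hφ χ
  refine ⟨D, χ ≫ φ', RingHom.FaithfullyFlat.stableUnderComposition _ _ hχ hφ', ?_, ?_⟩
  · have := hR.map χ' h
    rwa [map_map_apply, map_map_apply, ← e] at this
  · have := hR.map φ' h'
    rwa [map_map_apply, map_map_apply] at this

theorem locallyRelated_unique (hR : IsLocalRotation P R) (hG : IsFaithfullyFlatSheaf G)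
    {A : CommAlgCat.{u} F} {θ η η' : G.obj A} (h : LocallyRelated R θ η)
    (h' : LocallyRelated R θ η') : η = η' := by
  obtain ⟨B, φ, hφ, h1, h2⟩ := hR.common_extension h h'
  exact hG.injective φ hφ (hR.unique h1 h2)

theorem locallyRelated_mul (hR : IsLocalRotation P R)
    {A : CommAlgCat.{u} F} {θ η θ' η' : G.obj A} (h : LocallyRelated R θ η)
    (h' : LocallyRelated R θ' η') : LocallyRelated R (θ * θ') (η * η') := by
  obtain ⟨B, φ, hφ, h1, h2⟩ := hR.common_extension h h'
  refine ⟨B, φ, hφ, ?_⟩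
  rw [map_mul, map_mul]
  exact hR.mul h1 h2

theorem locallyRelated_map (hR : IsLocalRotation P R) {A B : CommAlgCat.{u} F} (χ : A ⟶ B)
    {θ η : G.obj A} (h : LocallyRelated R θ η) : LocallyRelated R (G.map χ θ) (G.map χ η) := by
  obtain ⟨C, φ, hφ, h⟩ := h
  obtain ⟨D, φ', χ', hφ', e⟩ := exists_pushout φ hφ χ
  refine ⟨D, φ', hφ', ?_⟩
  have := hR.map χ' h
  rwa [map_map_apply, map_map_apply, ← e, ← map_map_apply, ← map_map_apply] at this

/-- The partner over B is unique, so its two images over any C on which A → B equalizes agree, and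
it descends to A. -/
theorem exists_locallyRelated (hR : IsLocalRotation P R) (hG : IsFaithfullyFlatSheaf G)
    {A : CommAlgCat.{u} F} (θ : P.sub A) : ∃ η : P.sub A, LocallyRelated R θ.1 η.1 := by
  obtain ⟨B, φ, hφ, η', h⟩ := hR.exists_map θ.1 θ.2
  obtain ⟨η, rfl⟩ := hG.exists_map_eq φ hφ η' fun C p q e => by
    have h1 := hR.map p h
    have h2 := hR.map q h
    rw [map_map_apply] at h1 h2
    rw [← e] at h2
    exact hR.unique h1 h2
  -- By rotation the partner is itself the first member of a related pair, hence lies in P.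
  obtain ⟨ζ, hζ, -⟩ := hR.rotate h
  exact ⟨⟨η, hR.mem_of_map_mem φ hφ η (hR.mem hζ)⟩, B, φ, hφ, h⟩

theorem locallyRelated_rotate (hR : IsLocalRotation P R)
    {A : CommAlgCat.{u} F} {θ η ζ : G.obj A} (h : LocallyRelated R θ η)
    (h' : LocallyRelated R η ζ) : LocallyRelated R ζ θ := by
  obtain ⟨B, φ, hφ, h1, h2⟩ := hR.common_extension h h'
  obtain ⟨ζ', h3, h4⟩ := hR.rotate h1
  obtain rfl := hR.unique h3 h2
  exact ⟨B, φ, hφ, h4⟩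

/-- The endomorphism of `P` whose graph is locally the relation `R`. -/
theorem exists_hom (hR : IsLocalRotation P R) (hG : IsFaithfullyFlatSheaf G) :
    ∃ ρ : P.toFunctor ⟶ P.toFunctor, ∀ (A : CommAlgCat.{u} F) (θ : P.toFunctor.obj A),
      LocallyRelated R θ.1 (ρ.app A θ).1 := by
  choose r hr using fun (A : CommAlgCat.{u} F) (θ : P.sub A) => hR.exists_locallyRelated hG θ
  refine ⟨{ app := fun A => GrpCat.ofHom (MonoidHom.mk' (r A) fun θ θ' => Subtype.ext ?_)
            naturality := fun A B φ => ?_ }, hr⟩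
  · exact hR.locallyRelated_unique hG (hr A (θ * θ')) (hR.locallyRelated_mul (hr A θ) (hr A θ'))
  · ext θ
    exact Subtype.ext
      (hR.locallyRelated_unique hG (hr B (P.toFunctor.map φ θ)) (hR.locallyRelated_map φ (hr A θ)))

/-- Rotation gives ρ³ = 1, so ρ² is the inverse of ρ. -/
theorem exists_iso (hR : IsLocalRotation P R) (hG : IsFaithfullyFlatSheaf G) :
    ∃ ρ : P.toFunctor ≅ P.toFunctor, ∀ (A : CommAlgCat.{u} F) (θ : P.toFunctor.obj A),
      LocallyRelated R θ.1 (ρ.hom.app A θ).1 := by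
  obtain ⟨ρ, hρ⟩ := hR.exists_hom hG
  have h (A : CommAlgCat.{u} F) (θ : P.toFunctor.obj A) :
      ρ.app A (ρ.app A (ρ.app A θ)) = θ :=
    Subtype.ext (hR.locallyRelated_unique hG (hρ A _)
      (hR.locallyRelated_rotate (hρ A θ) (hρ A _)))
  refine ⟨⟨ρ, ρ ≫ ρ, ?_, ?_⟩, hρ⟩ <;>
  · ext A θ
    exact h A θ

theorem iso_unique (hR : IsLocalRotation P R) (hG : IsFaithfullyFlatSheaf G)
    {ρ ρ' : P.toFunctor ≅ P.toFunctor}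
    (h : ∀ (A : CommAlgCat.{u} F) (θ : P.toFunctor.obj A),
      LocallyRelated R θ.1 (ρ.hom.app A θ).1)
    (h' : ∀ (A : CommAlgCat.{u} F) (θ : P.toFunctor.obj A),
      LocallyRelated R θ.1 (ρ'.hom.app A θ).1) : ρ = ρ' := by
  ext A θ
  exact Subtype.ext (hR.locallyRelated_unique hG (h A θ) (h' A θ))

end IsLocalRotation

end LocalRotation

/-! ### Faithfully flat descent for Aut(End S) and GL(S) -/

section Sheaf

variable {F : Type u} [Field F] {S : Type v} [AddCommGroup S] [Module F S]
  {A B : Type u} [CommRing A] [Algebra F A] [CommRing B] [Algebra F B]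

theorem extVec_injective {φ : A →ₐ[F] B} (hφ : Function.Injective φ) :
    Function.Injective (extVec (S := S) φ) :=
  Module.Flat.rTensor_preserves_injective_linearMap _ hφ

variable [FiniteDimensional F S]

theorem extAut_injective {φ : A →ₐ[F] B} (hφ : Function.Injective φ) :
    Function.Injective (extAut (Module.End F S) φ) := fun θ η h => by
  refine AlgEquiv.ext fun x => extAlg_injective hφ ?_
  rw [← extAut_extAlg, ← extAut_extAlg, h]

/-- Preimages are chosen pointwise; injectivity makes them unique, and therefore compatible with the
algebra structure. -/
theorem exists_algHom_extAlg {φ : A →ₐ[F] B} (hφ : Function.Injective φ)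
    (θ : B ⊗[F] Module.End F S →ₐ[B] B ⊗[F] Module.End F S)
    (h : ∀ x, ∃ y, extAlg _ φ y = θ (extAlg _ φ x)) :
    ∃ η : A ⊗[F] Module.End F S →ₐ[A] A ⊗[F] Module.End F S,
      ∀ x, extAlg _ φ (η x) = θ (extAlg _ φ x) := by
  choose η hη using h
  refine ⟨AlgHom.ofLinearMap ⟨⟨η, fun x y => ?_⟩, fun a x => ?_⟩ ?_ fun x y => ?_, hη⟩ <;>
    apply extAlg_injective hφ
  · simp only [hη, map_add]
  · change extAlg _ φ (η (a • x)) = extAlg _ φ (a • η x)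
    rw [hη, extAlg_smul, extAlg_smul, map_smul, hη]
  · change extAlg _ φ (η 1) = _
    rw [hη, map_one, map_one]
  · change extAlg _ φ (η (x * y)) = extAlg _ φ (η x * η y)
    simp only [hη, map_mul]

theorem injective_of_faithfullyFlat {A B : CommAlgCat.{u} F} {φ : A ⟶ B}
    (hφ : φ.hom.toRingHom.FaithfullyFlat) : Function.Injective φ.hom :=
  hφ.injective

theorem exists_extAlg_eq_of_faithfullyFlat {A B : CommAlgCat.{u} F} (φ : A ⟶ B)
    (hφ : φ.hom.toRingHom.FaithfullyFlat) (x : B ⊗[F] Module.End F S)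
    (hx : ∀ (C : CommAlgCat.{u} F) (p q : B ⟶ C), φ ≫ p = φ ≫ q →
      extAlg _ p.hom x = extAlg _ q.hom x) : ∃ y, extAlg _ φ.hom y = x := by
  obtain ⟨C, p, q, e, hpq⟩ := exists_kernelPair φ hφ
  exact exists_extAlg_eq hpq x (hx C p q e)

theorem extAlg_extAlg {E : Type v} [Ring E] [Algebra F E] {C : Type u} [CommRing C] [Algebra F C]
    (φ : A →ₐ[F] B) (χ : B →ₐ[F] C) (x : A ⊗[F] E) :
    extAlg E χ (extAlg E φ x) = extAlg E (χ.comp φ) x := by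
  have : (extAlg E χ).comp (extAlg E φ) = extAlg E (χ.comp φ) := by
    ext <;> simp [extAlg]
  exact DFunLike.congr_fun this x

theorem exists_extAut_eq_of_faithfullyFlat {A B : CommAlgCat.{u} F} (φ : A ⟶ B)
    (hφ : φ.hom.toRingHom.FaithfullyFlat) (θ : B ⊗[F] Module.End F S ≃ₐ[B] B ⊗[F] Module.End F S)
    (hθ : ∀ (C : CommAlgCat.{u} F) (p q : B ⟶ C), φ ≫ p = φ ≫ q →
      extAut _ p.hom θ = extAut _ q.hom θ) : ∃ η, extAut _ φ.hom η = θ := by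
  have hinj := injective_of_faithfullyFlat hφ
  have key (η : B ⊗[F] Module.End F S ≃ₐ[B] B ⊗[F] Module.End F S)
      (hη : ∀ (C : CommAlgCat.{u} F) (p q : B ⟶ C), φ ≫ p = φ ≫ q →
        extAut _ p.hom η = extAut _ q.hom η) :
      ∃ η' : A ⊗[F] Module.End F S →ₐ[A] A ⊗[F] Module.End F S,
        ∀ x, extAlg _ φ.hom (η' x) = η (extAlg _ φ.hom x) := by
    refine exists_algHom_extAlg hinj η.toAlgHom fun x =>
      exists_extAlg_eq_of_faithfullyFlat φ hφ _ fun C p q e => ?_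
    change extAlg _ p.hom (η _) = extAlg _ q.hom (η _)
    have e' : p.hom.comp φ.hom = q.hom.comp φ.hom := congrArg CommAlgCat.Hom.hom e
    rw [← extAut_extAlg, ← extAut_extAlg, extAlg_extAlg, extAlg_extAlg, hη C p q e, e']
  obtain ⟨η, hη⟩ := key θ hθ
  -- The inverse satisfies the same descent condition, and descending it too yields an automorphism
  -- rather than an endomorphism.
  obtain ⟨ζ, hζ⟩ := key θ⁻¹ fun C p q e => by rw [map_inv, map_inv, hθ C p q e]
  have h1 : η.comp ζ = AlgHom.id A _ := by
    refine AlgHom.ext fun x => extAlg_injective hinj ?_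
    change extAlg _ φ.hom (η (ζ x)) = extAlg _ φ.hom x
    rw [hη, hζ]
    exact θ.apply_symm_apply _
  have h2 : ζ.comp η = AlgHom.id A _ := by
    refine AlgHom.ext fun x => extAlg_injective hinj ?_
    change extAlg _ φ.hom (ζ (η x)) = extAlg _ φ.hom x
    rw [hζ, hη]
    exact θ.symm_apply_apply _
  exact ⟨AlgEquiv.ofAlgHom η ζ h1 h2, (extAut_unique _ φ.hom _ θ fun x => (hη x).symm).symm⟩

variable (F S) in
theorem isFaithfullyFlatSheaf_autAlgFunctor :
    IsFaithfullyFlatSheaf (AutAlgFunctor F (Module.End F S)) where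
  injective _ hφ := extAut_injective (injective_of_faithfullyFlat hφ)
  exists_map_eq := exists_extAut_eq_of_faithfullyFlat

theorem exists_units_map_eq_of_faithfullyFlat {A B : CommAlgCat.{u} F} (φ : A ⟶ B)
    (hφ : φ.hom.toRingHom.FaithfullyFlat) (f : (B ⊗[F] Module.End F S)ˣ)
    (hf : ∀ (C : CommAlgCat.{u} F) (p q : B ⟶ C), φ ≫ p = φ ≫ q →
      (GLFunctor F S).map p f = (GLFunctor F S).map q f) :
    ∃ g : (A ⊗[F] Module.End F S)ˣ, (GLFunctor F S).map φ g = f := by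
  have hinj := injective_of_faithfullyFlat hφ
  obtain ⟨y, hy⟩ := exists_extAlg_eq_of_faithfullyFlat φ hφ f.1 fun C p q e =>
    congrArg Units.val (hf C p q e)
  obtain ⟨z, hz⟩ := exists_extAlg_eq_of_faithfullyFlat φ hφ (f⁻¹ : (B ⊗[F] Module.End F S)ˣ).1
    fun C p q e => congrArg (fun u : (C ⊗[F] Module.End F S)ˣ => (u⁻¹).1) (hf C p q e)
  refine ⟨⟨y, z, ?_, ?_⟩, Units.ext hy⟩ <;>
    apply extAlg_injective hinj
  · rw [map_mul, hy, hz, map_one, Units.mul_inv]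
  · rw [map_mul, hy, hz, map_one, Units.inv_mul]

end Sheaf

/-! ### Related triples under scalar extension and multiplication -/

namespace SymmetricComposition

variable {F : Type u} [Field F] {S : Type v} [AddCommGroup S] [Module F S]
  {n : QuadraticForm F S} (c : SymmetricComposition n) {A : Type u} [CommRing A] [Algebra F A]
  {B : Type u} [CommRing B] [Algebra F B]

theorem extMul_extVec (φ : A →ₐ[F] B) (X Y : A ⊗[F] S) :
    c.extMul B (extVec φ X) (extVec φ Y) = extVec φ (c.extMul A X Y) := by
  induction X with
  | zero => simp
  | add X X' hX hX' => simp only [map_add, LinearMap.add_apply, hX, hX']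
  | tmul a x =>
    induction Y with
    | zero => simp
    | add Y Y' hY hY' => simp only [map_add, hY, hY']
    | tmul b y => simp [extMul, extVec]

variable {c} in
theorem extMul_act_ext {f g h : A ⊗[F] Module.End F S} {a : A}
    (H : ∀ X Y, c.extMul A (act f X) (act g Y) = a • act h (c.extMul A X Y)) (φ : A →ₐ[F] B)
    (X Y : B ⊗[F] S) : c.extMul B (act (extAlg _ φ f) X) (act (extAlg _ φ g) Y) =
      φ a • act (extAlg _ φ h) (c.extMul B X Y) := by
  have h3 (b : B) (x : S) : b ⊗ₜ[F] x = b • extVec φ ((1 : A) ⊗ₜ[F] x) := by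
    rw [extVec_one_tmul, smul_tmul', smul_eq_mul, mul_one]
  induction X with
  | zero => simp only [map_zero, LinearMap.zero_apply, smul_zero]
  | add X X' hX hX' => simp only [map_add, LinearMap.add_apply, smul_add, hX, hX']
  | tmul b x =>
    induction Y with
    | zero => simp only [map_zero, smul_zero]
    | add Y Y' hY hY' => simp only [map_add, smul_add, hY, hY']
    | tmul b' y =>
      rw [h3 b x, h3 b' y]
      simp only [map_smul, LinearMap.smul_apply, act_extAlg, extMul_extVec, H, extVec_smul]
      simp only [smul_smul]
      congr 1
      ring

variable {c}

theorem Preserves.of_ext {B : Type u} [CommRing B] [Algebra F B] {φ : A →ₐ[F] B}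
    (hφ : Function.Injective φ) {f : A ⊗[F] Module.End F S} (hf : c.Preserves (extAlg _ φ f)) :
    c.Preserves f := fun X Y => by
  apply extVec_injective hφ
  rw [← act_extAlg, ← extMul_extVec, hf, act_extAlg, act_extAlg, extMul_extVec]

variable [FiniteDimensional F S]

theorem IsRelated.map {A B : CommAlgCat.{u} F} (φ : A ⟶ B) {f g h : (A ⊗[F] Module.End F S)ˣ}
    {μ ν : Aˣ} (H : c.IsRelated f g h μ ν) :
    c.IsRelated ((GLFunctor F S).map φ f) ((GLFunctor F S).map φ g) ((GLFunctor F S).map φ h)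
      (Units.map (φ.hom : A →* B) μ) (Units.map (φ.hom : A →* B) ν) where
  left := H.left.ext φ.hom
  mid := H.mid.ext φ.hom
  right := by
    rw [← map_mul]
    exact H.right.ext φ.hom
  left_mul_mid X Y := by
    have := extMul_act_ext (a := 1) (fun X Y => by rw [H.left_mul_mid, one_smul]) φ.hom X Y
    rwa [map_one, one_smul] at this
  right_mul_left := extMul_act_ext H.right_mul_left φ.hom
  mid_mul_right := extMul_act_ext H.mid_mul_right φ.hom

theorem IsRelated.mul {f g h f' g' h' : (A ⊗[F] Module.End F S)ˣ} {μ ν μ' ν' : Aˣ}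
    (H : c.IsRelated f g h μ ν) (H' : c.IsRelated f' g' h' μ' ν') :
    c.IsRelated (f * f') (g * g') (h * h') (μ * μ') (ν * ν') where
  left := H.left.mul H'.left
  mid := H.mid.mul H'.mid
  right := by
    rw [mul_mul_mul_comm]
    exact H.right.mul H'.right
  left_mul_mid X Y := by
    simp only [Units.val_mul, act_mul, H.left_mul_mid, H'.left_mul_mid]
  right_mul_left X Y := by
    simp only [Units.val_mul, act_mul, H.right_mul_left, H'.right_mul_left, map_smul, smul_smul]
  mid_mul_right X Y := by
    simp only [Units.val_mul, act_mul, H.mid_mul_right, H'.mid_mul_right, map_smul, smul_smul]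

end SymmetricComposition

/-! ### Existence and uniqueness of the triality automorphism -/

namespace SymmetricComposition

variable {F : Type u} [Field F] {S : Type v} [AddCommGroup S] [Module F S] [FiniteDimensional F S]
  {n : QuadraticForm F S} (c : SymmetricComposition n)

/-- The automorphisms `[f]` and `[g]`, for the related triples `(f, g, h)`. -/
def Related (A : CommAlgCat.{u} F) (θ η : (AutAlgFunctor F (Module.End F S)).obj A) : Prop :=
  ∃ (f g h : (A ⊗[F] Module.End F S)ˣ) (μ ν : Aˣ), c.IsRelated f g h μ ν ∧
    intHom.app A f = θ ∧ intHom.app A g = η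

variable {c} in
theorem IsRelated.mem_GOPlus (hn : n.polarBilin.SeparatingLeft) (hdim : Module.finrank F S = 8)
    {A : CommAlgCat.{u} F} {f g h : (A ⊗[F] Module.End F S)ˣ} {μ ν : Aˣ}
    (H : c.IsRelated f g h μ ν) : f ∈ (GOPlus n).sub A :=
  (H.dPlus hn).isProperSimilarity hdim

variable {c} in
theorem IsRelated.innerAut_eq (hn : n.polarBilin.SeparatingLeft)
    (hdim : Module.finrank F S = 8) {A : Type u} [CommRing A] [Algebra F A]
    {f g h f' g' h' : (A ⊗[F] Module.End F S)ˣ} {μ ν μ' ν' : Aˣ}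
    (H : c.IsRelated f g h μ ν) (H' : c.IsRelated f' g' h' μ' ν')
    (e : innerAut A _ f = innerAut A _ f') : innerAut A _ g = innerAut A _ g' :=
  DPlus.innerAut_eq hdim (H.dPlus hn) (H'.dPlus hn) e

theorem intHom_app_eq_iff {F : Type u} [Field F] {S : Type v} [AddCommGroup S] [Module F S]
    {A : CommAlgCat.{u} F} (f f' : (A ⊗[F] Module.End F S)ˣ) :
    intHom.app A f = intHom.app A f' ↔ innerAut A _ f = innerAut A _ f' := Iff.rfl

theorem intHom_app_map {F : Type u} [Field F] {S : Type v} [AddCommGroup S] [Module F S]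
    {A B : CommAlgCat.{u} F} (φ : A ⟶ B) (f : (A ⊗[F] Module.End F S)ˣ) :
    intHom.app B ((GLFunctor F S).map φ f) =
      (AutAlgFunctor F (Module.End F S)).map φ (intHom.app A f) :=
  NatTrans.naturality_apply intHom φ f

theorem isLocalRotation_related (hn : n.polarBilin.SeparatingLeft)
    (hdim : Module.finrank F S = 8) : IsLocalRotation (PGOPlus n) c.Related where
  map := by
    rintro A B φ _ _ ⟨f, g, h, μ, ν, H, rfl, rfl⟩
    exact ⟨_, _, _, _, _, H.map φ, intHom_app_map φ f,
      intHom_app_map φ g⟩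
  mul := by
    rintro A _ _ _ _ ⟨f, g, h, μ, ν, H, rfl, rfl⟩ ⟨f', g', h', μ', ν', H', rfl, rfl⟩
    exact ⟨_, _, _, _, _, H.mul H', map_mul (intHom.app A).hom f f',
      map_mul (intHom.app A).hom g g'⟩
  unique := by
    rintro A _ _ _ ⟨f, g, h, μ, ν, H, rfl, rfl⟩ ⟨f', g', h', μ', ν', H', e, rfl⟩
    exact (intHom_app_eq_iff g g').mpr
      (H.innerAut_eq hn hdim H' ((intHom_app_eq_iff f f').mp e.symm))
  rotate := by
    rintro A _ _ ⟨f, g, h, μ, ν, H, rfl, rfl⟩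
    -- The next class is [h]; a second rotation leads from [h] to [νf], which equals [f].
    exact ⟨intHom.app A h, ⟨g, h, _, _, _, H.rotate, rfl, rfl⟩,
      ⟨h, _, _, _, _, H.rotate.rotate, rfl, innerAut_homothety_mul ν f⟩⟩
  mem := by
    rintro A _ _ ⟨f, g, h, μ, ν, H, rfl, rfl⟩
    exact ((canonicalMap n).app A ⟨f, H.mem_GOPlus hn hdim⟩).2
  mem_of_map_mem := by
    rintro A B φ hφ θ ⟨C, χ, hχ, f, hf, e⟩
    rw [map_map_apply] at e
    exact ⟨C, φ ≫ χ, RingHom.FaithfullyFlat.stableUnderComposition _ _ hφ hχ, f, hf, e⟩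
  exists_map := by
    rintro A θ ⟨B, φ, hφ, f, hf, e⟩
    obtain ⟨C, χ, hχ, g, h, μ, ν, H⟩ := c.exists_isRelated_ext hn hdim f hf
    refine ⟨C, φ ≫ χ, RingHom.FaithfullyFlat.stableUnderComposition _ _ hφ hχ, intHom.app C g,
      _, g, h, μ, ν, H, ?_, rfl⟩
    rw [← map_map_apply, e]
    exact intHom_app_map χ f

/-- The h of the diagram D⁺ need not complete f and g to a related triple, as D⁺ sees it only up to
a scalar. It is replaced by the one built from f and g, which is harmless since only [f] and [g]
matter. -/
theorem isTriality_iff (hn : n.polarBilin.SeparatingLeft) (hdim : Module.finrank F S = 8)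
    (ρ : (PGOPlus n).toFunctor ≅ (PGOPlus n).toFunctor) :
    c.IsTriality hn ρ ↔ ∀ (A : CommAlgCat.{u} F) (θ : (PGOPlus n).toFunctor.obj A),
      LocallyRelated c.Related θ.1 (ρ.hom.app A θ).1 := by
  have : Nontrivial S := Module.nontrivial_of_finrank_pos (R := F) (by omega)
  refine forall₂_congr fun A θ => ⟨?_, ?_⟩
  · rintro ⟨B, φ, f, g, h, hφ, H, e₁, e₂⟩
    obtain ⟨μ, hf, -⟩ := id H
    obtain ⟨h', ν, H'⟩ := c.exists_isRelated hn hdim hf (H.right_mul_left_mul hf)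
    exact ⟨B, φ, hφ, _, _, h', μ, ν, H', (congrArg Subtype.val e₁).symm,
      (congrArg Subtype.val e₂).symm⟩
  · rintro ⟨B, φ, hφ, f, g, h, μ, ν, H, e₁, e₂⟩
    exact ⟨B, φ, ⟨f, H.mem_GOPlus hn hdim⟩, ⟨g, H.rotate.mem_GOPlus hn hdim⟩,
      ⟨h, H.rotate.rotate.mem_GOPlus hn hdim⟩, hφ, H.dPlus hn, Subtype.ext e₁.symm,
      Subtype.ext e₂.symm⟩

theorem existsUnique_isTriality (hn : n.polarBilin.SeparatingLeft)
    (hdim : Module.finrank F S = 8) :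
    ∃! ρ : (PGOPlus n).toFunctor ≅ (PGOPlus n).toFunctor, c.IsTriality hn ρ := by
  have hR := c.isLocalRotation_related hn hdim
  have hG := isFaithfullyFlatSheaf_autAlgFunctor F S
  obtain ⟨ρ, hρ⟩ := hR.exists_iso hG
  exact ⟨ρ, (c.isTriality_iff hn hdim ρ).mpr hρ, fun ρ' hρ' =>
    hR.iso_unique hG ((c.isTriality_iff hn hdim ρ').mp hρ') hρ⟩

/-! ### Automorphisms of ⋆ and fixed points of triality -/

section Preserves

variable {A : Type u} [CommRing A] [Algebra F A] {c}

/-- Computing n(f(x ⋆ x)) in two ways gives μλn(x)² = λμ²n(x)², with n(x) ≠ 0 for some x in S. -/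
theorem Preserves.multiplier_eq_one (hn : n.polarBilin.SeparatingLeft) [Nontrivial S]
    {f : A ⊗[F] Module.End F S} {μ : Aˣ} (hf : IsSimilarity n f μ) (hp : c.Preserves f) :
    μ = 1 := by
  obtain ⟨x, hx⟩ := exists_apply_ne_zero hn
  have h1 := congrArg (extForm A n) (hp (1 ⊗ₜ x) (1 ⊗ₜ x))
  rw [hf, extForm_extMul, extForm_extMul, hf, extForm_tmul, mul_one, one_mul] at h1
  have hu : IsUnit (algebraMap F A c.multiplier.1 * algebraMap F A (n x) * algebraMap F A (n x) *
      μ.1) :=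
    (((c.multiplier.isUnit.map (algebraMap F A)).mul ((IsUnit.mk0 _ hx).map (algebraMap F A))).mul
      ((IsUnit.mk0 _ hx).map (algebraMap F A))).mul μ.isUnit
  refine Units.ext (hu.mul_left_cancel ?_)
  rw [Units.val_one]
  linear_combination -h1

theorem Preserves.isRelated (hn : n.polarBilin.SeparatingLeft) [Nontrivial S]
    {f : (A ⊗[F] Module.End F S)ˣ} {μ : Aˣ} (hf : IsSimilarity n f.1 μ) (hp : c.Preserves f.1) :
    c.IsRelated f f f 1 1 := by
  obtain rfl := hp.multiplier_eq_one hn hf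
  exact ⟨hf, hf, by rwa [one_mul], fun X Y => (hp X Y).symm,
    fun X Y => by rw [hp, Units.val_one, one_smul], fun X Y => by rw [hp, Units.val_one, one_smul]⟩

/-- If f' and af' both preserve ⋆, then a² = a on all products x ⋆ y, so a acts trivially on them;
as ℓ_x r_x is an invertible scalar for suitable x, a = 1. -/
theorem Preserves.eq_of_innerAut_eq (hn : n.polarBilin.SeparatingLeft) [Nontrivial S]
    {f f' : (A ⊗[F] Module.End F S)ˣ} (hp : c.Preserves f.1) (hp' : c.Preserves f'.1)
    (h : innerAut A _ f = innerAut A _ f') : f = f' := by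
  obtain ⟨a, rfl⟩ := (innerAut_eq_iff _ _).mp h
  obtain ⟨x, hx⟩ := exists_apply_ne_zero hn
  have h1 (X Y : A ⊗[F] S) : a.1 • c.extMul A X Y = c.extMul A X Y := by
    have h2 := hp X Y
    rw [act_homothety_mul, act_homothety_mul, act_homothety_mul, map_smul, map_smul,
      LinearMap.smul_apply, ← hp'] at h2
    have h3 := congrArg (act (f'⁻¹ : (A ⊗[F] Module.End F S)ˣ).1)
      (a.isUnit.smul_left_cancel.mp h2)
    rw [map_smul, ← act_mul, Units.inv_mul, act_one] at h3
    exact h3.symm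
  have h2 : a.1 • c.left.baseChange A (1 ⊗ₜ x) = c.left.baseChange A (1 ⊗ₜ x) :=
    act_injective (LinearMap.ext fun Y => by rw [act_smul, act_left, h1])
  have h3 : c.left.baseChange A (1 ⊗ₜ x) * c.right.baseChange A (1 ⊗ₜ x) = _ :=
    baseChange_mul_baseChange n c.left c.right _ (c.left_mul_right hn) _
  have h4 := congrArg (· * c.right.baseChange A (1 ⊗ₜ x)) h2
  simp only [smul_mul_assoc, h3] at h4
  have h5 := (map_mul (algebraMap A (A ⊗[F] Module.End F S)) _ _).trans
    ((Algebra.smul_def _ _).symm.trans h4)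
  have hu : IsUnit (algebraMap F A c.multiplier.1 * extForm A n (1 ⊗ₜ x)) := by
    rw [extForm_tmul, mul_one, one_mul]
    exact (c.multiplier.isUnit.map (algebraMap F A)).mul ((IsUnit.mk0 _ hx).map (algebraMap F A))
  have ha : a.1 = 1 := hu.mul_right_cancel (by rw [algebraMap_end_injective h5, one_mul])
  rw [show a = 1 from Units.ext ha, homothety, map_one, one_mul]

/-- With g = af and h = df the first identity becomes f(x) ⋆ f(y) = s f(x ⋆ y), where s = a⁻¹d.
Multiplying f by s⁻¹ makes the left side quadratic in s⁻¹ and the right side linear, which removes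
s. -/
theorem IsRelated.exists_preserves [Nontrivial S] {f g h : (A ⊗[F] Module.End F S)ˣ} {μ ν : Aˣ}
    (H : c.IsRelated f g h μ ν) (hg : innerAut A _ g = innerAut A _ f)
    (hh : innerAut A _ h = innerAut A _ f) : ∃ b, c.Preserves (homothety S b * f).1 := by
  obtain ⟨a, rfl⟩ := (innerAut_eq_iff _ _).mp hg
  obtain ⟨d, rfl⟩ := (innerAut_eq_iff _ _).mp hh
  have h1 (X Y) : c.extMul A (act f.1 X) (act f.1 Y) = (a⁻¹ * d).1 • act f.1 (c.extMul A X Y) := by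
    have := H.left_mul_mid X Y
    rw [act_homothety_mul, act_homothety_mul, map_smul] at this
    rw [Units.val_mul, mul_smul, ← this, smul_smul, Units.inv_mul, one_smul]
  refine ⟨(a⁻¹ * d)⁻¹, fun X Y => ?_⟩
  rw [act_homothety_mul, act_homothety_mul, act_homothety_mul, map_smul, map_smul,
    LinearMap.smul_apply, h1, smul_smul _ (a⁻¹ * d).1, Units.inv_mul, one_smul]

end Preserves

end SymmetricComposition

theorem IsSimilarity.of_ext {F : Type u} [Field F] {S : Type v} [AddCommGroup S]
    [Module F S] [FiniteDimensional F S] {n : QuadraticForm F S} {A B : Type u}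
    [CommRing A] [Algebra F A] [CommRing B] [Algebra F B] {φ : A →ₐ[F] B}
    (hφ : Function.Injective φ) {f : A ⊗[F] Module.End F S}
    (hf : IsSimilarity n (extAlg _ φ f) 1) : IsSimilarity n f 1 := fun X => by
  apply hφ
  rw [← extForm_extVec, ← act_extAlg, hf, Units.val_one, one_mul, Units.val_one, one_mul,
    extForm_extVec]

namespace SymmetricComposition

variable {F : Type u} [Field F] {S : Type v} [AddCommGroup S] [Module F S] [FiniteDimensional F S]
  {n : QuadraticForm F S} (c : SymmetricComposition n)

theorem autScheme_le_GOPlus (hn : n.polarBilin.SeparatingLeft) (hdim : Module.finrank F S = 8)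
    (A : CommAlgCat.{u} F) : c.autScheme.sub A ≤ (GOPlus n).sub A := by
  have : Nontrivial S := Module.nontrivial_of_finrank_pos (R := F) (by omega)
  rintro f ⟨⟨μ, hf⟩, hp⟩
  exact (hp.isRelated hn hf).mem_GOPlus hn hdim

/-- The inclusion of `Aut(⋆)` in `GO⁺(n)`. -/
def autSchemeToGOPlus (hn : n.polarBilin.SeparatingLeft) (hdim : Module.finrank F S = 8) :
    c.autScheme.toFunctor ⟶ (GOPlus n).toFunctor where
  app A := GrpCat.ofHom (Subgroup.inclusion (c.autScheme_le_GOPlus hn hdim A))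
  naturality _ _ _ := rfl

variable {c}

theorem IsTriality.apply_eq_self {hn : n.polarBilin.SeparatingLeft}
    (hdim : Module.finrank F S = 8) {ρ : (PGOPlus n).toFunctor ≅ (PGOPlus n).toFunctor}
    (hρ : c.IsTriality hn ρ) (A : CommAlgCat.{u} F) (f : c.autScheme.toFunctor.obj A) :
    ρ.hom.app A ((canonicalMap n).app A ((c.autSchemeToGOPlus hn hdim).app A f)) =
      (canonicalMap n).app A ((c.autSchemeToGOPlus hn hdim).app A f) := by
  have : Nontrivial S := Module.nontrivial_of_finrank_pos (R := F) (by omega)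
  obtain ⟨f, ⟨μ, hf⟩, hp⟩ := f
  refine Subtype.ext ((c.isLocalRotation_related hn hdim).locallyRelated_unique
    (isFaithfullyFlatSheaf_autAlgFunctor F S) ((c.isTriality_iff hn hdim ρ).mp hρ A _)
    ⟨A, 𝟙 A, .of_bijective Function.bijective_id, ?_⟩)
  rw [CategoryTheory.Functor.map_id]
  exact ⟨f, f, f, 1, 1, hp.isRelated hn hf, rfl, rfl⟩

theorem exists_preserves_of_locallyRelated (hn : n.polarBilin.SeparatingLeft)
    (hdim : Module.finrank F S = 8) {A : CommAlgCat.{u} F}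
    {θ : (AutAlgFunctor F (Module.End F S)).obj A} (hθ : LocallyRelated c.Related θ θ) :
    ∃ f ∈ c.autScheme.sub A, intHom.app A f = θ := by
  have : Nontrivial S := Module.nontrivial_of_finrank_pos (R := F) (by omega)
  obtain ⟨B, φ, hφ, f, g, h, μ, ν, H, hf, hg⟩ := hθ
  have hgf : innerAut B _ g = innerAut B _ f := hg.trans hf.symm
  -- The triples (g, h, νf) and (f, g, h) have the same first class, hence the same second class:
  -- [h] = [g].
  have hh : innerAut B _ h = innerAut B _ f :=
    (H.rotate.innerAut_eq hn hdim H hgf).trans hgf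
  obtain ⟨f₁, hb, hs, hclass⟩ : ∃ f₁ : (B ⊗[F] Module.End F S)ˣ, c.Preserves f₁.1 ∧
      IsSimilarity n f₁.1 1 ∧ intHom.app B f₁ = (AutAlgFunctor F (Module.End F S)).map φ θ := by
    obtain ⟨b, hb⟩ := H.exists_preserves hgf hh
    have hs := isSimilarity_homothety_mul H.left b
    rw [hb.multiplier_eq_one hn hs] at hs
    exact ⟨_, hb, hs, (innerAut_homothety_mul b f).trans hf⟩
  -- The two pullbacks of f₁ preserve ⋆ and have the same class, which comes from A. Uniqueness of
  -- the automorphism in its class makes them equal, so f₁ descends.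
  obtain ⟨f₀, hf₀⟩ := exists_units_map_eq_of_faithfullyFlat φ hφ f₁ fun C p q e => by
    refine Preserves.eq_of_innerAut_eq (f := (GLFunctor F S).map p f₁)
      (f' := (GLFunctor F S).map q f₁) hn (hb.ext p.hom) (hb.ext q.hom)
      ((intHom_app_eq_iff _ _).mp ?_)
    rw [intHom_app_map, intHom_app_map, hclass, map_map_apply, map_map_apply, e]
  have hinj := injective_of_faithfullyFlat hφ
  have hf₀' : extAlg _ φ.hom f₀.1 = f₁.1 := congrArg Units.val hf₀
  rw [← hf₀'] at hb hs
  refine ⟨f₀, ⟨⟨1, IsSimilarity.of_ext hinj hs⟩, Preserves.of_ext hinj hb⟩,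
    (isFaithfullyFlatSheaf_autAlgFunctor F S).injective φ hφ ?_⟩
  rw [← hclass, ← hf₀, intHom_app_map]

theorem IsTriality.exists_iso_fixedPoints {hn : n.polarBilin.SeparatingLeft}
    (hdim : Module.finrank F S = 8) {ρ : (PGOPlus n).toFunctor ≅ (PGOPlus n).toFunctor}
    (hρ : c.IsTriality hn ρ) : ∃ e : c.autScheme.toFunctor ≅ (fixedPoints ρ).toFunctor,
      e.hom ≫ (fixedPoints ρ).incl = c.autSchemeToGOPlus hn hdim ≫ canonicalMap n := by
  have : Nontrivial S := Module.nontrivial_of_finrank_pos (R := F) (by omega)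
  let e (A : CommAlgCat.{u} F) : c.autScheme.sub A →* (fixedPoints ρ).sub A :=
    ((c.autSchemeToGOPlus hn hdim ≫ canonicalMap n).app A).hom.codRestrict ((fixedPoints ρ).sub A)
      (hρ.apply_eq_self hdim A)
  have he (A) : Function.Bijective (e A) := by
    constructor
    · rintro ⟨f, hf⟩ ⟨f', hf'⟩ h
      have h1 : innerAut A _ f = innerAut A _ f' :=
        congrArg (fun x : (fixedPoints ρ).sub A => x.1.1) h
      exact Subtype.ext (hf.2.eq_of_innerAut_eq hn hf'.2 h1)
    · rintro ⟨θ, hθ⟩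
      have h1 := (c.isTriality_iff hn hdim ρ).mp hρ A θ
      rw [show ρ.hom.app A θ = θ from hθ] at h1
      obtain ⟨f, hf, h2⟩ := exists_preserves_of_locallyRelated hn hdim h1
      exact ⟨⟨f, hf⟩, Subtype.ext (Subtype.ext h2)⟩
  refine ⟨NatIso.ofComponents (fun A => (MulEquiv.ofBijective (e A) (he A)).toGrpIso)
    fun {A B} φ => ?_, rfl⟩
  ext f
  exact Subtype.ext (NatTrans.naturality_apply (c.autSchemeToGOPlus hn hdim ≫ canonicalMap n) φ f)

end SymmetricComposition

end Triality
end

theorem mainTheorem4 {F : Type*} [Field F] {S : Type*} [AddCommGroup S] [Module F S]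
    [FiniteDimensional F S] (hdim : Module.finrank F S = 8) (n : QuadraticForm F S)
    (hn : n.polarBilin.SeparatingLeft) (c : Triality.SymmetricComposition n) :
    (∃! ρ : (Triality.PGOPlus n).toFunctor ≅ (Triality.PGOPlus n).toFunctor,
      c.IsTriality hn ρ) ∧
    ∀ ρ : (Triality.PGOPlus n).toFunctor ≅ (Triality.PGOPlus n).toFunctor,
      c.IsTriality hn ρ →
      ∃ ι : c.autScheme.toFunctor ⟶ (Triality.GOPlus n).toFunctor,
        ι ≫ (Triality.GOPlus n).incl = c.autScheme.incl ∧
        ∃ e : c.autScheme.toFunctor ≅ (Triality.fixedPoints ρ).toFunctor,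
          e.hom ≫ (Triality.fixedPoints ρ).incl = ι ≫ Triality.canonicalMap n :=
  ⟨c.existsUnique_isTriality hn hdim, fun _ hρ =>
    ⟨c.autSchemeToGOPlus hn hdim, rfl, hρ.exists_iso_fixedPoints hdim⟩⟩
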